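/- Let $M,d,k$ be positive integers with $k\le d$, and let $B^\star\in\mathbb R^{d\times k}$ satisfy $(B^\star)^\top B^\star=I_k$. Client $i\in\{1,\dots,M\}$ holds an even number $n_i\ge 2$ of samples $(x_{ij},y_{ij})\in\mathbb R^d\times\mathbb R$, $1\le j\le n_i$; all samples are mutually independent, $x_{ij}\sim N(0,I_d)$, $y_{ij}$ is integrable and $$\mathbb E[y_{ij}\mid x_{ij}]=h_i\big((B^\star)^\top x_{ij}\big),\qquad h_i:\mathbb R^k\to\mathbb R .$$ For $U\sim N(0,I_k)$ put $\alpha_i^\star=\mathbb E[h_i(U)U]\in\mathbb R^k$, let $N=\sum_{i=1}^M n_i$, and let $\lambda_1$ and $\lambda_k$ be the largest and smallest eigenvalues of the diversity matrix $D=\frac1N\sum_{i=1}^M n_i\,\alpha_i^\star(\alpha_i^\star)^\top$; assume $\lambda_k>0$. Suppose that, for constants $a,L,m,\sigma$ and all $i,j$: 1. $\|\mathbb E[h_i(U)U]\|\le a$; 2. $|h_i(u)-h_i(v)|\le L\|u-v\|$ for all $u,v\in\mathbb R^k$; 3. $|\mathbb E[h_i(U)]|\le m$; 4. for every $t\in\mathbb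 R$, the variable $\exp\big(t(y_{ij}-\mathbb E[y_{ij}\mid x_{ij}])\big)$ is integrable and $\mathbb E\big[\exp\big(t(y_{ij}-\mathbb E[y_{ij}\mid x_{ij}])\big)\,\big|\,x_{ij}\big]\le\exp(\sigma^2t^2/2)$ almost surely. Let $$Z=\sum_{i=1}^M n_i\bigg(\frac2{n_i}\sum_{j=1}^{n_i/2}y_{ij}x_{ij}\bigg)\bigg(\frac2{n_i}\sum_{j=n_i/2+1}^{n_i}y_{ij}x_{ij}\bigg)^{\!\top},$$ let $\widehat B\in\mathbb R^{d\times k}$ be formed by top-$k$ right (or left) singular vectors of $Z$ (any choice of them), and let $\|\sin\Theta(\widehat B,B^\star)\|=\|\widehat B\widehat B^\top-B^\star(B^\star)^\top\|$ (spectral norm). Then there is a constant $C>0$, depending only on $a,L,m,\sigma$, such that with probability at least $1-C(d+N)^{-10}$ $$\|\sin\Theta(\widehat B,B^\star)\|\le C\bigg(\sqrt{\frac{d\lambda_1}{N\lambda_k^2}}+\sqrt{\frac{Md}{N^2\lambda_k^2}}\bigg)\log^3(d+N).$$ In particular, the same bound holds * for logistic regression, where $y_{ij}\in\{0,1\}$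 almost surely and $h_i(u)=1/(1+\exp(-u^\top\alpha_i))$ with $\|\alpha_i\|\le a$ for all $i$, with $C$ depending only on $a$; * for one-hidden-layer ReLU networks, where $h_i(u)=\sum_{r=1}^k\max\{0,u_r\}\,\alpha_{i,r}$ with $\|\alpha_i\|\le a$ and $\big|\sum_{r=1}^k\alpha_{i,r}\big|\le m$ for all $i$, under condition 4, with $C$ depending only on $a,m,\sigma$. -/

import Mathlib

open MeasureTheory ProbabilityTheory Matrix

namespace SharedRep

/-- The low-dimensional feature `Bᵀ x ∈ ℝᵏ` of a covariate `x ∈ ℝᵈ`. -/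
noncomputable def feature {d k : ℕ} (B : Matrix (Fin d) (Fin k) ℝ)
    (x : EuclideanSpace ℝ (Fin d)) : EuclideanSpace ℝ (Fin k) :=
  WithLp.toLp 2 (Bᵀ *ᵥ x.ofLp)

/-- The vector `E[h(U) U]` for `U ∼ N(0, I_k)`. -/
noncomputable def gaussianCorr {k : ℕ} (h : EuclideanSpace ℝ (Fin k) → ℝ) :
    EuclideanSpace ℝ (Fin k) :=
  ∫ u, h u • u ∂(stdGaussian (EuclideanSpace ℝ (Fin k)))

/-- The mean `E[h(U)]` for `U ∼ N(0, I_k)`. -/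
noncomputable def gaussianMean {k : ℕ} (h : EuclideanSpace ℝ (Fin k) → ℝ) : ℝ :=
  ∫ u, h u ∂(stdGaussian (EuclideanSpace ℝ (Fin k)))

/-- The total sample size `N = n₁ + ⋯ + n_M`. -/
def totalSize {M : ℕ} (n : Fin M → ℕ) : ℕ := ∑ i, n i

/-- The client diversity matrix `D = N⁻¹ ∑ᵢ nᵢ E[hᵢ(U)U] E[hᵢ(U)U]ᵀ`. -/
noncomputable def diversity {M k : ℕ} (n : Fin M → ℕ)
    (h : Fin M → EuclideanSpace ℝ (Fin k) → ℝ) : Matrix (Fin k) (Fin k) ℝ :=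
  (totalSize n : ℝ)⁻¹ •
    ∑ i, (n i : ℝ) • vecMulVec (gaussianCorr (h i)).ofLp (gaussianCorr (h i)).ofLp

/-- Average of `y_j x_j` over the first half `j < m / 2` of a client's `m` samples. -/
noncomputable def firstAverage {d m : ℕ} (x : Fin m → EuclideanSpace ℝ (Fin d))
    (y : Fin m → ℝ) : EuclideanSpace ℝ (Fin d) :=
  (2 / (m : ℝ)) • ∑ j : Fin m with j.val < m / 2, y j • x j

/-- Average of `y_j x_j` over the second half `m / 2 ≤ j` of a client's `m` samples. -/
noncomputable def secondAverage {d m : ℕ} (x : Fin m → EuclideanSpace ℝ (Fin d))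
    (y : Fin m → ℝ) : EuclideanSpace ℝ (Fin d) :=
  (2 / (m : ℝ)) • ∑ j : Fin m with m / 2 ≤ j.val, y j • x j

/-- The matrix `Z = ∑ᵢ nᵢ z̄ᵢ z̃ᵢᵀ` built from the two local averages of each client. -/
noncomputable def replicaMatrix {M d : ℕ} (n : Fin M → ℕ)
    (x : (i : Fin M) → Fin (n i) → EuclideanSpace ℝ (Fin d))
    (y : (i : Fin M) → Fin (n i) → ℝ) : Matrix (Fin d) (Fin d) ℝ :=
  ∑ i, (n i : ℝ) •
    vecMulVec (firstAverage (x i) (y i)).ofLp (secondAverage (x i) (y i)).ofLp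

/-- `Z = U diag(s) Vᵀ` is a singular value decomposition, with singular values in
nonincreasing order. -/
def IsSVD {d : ℕ} (Z U V : Matrix (Fin d) (Fin d) ℝ) (s : Fin d → ℝ) : Prop :=
  U ∈ orthogonalGroup (Fin d) ℝ ∧ V ∈ orthogonalGroup (Fin d) ℝ ∧
    Antitone s ∧ (∀ r, 0 ≤ s r) ∧ Z = U * diagonal s * Vᵀ

/-- The columns of `B` are top-`k` right singular vectors of `Z`, that is, the first `k` columns
of `V` in some singular value decomposition `Z = U diag(s) Vᵀ`. -/
def IsTopRightSingular {d k : ℕ} (Z : Matrix (Fin d) (Fin d) ℝ)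
    (B : Matrix (Fin d) (Fin k) ℝ) : Prop :=
  ∃ (hk : k ≤ d) (U V : Matrix (Fin d) (Fin d) ℝ) (s : Fin d → ℝ),
    IsSVD Z U V s ∧ B = V.submatrix id (Fin.castLE hk)

/-- The columns of `B` are top-`k` left singular vectors of `Z`, that is, the first `k` columns
of `U` in some singular value decomposition `Z = U diag(s) Vᵀ`. -/
def IsTopLeftSingular {d k : ℕ} (Z : Matrix (Fin d) (Fin d) ℝ)
    (B : Matrix (Fin d) (Fin k) ℝ) : Prop :=
  ∃ (hk : k ≤ d) (U V : Matrix (Fin d) (Fin d) ℝ) (s : Fin d → ℝ),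
    IsSVD Z U V s ∧ B = U.submatrix id (Fin.castLE hk)

/-- The principal angle distance `‖sin Θ(A, B)‖ = ‖A Aᵀ - B Bᵀ‖` (spectral norm). -/
noncomputable def sinTheta {d k : ℕ} (A B : Matrix (Fin d) (Fin k) ℝ) : ℝ :=
  ‖Matrix.toEuclideanCLM (𝕜 := ℝ) (A * Aᵀ - B * Bᵀ)‖

/-- The general model: `M` clients, client `i` holding an even number `nᵢ ≥ 2` of samples
`(x_ij, y_ij)`; all samples are independent, the covariates are standard Gaussian in `ℝᵈ`, the
responses are integrable and `E[y_ij | x_ij] = hᵢ(Bᵀ x_ij)` for a matrix `B` with orthonormal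
columns. -/
structure GeneralModel {Ω : Type*} [MeasurableSpace Ω] (μ : Measure Ω) {M d k : ℕ}
    (n : Fin M → ℕ) (B : Matrix (Fin d) (Fin k) ℝ)
    (h : Fin M → EuclideanSpace ℝ (Fin k) → ℝ)
    (x : (i : Fin M) → Fin (n i) → Ω → EuclideanSpace ℝ (Fin d))
    (y : (i : Fin M) → Fin (n i) → Ω → ℝ) : Prop where
  orthonormal : Bᵀ * B = 1
  two_le : ∀ i, 2 ≤ n i
  even : ∀ i, Even (n i)
  measurable_x : ∀ i j, Measurable (x i j)
  measurable_y : ∀ i j, Measurable (y i j)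
  indep : iIndepFun
    (fun (p : (i : Fin M) × Fin (n i)) ω ↦ (x p.1 p.2 ω, y p.1 p.2 ω)) μ
  gaussian : ∀ i j, μ.map (x i j) = stdGaussian (EuclideanSpace ℝ (Fin d))
  integrable_y : ∀ i j, Integrable (y i j) μ
  condMean : ∀ i j,
    μ[y i j | MeasurableSpace.comap (x i j) inferInstance] =ᵐ[μ] fun ω ↦ h i (feature B (x i j ω))

/-- Conditionally on `x`, the error `y - E[y | x]` is sub-gaussian with variance proxy `σ²`:
`E[exp(t (y - E[y | x])) | x] ≤ exp(σ² t² / 2)` almost surely, for every real `t`. -/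
def CondSubgaussianError {Ω E : Type*} [MeasurableSpace Ω] [MeasurableSpace E] (μ : Measure Ω)
    (x : Ω → E) (y : Ω → ℝ) (σ : ℝ) : Prop :=
  ∀ t : ℝ,
    Integrable
      (fun ω ↦ Real.exp (t * (y ω - (μ[y | MeasurableSpace.comap x inferInstance]) ω))) μ ∧
    μ[fun ω ↦ Real.exp (t * (y ω - (μ[y | MeasurableSpace.comap x inferInstance]) ω)) |
        MeasurableSpace.comap x inferInstance] ≤ᵐ[μ] fun _ ↦ Real.exp (σ ^ 2 * t ^ 2 / 2)

/-- The error bound with constant `C`: if the largest and smallest eigenvalues `l₁`, `l_k` of the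
diversity matrix satisfy `l_k > 0`, then on an event of probability at least `1 - C (d + N)⁻¹⁰`,
every choice of top-`k` right or left singular vectors of `Z` has distance at most
`C (√(d l₁ / (N l_k²)) + √(M d / (N² l_k²))) log³(d + N)` from `B`. -/
def SpectralErrorBound {Ω : Type*} [MeasurableSpace Ω] (μ : Measure Ω) {M d k : ℕ}
    (n : Fin M → ℕ) (B : Matrix (Fin d) (Fin k) ℝ)
    (h : Fin M → EuclideanSpace ℝ (Fin k) → ℝ)
    (x : (i : Fin M) → Fin (n i) → Ω → EuclideanSpace ℝ (Fin d))
    (y : (i : Fin M) → Fin (n i) → Ω → ℝ) (C : ℝ) : Prop :=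
  ∀ l₁ l_k : ℝ, IsGreatest (spectrum ℝ (diversity n h)) l₁ →
    IsLeast (spectrum ℝ (diversity n h)) l_k → 0 < l_k →
    ∃ G : Set Ω, MeasurableSet G ∧
      1 - C * (((d : ℝ) + totalSize n) ^ 10)⁻¹ ≤ μ.real G ∧
      ∀ ω ∈ G, ∀ A : Matrix (Fin d) (Fin k) ℝ,
        (IsTopRightSingular (replicaMatrix n (fun i j ↦ x i j ω) (fun i j ↦ y i j ω)) A ∨
          IsTopLeftSingular (replicaMatrix n (fun i j ↦ x i j ω) (fun i j ↦ y i j ω)) A) →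
        sinTheta A B ≤
          C * ((√((d : ℝ) * l₁ / ((totalSize n : ℝ) * l_k ^ 2)) +
              √((M : ℝ) * d / ((totalSize n : ℝ) ^ 2 * l_k ^ 2))) *
            Real.log ((d : ℝ) + totalSize n) ^ 3)

/-- The regression function `u ↦ 1 / (1 + exp(-uᵀ α))` of logistic regression. -/
noncomputable def logisticLink {k : ℕ} (α u : EuclideanSpace ℝ (Fin k)) : ℝ :=
  1 / (1 + Real.exp (-inner ℝ u α))

/-- The one-hidden-layer ReLU network `u ↦ ∑ᵣ max(0, uᵣ) αᵣ`. -/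
noncomputable def reluLink {k : ℕ} (α u : EuclideanSpace ℝ (Fin k)) : ℝ :=
  ∑ r, max 0 (u r) * α r

end SharedRep

/-! Let m_i = E[y_ij x_ij] and N = ∑ n_i. A Stein-type identity gives m_i = B α_i*, so that the two
independent halves of each client make Z an unbiased estimate of the signal S = ∑ n_i m_i m_iᵀ = B
(N D) Bᵀ. This S has rank k, its singular subspaces are the column space of B, and its smallest
nonzero singular value is N λ_k. A Wedin-type inequality (`norm_headProj_sub_le`, `sinTheta_le`)
therefore bounds sin Θ by 4 ‖Z - S‖ / (N λ_k), and it remains to bound ‖Z - S‖.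

The spectral norm is controlled by uᵀ(Z - S)v over at most 25^d pairs from a net of the unit ball.
For fixed u and v, write the two averages of client i as mean plus fluctuation, A_i + e_i and A'_i +
e'_i. The cross terms A_i e'_i and e_i A'_i are linear in independent scores with total variance of
order N λ₁; they produce the first rate. The term ∑ n_i e_i e'_i is a decoupled chaos with M
summands; `lintegral_exp_mul_sum_mul_le` linearises it by an auxiliary Gaussian vector, and its tail
√(Mq) + q produces the second rate.

The scores y x are products and not sub-gaussian, so y is truncated at T = log(d + N): a truncated
score is sub-gaussian at scale T in every direction. Since e^T = d + N, the truncation bias is of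
order 1/(d + N) and survives summation over N samples, while a moment bound E exp(11|y|) ≤ K makes
truncation inactive with probability at least 1 - K (d + N)^(-10). The net forces q = 14 d T; the
powers of T then add up to at most T³. If N λ_k ≤ d the claimed rate is at least 1 and nothing needs
proof.

The only information on the model beyond the Stein-type identity is thus K
(`spectralErrorBound_of_integral_exp_le`). For Lipschitz h_i it comes from dimension-free Gaussian
concentration (the Maurey-Pisier rotation argument) together with the conditional sub-gaussian
error; for logistic regression it is immediate because y is bounded. -/

namespace SharedRep

/-! ### Nets of the unit ball and the operator norm. -/

section Nets

variable {E : Type*} [NormedAddCommGroup E] [InnerProductSpace ℝ E]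

/-- A 1/2-separated subset of the unit ball of maximal cardinality is a net. After scaling by 2 it
is 1-separated in the ball of radius 2, and the packing bound there is 5^dim. -/
theorem exists_halfNet (E : Type*) [NormedAddCommGroup E] [InnerProductSpace ℝ E]
    [FiniteDimensional ℝ E] :
    ∃ S : Finset E, S.card ≤ 5 ^ Module.finrank ℝ E ∧ (∀ u ∈ S, ‖u‖ ≤ 1) ∧
      ∀ x : E, ‖x‖ ≤ 1 → ∃ u ∈ S, ‖x - u‖ ≤ 1 / 2 := by
  classical
  let p : ℕ → Prop := fun m ↦ ∃ S : Finset E, S.card = m ∧ (∀ u ∈ S, ‖u‖ ≤ 1) ∧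
    ∀ c ∈ S, ∀ e ∈ S, c ≠ e → 1 / 2 ≤ ‖c - e‖
  have hbd : ∀ m, p m → m ≤ 5 ^ Module.finrank ℝ E := by
    rintro m ⟨S, rfl, h1, h2⟩
    have hinj : Function.Injective (fun x : E ↦ (2 : ℝ) • x) :=
      smul_right_injective E (two_ne_zero)
    rw [← Finset.card_image_of_injective S hinj]
    apply Besicovitch.card_le_of_separated
    · intro c hc
      obtain ⟨u, hu, rfl⟩ := Finset.mem_image.1 hc
      have := h1 u hu
      simp only [norm_smul, Real.norm_ofNat]
      linarith
    · intro c hc e he hce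
      obtain ⟨u, hu, rfl⟩ := Finset.mem_image.1 hc
      obtain ⟨w, hw, rfl⟩ := Finset.mem_image.1 he
      have hne : u ≠ w := fun h ↦ hce (by rw [h])
      have := h2 u hu w hw hne
      rw [← smul_sub, norm_smul, Real.norm_ofNat]
      linarith
  have h0 : p 0 := ⟨∅, by simp⟩
  obtain ⟨S, hS, h1, h2⟩ := Nat.findGreatest_spec (P := p) (Nat.zero_le _) h0
  refine ⟨S, hS ▸ Nat.findGreatest_le _, h1, fun x hx ↦ ?_⟩
  by_contra! hcon
  have hxS : x ∉ S := fun h ↦ by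
    have := hcon x h
    simp at this
    linarith
  have hp : p (S.card + 1) := by
    refine ⟨insert x S, Finset.card_insert_of_notMem hxS, ?_, ?_⟩
    · intro u hu
      rcases Finset.mem_insert.1 hu with rfl | hu
      · exact hx
      · exact h1 u hu
    · intro c hc e he hce
      rcases Finset.mem_insert.1 hc with hc | hc <;> rcases Finset.mem_insert.1 he with he | he
      · exact absurd (hc.trans he.symm) hce
      · rw [hc]; exact (hcon e he).le
      · rw [he, norm_sub_rev]; exact (hcon c hc).le
      · exact h2 c hc e he hce
  have := Nat.le_findGreatest (hbd _ hp) hp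
  omega

/-- Each of the two arguments of the bilinear form is approximated up to 1/2, and each absorption of
the error costs a factor 2. -/
theorem opNorm_le_of_halfNet {S : Finset E} (hnet : ∀ x : E, ‖x‖ ≤ 1 → ∃ u ∈ S, ‖x - u‖ ≤ 1 / 2)
    (A : E →L[ℝ] E) {t : ℝ} (h : ∀ u ∈ S, ∀ v ∈ S, inner ℝ u (A v) ≤ t) : ‖A‖ ≤ 4 * t := by
  have key : ∀ v ∈ S, ‖A v‖ ≤ 2 * t := by
    intro v hv
    rcases eq_or_ne (A v) 0 with h0 | h0
    · obtain ⟨u, hu, -⟩ := hnet 0 (by simp)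
      have := h u hu v hv
      rw [h0, inner_zero_right] at this
      rw [h0, norm_zero]
      linarith
    · have hpos : 0 < ‖A v‖ := norm_pos_iff.2 h0
      obtain ⟨u, hu, hu'⟩ := hnet (‖A v‖⁻¹ • A v) (by
        rw [norm_smul, norm_inv, norm_norm, inv_mul_cancel₀ hpos.ne'])
      have h1 := h u hu v hv
      have h2 : inner ℝ (‖A v‖⁻¹ • A v - u) (A v) ≤ 1 / 2 * ‖A v‖ :=
        (real_inner_le_norm _ _).trans (by gcongr)
      rw [inner_sub_left, real_inner_smul_left, real_inner_self_eq_norm_sq, sq,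
        inv_mul_cancel_left₀ hpos.ne'] at h2
      linarith
  have hA : ‖A‖ ≤ 2 * t + ‖A‖ * (1 / 2) := by
    refine ContinuousLinearMap.opNorm_le_of_unit_norm ?_ ?_
    · obtain ⟨u, hu, -⟩ := hnet 0 (by simp)
      have := (norm_nonneg _).trans (key u hu)
      positivity
    · intro x hx
      obtain ⟨v, hv, hxv⟩ := hnet x hx.le
      calc ‖A x‖ = ‖A v + A (x - v)‖ := by rw [← map_add]; congr 2; abel
        _ ≤ ‖A v‖ + ‖A (x - v)‖ := norm_add_le _ _
        _ ≤ 2 * t + ‖A‖ * (1 / 2) := by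
          gcongr
          · exact key v hv
          · exact (A.le_opNorm _).trans (by gcongr)
  linarith

end Nets

/-! ### Weyl and Wedin perturbation bounds for singular subspaces. -/

section Wedin

variable {E F : Type*} [NormedAddCommGroup E] [InnerProductSpace ℝ E]
  [NormedAddCommGroup F] [InnerProductSpace ℝ F] {d : ℕ}

/-- Orthogonal projection onto the span of the first `k` vectors of an orthonormal basis. -/
noncomputable def headProj (v : OrthonormalBasis (Fin d) ℝ E) (k : ℕ) (x : E) : E :=
  ∑ r with r.val < k, inner ℝ (v r) x • v r

theorem inner_headProj (v : OrthonormalBasis (Fin d) ℝ E) (k : ℕ) (x : E) (r : Fin d) :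
    inner ℝ (v r) (headProj v k x) = if r.val < k then inner ℝ (v r) x else 0 := by
  simp [headProj, inner_sum, real_inner_smul_right, orthonormal_iff_ite.1 v.orthonormal,
    Finset.sum_ite_eq]

theorem norm_sq_eq_sum (v : OrthonormalBasis (Fin d) ℝ E) (x : E) :
    ‖x‖ ^ 2 = ∑ r, inner ℝ (v r) x ^ 2 := by
  rw [← v.sum_sq_norm_inner_right x]
  simp

/-- Parseval in two different bases: with left singular vectors for the image and right ones for the
argument, bounds on singular values become bounds on the norm of the image. -/
theorem norm_le_of_forall_inner (v w : OrthonormalBasis (Fin d) ℝ E) {x y : E} {c : ℝ}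
    (hc : 0 ≤ c) (h : ∀ r, |inner ℝ (v r) x| ≤ c * |inner ℝ (w r) y|) : ‖x‖ ≤ c * ‖y‖ := by
  apply le_of_sq_le_sq _ (by positivity)
  rw [mul_pow, norm_sq_eq_sum v, norm_sq_eq_sum w, Finset.mul_sum]
  refine Finset.sum_le_sum fun r _ ↦ ?_
  rw [← mul_pow, ← sq_abs, ← sq_abs (c * _), abs_mul, abs_of_nonneg hc]
  gcongr
  exact h r

theorem norm_headProj_le (v : OrthonormalBasis (Fin d) ℝ E) (k : ℕ) (x : E) :
    ‖headProj v k x‖ ≤ ‖x‖ := by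
  have := norm_le_of_forall_inner v v (x := headProj v k x) (y := x) zero_le_one (fun r ↦ by
    rw [inner_headProj]; split_ifs <;> simp)
  simpa using this

theorem norm_sub_headProj_le (v : OrthonormalBasis (Fin d) ℝ E) (k : ℕ) (x : E) :
    ‖x - headProj v k x‖ ≤ ‖x‖ := by
  have := norm_le_of_forall_inner v v (x := x - headProj v k x) (y := x) zero_le_one (fun r ↦ by
    rw [inner_sub_right, inner_headProj]; split_ifs <;> simp)
  simpa using this

-- `hZ` is the singular value decomposition of `Z` in coordinates; `S` has rank at most dim F, and
-- `g` bounds from below the lengths produced by its core `K`.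
variable [FiniteDimensional ℝ E] [FiniteDimensional ℝ F]
  (u v : OrthonormalBasis (Fin d) ℝ E) (s : Fin d → ℝ) (hs : Antitone s) (h0 : ∀ r, 0 ≤ s r)
  (Z S : E →L[ℝ] E) (hZ : ∀ r x, inner ℝ (u r) (Z x) = s r * inner ℝ (v r) x)
  (b : F →ₗᵢ[ℝ] E) (K : F →L[ℝ] F)
  (hS : ∀ x, S x = b (K (b.toContinuousLinearMap.adjoint x)))
  {g ε : ℝ} (hK : ∀ x, g * ‖x‖ ≤ ‖K x‖) (hε : ∀ x, ‖Z x - S x‖ ≤ ε * ‖x‖)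

include hs h0 hZ hS hε in
/-- Weyl's inequality: a singular value beyond the rank of `S` is at most `‖Z - S‖`. -/
theorem singularValue_le_of_finrank_le (r₀ : Fin d) (hr : Module.finrank ℝ F ≤ r₀.val)
    (hd : Module.finrank ℝ E = d) : s r₀ ≤ ε := by
  -- The kernel consists of the vectors in the span of v_0, ..., v_{r₀} that `S` kills. It is
  -- nonzero since the target has dimension (d - 1 - r₀) + dim F < d.
  let f : E →ₗ[ℝ] ({r : Fin d // r₀ < r} → ℝ) × F :=
    (LinearMap.pi fun r ↦ (innerSL ℝ (v r.1)).toLinearMap).prod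
      b.toContinuousLinearMap.adjoint.toLinearMap
  have hdim : Module.finrank ℝ (({r : Fin d // r₀ < r} → ℝ) × F) < Module.finrank ℝ E := by
    have : Fintype.card {r : Fin d // r₀ < r} = d - 1 - r₀.val := by
      rw [Fintype.card_subtype, ← Fin.card_Ioi]
      congr 1
      ext; simp
    rw [Module.finrank_prod, Module.finrank_pi, this, hd]
    omega
  obtain ⟨x, hx, hx0⟩ := Submodule.exists_mem_ne_zero_of_ne_bot
    (LinearMap.ker_ne_bot_of_finrank_lt (f := f) hdim)
  have hfx : f x = 0 := hx
  have h1 : ∀ r, r₀ < r → inner ℝ (v r) x = 0 := fun r hr ↦ by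
    have := congrFun (congrArg Prod.fst hfx) ⟨r, hr⟩
    simpa [f] using this
  have h2 : b.toContinuousLinearMap.adjoint x = 0 := congrArg Prod.snd hfx
  have h3 : S x = 0 := by rw [hS, h2]; simp
  have h4 : s r₀ * ‖x‖ ≤ ‖Z x‖ := by
    apply le_of_sq_le_sq _ (norm_nonneg _)
    rw [mul_pow, norm_sq_eq_sum v, norm_sq_eq_sum u, Finset.mul_sum]
    refine Finset.sum_le_sum fun r _ ↦ ?_
    rw [hZ, mul_pow]
    rcases lt_or_ge r₀ r with h | h
    · simp [h1 r h]
    · have := hs h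
      have := h0 r₀
      gcongr
  have h5 := hε x
  rw [h3, sub_zero] at h5
  exact le_of_mul_le_mul_right (h4.trans h5) (norm_pos_iff.2 hx0)

include hs h0 hZ hS hK hε in
/-- Weyl's inequality: a singular value within the rank of `S` is at least `g - ‖Z - S‖`. -/
theorem sub_le_singularValue (r₀ : Fin d) (hr : r₀.val < Module.finrank ℝ F) : g - ε ≤ s r₀ := by
  -- There are r₀ < dim F conditions, so some nonzero vector in the range of `b` avoids v_0, ...,
  -- v_{r₀-1}; there `Z` stretches by at most s_{r₀} and `S` by at least g.
  let f : F →ₗ[ℝ] ({r : Fin d // r < r₀} → ℝ) :=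
    LinearMap.pi fun r ↦ (innerSL ℝ (v r.1)).toLinearMap ∘ₗ b.toLinearMap
  have hdim : Module.finrank ℝ ({r : Fin d // r < r₀} → ℝ) < Module.finrank ℝ F := by
    have : Fintype.card {r : Fin d // r < r₀} = r₀.val := by
      rw [Fintype.card_subtype, ← Fin.card_Iio]
      congr 1
      ext; simp
    rw [Module.finrank_pi, this]
    omega
  obtain ⟨x, hx, hx0⟩ := Submodule.exists_mem_ne_zero_of_ne_bot
    (LinearMap.ker_ne_bot_of_finrank_lt (f := f) hdim)
  have hfx : f x = 0 := hx
  have h1 : ∀ r, r < r₀ → inner ℝ (v r) (b x) = 0 := fun r hr ↦ by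
    have := congrFun hfx ⟨r, hr⟩
    simpa [f] using this
  have hb : b.toContinuousLinearMap.adjoint (b x) = x :=
    DFunLike.congr_fun b.adjoint_comp_self x
  have h3 : ‖S (b x)‖ = ‖K x‖ := by rw [hS, hb, b.norm_map]
  have h4 : ‖Z (b x)‖ ≤ s r₀ * ‖b x‖ := by
    refine norm_le_of_forall_inner u v (h0 r₀) fun r ↦ ?_
    rw [hZ, abs_mul, abs_of_nonneg (h0 r)]
    rcases lt_or_ge r r₀ with h | h
    · simp [h1 r h]
    · have := hs h
      gcongr
  have h5 := hε (b x)
  rw [b.norm_map] at h4 h5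
  have h6 := norm_sub_norm_le (S (b x)) (Z (b x))
  rw [norm_sub_rev, h3] at h6
  have h7 := hK x
  exact le_of_mul_le_mul_right (by linarith) (norm_pos_iff.2 hx0)

include hs h0 hZ hS hK hε in
/-- Wedin's perturbation bound for the projection onto the top right singular subspace. -/
theorem norm_headProj_sub_le (hd : Module.finrank ℝ E = d)
    (hg : 0 < g) (x : E) :
    ‖headProj v (Module.finrank ℝ F) x - b (b.toContinuousLinearMap.adjoint x)‖
      ≤ 4 * ε / g * ‖x‖ := by
  set bs := b.toContinuousLinearMap.adjoint with hbs
  set k := Module.finrank ℝ F with hk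
  have hbb : ∀ y, bs (b y) = y := fun y ↦ DFunLike.congr_fun b.adjoint_comp_self y
  have hadj : ∀ y z, inner ℝ (bs y) z = inner ℝ y (b z) := fun y z ↦
    ContinuousLinearMap.adjoint_inner_left _ _ _
  have hbsn : ∀ y, ‖bs y‖ ≤ ‖y‖ := fun y ↦ by
    have h : ‖bs y‖ * ‖bs y‖ ≤ ‖y‖ * ‖bs y‖ := by
      rw [← real_inner_self_eq_norm_mul_norm, hadj]
      exact (real_inner_le_norm _ _).trans (by rw [b.norm_map])
    nlinarith [norm_nonneg (bs y), norm_nonneg y]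
  rcases eq_or_ne x 0 with rfl | hx0
  · simp [headProj]
  have hxpos := norm_pos_iff.2 hx0
  have hε0 : 0 ≤ ε := nonneg_of_mul_nonneg_left ((norm_nonneg _).trans (hε x)) hxpos
  -- With P the head projection and Q = b b*, P - Q = (1 - Q)P - Q(1 - P), and each term costs 2ε/g.
  -- If ε ≥ g/2 the asserted bound is at least 2‖x‖ and holds trivially.
  set p := headProj v k x with hp
  rcases le_or_gt g (2 * ε) with hcase | hcase
  · have h2 : (2 : ℝ) ≤ 4 * ε / g := by rw [le_div_iff₀ hg]; linarith
    calc ‖p - b (bs x)‖ ≤ ‖p‖ + ‖b (bs x)‖ := norm_sub_le _ _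
      _ ≤ ‖x‖ + ‖x‖ := by
        gcongr
        · exact norm_headProj_le _ _ _
        · rw [b.norm_map]; exact hbsn x
      _ ≤ 4 * ε / g * ‖x‖ := by nlinarith
  -- the part of `b bs` outside the head
  have hfirst : ‖b (bs (x - p))‖ ≤ 2 * ε / g * ‖x‖ := by
    -- By Weyl, only singular values at most ε act on x - p; hence g ‖b*(x - p)‖ ≤ ‖S(x - p)‖ ≤ 2ε
    -- ‖x - p‖.
    have hZy : ‖Z (x - p)‖ ≤ ε * ‖x - p‖ := by
      refine norm_le_of_forall_inner u v hε0 fun r ↦ ?_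
      rw [hZ, abs_mul, abs_of_nonneg (h0 r)]
      rcases lt_or_ge r.val k with h | h
      · rw [inner_sub_right, hp, inner_headProj, if_pos h]; simp
      · have := singularValue_le_of_finrank_le u v s hs h0 Z S hZ b K hS hε r h hd
        gcongr
    have h1 : g * ‖bs (x - p)‖ ≤ ‖S (x - p)‖ := by rw [hS, b.norm_map]; exact hK _
    have h2 := norm_sub_norm_le (S (x - p)) (Z (x - p))
    rw [norm_sub_rev] at h2
    have h3 := hε (x - p)
    have h4 : ‖x - p‖ ≤ ‖x‖ := norm_sub_headProj_le _ _ _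
    rw [b.norm_map, div_mul_eq_mul_div, le_div_iff₀ hg]
    nlinarith
  -- Here p = Z* w for a vector w with ‖w‖ ≤ 2‖x‖/g, since head singular values are at least g/2. As
  -- q lies in the kernel of `S`, ‖q‖² = ⟨p, q⟩ = ⟨w, Zq⟩ = ⟨w, (Z - S)q⟩.
  have hsecond : ‖p - b (bs p)‖ ≤ 2 * ε / g * ‖x‖ := by
    set q : E := p - b (bs p) with hq
    have hbq : bs q = 0 := by rw [hq, map_sub, hbb, sub_self]
    -- `w = ∑ sᵣ⁻¹ cᵣ uᵣ`
    have hsr : ∀ r : Fin d, r.val < k → g / 2 ≤ s r := fun r hr ↦ by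
      have := sub_le_singularValue u v s hs h0 Z S hZ b K hS hK hε r hr
      linarith
    let w : E := ∑ r with r.val < k, ((s r)⁻¹ * inner ℝ (v r) x) • u r
    have hw : ‖w‖ ≤ 2 / g * ‖x‖ := by
      refine norm_le_of_forall_inner u v (by positivity) fun r ↦ ?_
      have : inner ℝ (u r) w = if r.val < k then (s r)⁻¹ * inner ℝ (v r) x else 0 := by
        simp [w, inner_sum, real_inner_smul_right, orthonormal_iff_ite.1 u.orthonormal,
          Finset.sum_ite_eq]
      rw [this]
      split_ifs with h
      · rw [abs_mul]
        gcongr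
        have h1 := hsr r h
        have h2 : 0 < s r := by linarith
        rw [abs_of_pos (inv_pos.2 h2), inv_eq_one_div, div_le_div_iff₀ h2 hg]
        linarith
      · rw [abs_zero]; positivity
    have hwp : ∀ y, inner ℝ w (Z y) = inner ℝ p y := fun y ↦ by
      simp only [w, hp, headProj, sum_inner, real_inner_smul_left, hZ]
      refine Finset.sum_congr rfl fun r hr ↦ ?_
      have h1 := hsr r (Finset.mem_filter.1 hr).2
      have h2 : s r ≠ 0 := by linarith
      field_simp
    have hqq : ‖q‖ * ‖q‖ = inner ℝ w (Z q - S q) := by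
      have h1 : S q = 0 := by rw [hS, hbq]; simp
      have h2 : inner ℝ (b (bs p)) q = 0 := by
        rw [real_inner_comm, ← hadj, hbq, inner_zero_left]
      rw [h1, sub_zero, hwp, ← real_inner_self_eq_norm_mul_norm]
      nth_rewrite 1 [hq]
      rw [inner_sub_left, h2, sub_zero]
    have hle : ‖q‖ * ‖q‖ ≤ (2 * ε / g * ‖x‖) * ‖q‖ := by
      rw [hqq]
      calc inner ℝ w (Z q - S q) ≤ ‖w‖ * ‖Z q - S q‖ := real_inner_le_norm _ _
        _ ≤ (2 / g * ‖x‖) * (ε * ‖q‖) := by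
          gcongr
          exact hε q
        _ = _ := by ring
    rcases (norm_nonneg q).eq_or_lt with h | h
    · rw [← h]; positivity
    · exact le_of_mul_le_mul_right hle h
  calc ‖p - b (bs x)‖ = ‖(p - b (bs p)) - b (bs (x - p))‖ := by
        congr 1; simp only [map_sub]; abel
    _ ≤ ‖p - b (bs p)‖ + ‖b (bs (x - p))‖ := norm_sub_le _ _
    _ ≤ 2 * ε / g * ‖x‖ + 2 * ε / g * ‖x‖ := add_le_add hsecond hfirst
    _ = _ := by ring

end Wedin

/-! ### Translation to matrices: sin Θ and eigenvalue bounds. -/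

section MatrixForm

variable {d k : ℕ}

theorem exists_orthonormalBasis_of_mem_orthogonalGroup {V : Matrix (Fin d) (Fin d) ℝ}
    (hV : V ∈ orthogonalGroup (Fin d) ℝ) :
    ∃ v : OrthonormalBasis (Fin d) ℝ (EuclideanSpace ℝ (Fin d)),
      ∀ r i, (v r) i = V i r := by
  have hVV : Vᵀ * V = 1 := (mem_orthogonalGroup_iff' (Fin d) ℝ).1 hV
  let w : Fin d → EuclideanSpace ℝ (Fin d) := fun r ↦ WithLp.toLp 2 (fun i ↦ V i r)
  have hw : Orthonormal ℝ w := by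
    rw [orthonormal_iff_ite]
    intro r r'
    have := congrFun (congrFun hVV r) r'
    rw [mul_apply, one_apply] at this
    rw [← this, PiLp.inner_apply]
    simp [w, mul_comm]
  obtain ⟨v, hv⟩ := Orthonormal.exists_orthonormalBasis_extension_of_card_eq
    (𝕜 := ℝ) (E := EuclideanSpace ℝ (Fin d)) (ι := Fin d) (by simp) (v := w) (s := Set.univ)
    (hw.comp _ Subtype.val_injective)
  exact ⟨v, fun r i ↦ by rw [hv r (Set.mem_univ r)]⟩

theorem inner_eq_mulVec {V : Matrix (Fin d) (Fin k) ℝ} {v : Fin k → EuclideanSpace ℝ (Fin d)}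
    (hv : ∀ r i, (v r) i = V i r) (x : EuclideanSpace ℝ (Fin d)) (r : Fin k) :
    inner ℝ (v r) x = (Vᵀ *ᵥ x.ofLp) r := by
  rw [PiLp.inner_apply, mulVec, dotProduct]
  simp [hv, mul_comm]

theorem headProj_eq_mulVec {V : Matrix (Fin d) (Fin d) ℝ}
    {v : OrthonormalBasis (Fin d) ℝ (EuclideanSpace ℝ (Fin d))}
    (hv : ∀ r i, (v r) i = V i r) (hk : k ≤ d) (x : EuclideanSpace ℝ (Fin d)) :
    headProj v k x = WithLp.toLp 2 ((V.submatrix id (Fin.castLE hk) *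
      (V.submatrix id (Fin.castLE hk))ᵀ) *ᵥ x.ofLp) := by
  ext i
  rw [← mulVec_mulVec, headProj]
  simp only [WithLp.ofLp_sum, Finset.sum_apply, PiLp.smul_apply, smul_eq_mul, hv]
  simp only [inner_eq_mulVec hv]
  rw [mulVec, dotProduct]
  symm
  refine Finset.sum_bij (fun r _ ↦ Fin.castLE hk r) ?_ ?_ ?_ ?_
  · intro r _; simp
  · intro r _ r' _ h; exact Fin.castLE_injective hk h
  · intro r hr
    exact ⟨⟨r.val, (Finset.mem_filter.1 hr).2⟩, Finset.mem_univ _, rfl⟩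
  · intro r _
    simp only [submatrix_apply, id, mul_comm]
    rfl

/-- The isometry `u ↦ B u` of a matrix `B` with orthonormal columns. -/
noncomputable def columnIsometry (B : Matrix (Fin d) (Fin k) ℝ) (hB : Bᵀ * B = 1) :
    EuclideanSpace ℝ (Fin k) →ₗᵢ[ℝ] EuclideanSpace ℝ (Fin d) where
  toFun u := WithLp.toLp 2 (B *ᵥ u.ofLp)
  map_add' u v := by simp [mulVec_add]
  map_smul' c u := by simp [mulVec_smul]
  norm_map' u := by
    have h : ‖(WithLp.toLp 2 (B *ᵥ u.ofLp) : EuclideanSpace ℝ (Fin d))‖ ^ 2 = ‖u‖ ^ 2 := by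
      rw [← real_inner_self_eq_norm_sq, ← real_inner_self_eq_norm_sq,
        EuclideanSpace.inner_eq_star_dotProduct, EuclideanSpace.inner_eq_star_dotProduct,
        star_trivial, star_trivial]
      rw [dotProduct_mulVec, vecMul_mulVec, hB, vecMul_one]
    exact (sq_eq_sq₀ (norm_nonneg _) (norm_nonneg _)).1 h

theorem columnIsometry_apply (B : Matrix (Fin d) (Fin k) ℝ) (hB : Bᵀ * B = 1)
    (u : EuclideanSpace ℝ (Fin k)) : columnIsometry B hB u = WithLp.toLp 2 (B *ᵥ u.ofLp) := rfl

theorem inner_columnIsometry (B : Matrix (Fin d) (Fin k) ℝ) (hB : Bᵀ * B = 1)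
    (x : EuclideanSpace ℝ (Fin d)) (u : EuclideanSpace ℝ (Fin k)) :
    inner ℝ x (columnIsometry B hB u) = inner ℝ (feature B x) u := by
  rw [columnIsometry_apply, feature, EuclideanSpace.inner_eq_star_dotProduct,
    EuclideanSpace.inner_eq_star_dotProduct, star_trivial, star_trivial, mulVec_transpose,
    dotProduct_comm, dotProduct_mulVec, dotProduct_comm]

theorem adjoint_columnIsometry (B : Matrix (Fin d) (Fin k) ℝ) (hB : Bᵀ * B = 1)
    (x : EuclideanSpace ℝ (Fin d)) :
    (columnIsometry B hB).toContinuousLinearMap.adjoint x = feature B x := by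
  refine ext_inner_right ℝ fun u ↦ ?_
  rw [ContinuousLinearMap.adjoint_inner_left]
  exact inner_columnIsometry B hB x u

theorem norm_feature_le (B : Matrix (Fin d) (Fin k) ℝ) (hB : Bᵀ * B = 1)
    (x : EuclideanSpace ℝ (Fin d)) : ‖feature B x‖ ≤ ‖x‖ := by
  have h : ‖feature B x‖ * ‖feature B x‖ ≤ ‖x‖ * ‖feature B x‖ := by
    rw [← real_inner_self_eq_norm_mul_norm, ← inner_columnIsometry B hB]
    exact (real_inner_le_norm _ _).trans (by rw [LinearIsometry.norm_map])
  nlinarith [norm_nonneg (feature B x), norm_nonneg x]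

/-- Both matrix products are contractions. This crude bound settles the regime where the claimed
rate is at least 1. -/
theorem sinTheta_le_two {A B : Matrix (Fin d) (Fin k) ℝ} (hA : Aᵀ * A = 1) (hB : Bᵀ * B = 1) :
    sinTheta A B ≤ 2 := by
  refine ContinuousLinearMap.opNorm_le_bound _ (by norm_num) fun x ↦ ?_
  have h : ∀ (Q : Matrix (Fin d) (Fin k) ℝ) (hQ : Qᵀ * Q = 1),
      ‖(WithLp.toLp 2 ((Q * Qᵀ) *ᵥ x.ofLp) : EuclideanSpace ℝ (Fin d))‖ ≤ ‖x‖ := fun Q hQ ↦ by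
    rw [← mulVec_mulVec]
    change ‖columnIsometry Q hQ (feature Q x)‖ ≤ _
    rw [LinearIsometry.norm_map]
    exact norm_feature_le Q hQ x
  have hx : toEuclideanCLM (𝕜 := ℝ) (A * Aᵀ - B * Bᵀ) x =
      WithLp.toLp 2 ((A * Aᵀ) *ᵥ x.ofLp) - WithLp.toLp 2 ((B * Bᵀ) *ᵥ x.ofLp) := by
    change WithLp.toLp 2 ((A * Aᵀ - B * Bᵀ) *ᵥ x.ofLp) = _
    rw [sub_mulVec, WithLp.toLp_sub]
  rw [hx]
  calc _ ≤ _ + _ := norm_sub_le _ _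
    _ ≤ ‖x‖ + ‖x‖ := add_le_add (h A hA) (h B hB)
    _ = 2 * ‖x‖ := by ring

theorem IsTopRightSingular.transpose_mul_self {Z : Matrix (Fin d) (Fin d) ℝ}
    {A : Matrix (Fin d) (Fin k) ℝ} (h : IsTopRightSingular Z A) : Aᵀ * A = 1 := by
  obtain ⟨hk, U, V, s, ⟨-, hV, -⟩, rfl⟩ := h
  have hVV : Vᵀ * V = 1 := (mem_orthogonalGroup_iff' (Fin d) ℝ).1 hV
  ext r r'
  have := congrFun (congrFun hVV (Fin.castLE hk r)) (Fin.castLE hk r')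
  rw [mul_apply] at this ⊢
  simpa [one_apply, (Fin.castLE_injective hk).eq_iff] using this

theorem IsTopLeftSingular.transpose {Z : Matrix (Fin d) (Fin d) ℝ}
    {A : Matrix (Fin d) (Fin k) ℝ} (h : IsTopLeftSingular Z A) : IsTopRightSingular Zᵀ A := by
  obtain ⟨hk, U, V, s, ⟨hU, hV, hs, h0, hZ⟩, rfl⟩ := h
  refine ⟨hk, V, U, s, ⟨hV, hU, hs, h0, ?_⟩, rfl⟩
  rw [hZ, transpose_mul, transpose_mul, transpose_transpose, diagonal_transpose, Matrix.mul_assoc]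

theorem sinTheta_le_of_isTopRightSingular {Z : Matrix (Fin d) (Fin d) ℝ}
    {A B : Matrix (Fin d) (Fin k) ℝ} (hB : Bᵀ * B = 1) (D : Matrix (Fin k) (Fin k) ℝ) {g : ℝ}
    (hg : 0 < g) (hD : ∀ x, g * ‖x‖ ≤ ‖toEuclideanCLM (𝕜 := ℝ) D x‖)
    (hA : IsTopRightSingular Z A) :
    sinTheta A B ≤ 4 * ‖toEuclideanCLM (𝕜 := ℝ) (Z - B * D * Bᵀ)‖ / g := by
  obtain ⟨hk, U, V, s, ⟨hU, hV, hs, h0, hZ⟩, rfl⟩ := hA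
  obtain ⟨u, hu⟩ := exists_orthonormalBasis_of_mem_orthogonalGroup hU
  obtain ⟨v, hv⟩ := exists_orthonormalBasis_of_mem_orthogonalGroup hV
  have hUU : Uᵀ * U = 1 := (mem_orthogonalGroup_iff' (Fin d) ℝ).1 hU
  set ε := ‖toEuclideanCLM (𝕜 := ℝ) (Z - B * D * Bᵀ)‖
  have key := norm_headProj_sub_le u v s hs h0 (toEuclideanCLM (𝕜 := ℝ) Z)
    (toEuclideanCLM (𝕜 := ℝ) (B * D * Bᵀ)) (fun r x ↦ by
      rw [inner_eq_mulVec hu, inner_eq_mulVec hv]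
      change (Uᵀ *ᵥ (Z *ᵥ x.ofLp)) r = _
      rw [hZ, mulVec_mulVec, ← Matrix.mul_assoc, ← Matrix.mul_assoc, hUU, Matrix.one_mul,
        ← mulVec_mulVec, mulVec_diagonal])
    (columnIsometry B hB) (toEuclideanCLM (𝕜 := ℝ) D) (fun x ↦ by
      rw [adjoint_columnIsometry]
      change WithLp.toLp 2 ((B * D * Bᵀ) *ᵥ x.ofLp) = WithLp.toLp 2 (B *ᵥ (D *ᵥ (Bᵀ *ᵥ x.ofLp)))
      rw [mulVec_mulVec, mulVec_mulVec, Matrix.mul_assoc]) (g := g) (ε := ε) hD (fun x ↦ by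
      rw [← _root_.sub_apply, ← map_sub]
      exact ContinuousLinearMap.le_opNorm _ _) (by simp) hg
  refine ContinuousLinearMap.opNorm_le_bound _ (by positivity) fun x ↦ ?_
  refine le_of_eq_of_le (congrArg norm ?_) (key x)
  rw [adjoint_columnIsometry, finrank_euclideanSpace_fin, headProj_eq_mulVec hv hk]
  change WithLp.toLp 2 ((_ - B * Bᵀ) *ᵥ x.ofLp) = _ - WithLp.toLp 2 (B *ᵥ (Bᵀ *ᵥ x.ofLp))
  rw [sub_mulVec, WithLp.toLp_sub, mulVec_mulVec]

theorem norm_toEuclideanCLM_transpose (Z : Matrix (Fin d) (Fin d) ℝ) :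
    ‖toEuclideanCLM (𝕜 := ℝ) Zᵀ‖ = ‖toEuclideanCLM (𝕜 := ℝ) Z‖ := by
  rw [← conjTranspose_eq_transpose_of_trivial, ← star_eq_conjTranspose, map_star,
    ContinuousLinearMap.star_eq_adjoint, LinearIsometryEquiv.norm_map]

/-- Left singular vectors of `Z` are right singular vectors of `Zᵀ`; the signal is symmetric, so
transposition does not change the error. -/
theorem sinTheta_le {Z : Matrix (Fin d) (Fin d) ℝ}
    {A B : Matrix (Fin d) (Fin k) ℝ} (hB : Bᵀ * B = 1) (D : Matrix (Fin k) (Fin k) ℝ)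
    (hDs : Dᵀ = D) {g : ℝ} (hg : 0 < g) (hD : ∀ x, g * ‖x‖ ≤ ‖toEuclideanCLM (𝕜 := ℝ) D x‖)
    (hA : IsTopRightSingular Z A ∨ IsTopLeftSingular Z A) :
    sinTheta A B ≤ 4 * ‖toEuclideanCLM (𝕜 := ℝ) (Z - B * D * Bᵀ)‖ / g := by
  rcases hA with hA | hA
  · exact sinTheta_le_of_isTopRightSingular hB D hg hD hA
  · have := sinTheta_le_of_isTopRightSingular hB D hg hD hA.transpose
    rwa [← norm_toEuclideanCLM_transpose, transpose_sub, transpose_transpose, transpose_mul,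
      transpose_mul, transpose_transpose, hDs, ← Matrix.mul_assoc] at this

theorem inner_toEuclideanCLM_eq_sum {D : Matrix (Fin k) (Fin k) ℝ} (hD : D.IsHermitian)
    (x : EuclideanSpace ℝ (Fin k)) :
    inner ℝ x (toEuclideanCLM (𝕜 := ℝ) D x) =
      ∑ r, hD.eigenvalues r * inner ℝ (hD.eigenvectorBasis r) x ^ 2 := by
  rw [← hD.eigenvectorBasis.sum_inner_mul_inner x]
  refine Finset.sum_congr rfl fun r _ ↦ ?_
  have h1 : inner ℝ (hD.eigenvectorBasis r) (toEuclideanCLM (𝕜 := ℝ) D x) =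
      inner ℝ (toEuclideanCLM (𝕜 := ℝ) D (hD.eigenvectorBasis r)) x := by
    rw [← ContinuousLinearMap.adjoint_inner_left, ← ContinuousLinearMap.star_eq_adjoint,
      ← map_star, star_eq_conjTranspose, hD.eq]
  have h2 : toEuclideanCLM (𝕜 := ℝ) D (hD.eigenvectorBasis r) =
      hD.eigenvalues r • hD.eigenvectorBasis r := by
    ext i
    exact congrFun (hD.mulVec_eigenvectorBasis r) i
  rw [h1, h2, real_inner_smul_left, real_inner_comm x]
  ring

/-- The quadratic form of a symmetric matrix is at most its largest eigenvalue. -/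
theorem inner_toEuclideanCLM_le {D : Matrix (Fin k) (Fin k) ℝ} (hD : D.IsHermitian) {l : ℝ}
    (hl : ∀ c ∈ spectrum ℝ D, c ≤ l) (x : EuclideanSpace ℝ (Fin k)) :
    inner ℝ x (toEuclideanCLM (𝕜 := ℝ) D x) ≤ l * ‖x‖ ^ 2 := by
  rw [inner_toEuclideanCLM_eq_sum hD, ← hD.eigenvectorBasis.sum_sq_norm_inner_right x,
    Finset.mul_sum]
  refine Finset.sum_le_sum fun r _ ↦ ?_
  rw [Real.norm_eq_abs, sq_abs]
  gcongr
  exact hl _ (hD.eigenvalues_mem_spectrum_real r)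

/-- A symmetric matrix with eigenvalues at least `l` expands lengths by at least `l`. -/
theorem mul_norm_le_norm_toEuclideanCLM {D : Matrix (Fin k) (Fin k) ℝ} (hD : D.IsHermitian) {l : ℝ}
    (hl : ∀ c ∈ spectrum ℝ D, l ≤ c) (x : EuclideanSpace ℝ (Fin k)) :
    l * ‖x‖ ≤ ‖toEuclideanCLM (𝕜 := ℝ) D x‖ := by
  have h : l * ‖x‖ ^ 2 ≤ inner ℝ x (toEuclideanCLM (𝕜 := ℝ) D x) := by
    rw [inner_toEuclideanCLM_eq_sum hD, ← hD.eigenvectorBasis.sum_sq_norm_inner_right x,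
      Finset.mul_sum]
    refine Finset.sum_le_sum fun r _ ↦ ?_
    rw [Real.norm_eq_abs, sq_abs]
    gcongr
    exact hl _ (hD.eigenvalues_mem_spectrum_real r)
  have h2 := h.trans (real_inner_le_norm _ _)
  rcases (norm_nonneg x).eq_or_lt with h0 | h0
  · rw [← h0, mul_zero]; exact norm_nonneg _
  · exact le_of_mul_le_mul_right (by linarith) h0

end MatrixForm

/-! ### Sub-gaussian variables and Gaussian squares in one dimension. -/

section OneDim

/-- For a centred variable the linear term integrates to zero, which leaves a bound quadratic in the
exponent. -/
theorem exp_le_add_exp_sq (x : ℝ) : Real.exp x ≤ x + Real.exp (x ^ 2) := by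
  have h1 := Real.add_one_le_exp (x ^ 2)
  rcases le_total |x| 1 with h | h
  · have := (abs_le.1 (Real.abs_exp_sub_one_sub_id_le h)).2
    linarith
  · rcases le_abs.1 h with h | h
    · have : Real.exp x ≤ Real.exp (x ^ 2) := Real.exp_le_exp.2 (by nlinarith)
      linarith
    · have : Real.exp x ≤ 1 := Real.exp_le_one_iff.2 (by linarith)
      nlinarith

/-- The chord of the convex function exp over [0, a]; it passes an exponential moment on to smaller
exponents with linear dependence on c. -/
theorem exp_mul_le_of_mem_Icc {c : ℝ} (h0 : 0 ≤ c) (h1 : c ≤ 1) (a : ℝ) :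
    Real.exp (c * a) ≤ 1 + c * (Real.exp a - 1) := by
  have := convexOn_exp.2 (Set.mem_univ a) (Set.mem_univ 0) h0 (sub_nonneg.2 h1) (by ring)
  simp only [smul_eq_mul, mul_zero, add_zero, Real.exp_zero, mul_one] at this
  linarith

variable {Ω : Type*} [MeasurableSpace Ω] {μ : Measure Ω} [IsProbabilityMeasure μ]

theorem integrable_one_add_mul_sub_one {f : Ω → ℝ} (hf : Integrable f μ) (c : ℝ) :
    Integrable (fun ω ↦ 1 + c * (f ω - 1)) μ :=
  (integrable_const _).add ((hf.sub (integrable_const _)).const_mul _)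

theorem integral_one_add_mul_sub_one {f : Ω → ℝ} (hf : Integrable f μ) (c : ℝ) :
    ∫ ω, (1 + c * (f ω - 1)) ∂μ = 1 + c * (∫ ω, f ω ∂μ - 1) := by
  have h1 : Integrable (fun ω ↦ f ω - 1) μ := hf.sub (integrable_const _)
  rw [integral_add (integrable_const _) (h1.const_mul c), integral_const_mul,
    integral_sub hf (integrable_const _)]
  simp

/-- A centred variable `X` with `E exp(X²) ≤ 2` is sub-gaussian. -/
theorem hasSubgaussianMGF_of_integral_exp_sq_le {X : Ω → ℝ} (hX : AEMeasurable X μ)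
    (hXi : Integrable X μ) (h0 : ∫ ω, X ω ∂μ = 0)
    (hi : Integrable (fun ω ↦ Real.exp (X ω ^ 2)) μ) (h2 : ∫ ω, Real.exp (X ω ^ 2) ∂μ ≤ 2) :
    HasSubgaussianMGF X 2 μ := by
  have hdom : ∀ (t : ℝ) ω, Real.exp (t * X ω) ≤ Real.exp (t ^ 2 / 2) *
      (1 + 1 / 2 * (Real.exp (X ω ^ 2) - 1)) := fun t ω ↦ by
    calc Real.exp (t * X ω) ≤ Real.exp (t ^ 2 / 2 + 1 / 2 * X ω ^ 2) :=
          Real.exp_le_exp.2 (by nlinarith [sq_nonneg (t - X ω)])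
      _ ≤ _ := by
        rw [Real.exp_add]
        gcongr
        exact exp_mul_le_of_mem_Icc (by norm_num) (by norm_num) _
  have hdi : ∀ t : ℝ, Integrable (fun ω ↦ Real.exp (t ^ 2 / 2) *
      (1 + 1 / 2 * (Real.exp (X ω ^ 2) - 1))) μ := fun t ↦
    (integrable_one_add_mul_sub_one hi _).const_mul _
  have hint : ∀ t : ℝ, Integrable (fun ω ↦ Real.exp (t * X ω)) μ := fun t ↦ by
    refine (hdi t).mono' (by fun_prop) (Filter.Eventually.of_forall fun ω ↦ ?_)
    rw [Real.norm_eq_abs, abs_of_pos (Real.exp_pos _)]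
    exact hdom t ω
  refine ⟨hint, fun t ↦ ?_⟩
  rw [mgf]
  -- Centring matters only for small t. For t² > 1, Young's inequality loses a factor 3/2, which is
  -- at most 1 + t²/2 ≤ exp(t²/2).
  rcases le_or_gt (t ^ 2) 1 with ht | ht
  · calc ∫ ω, Real.exp (t * X ω) ∂μ
        ≤ ∫ ω, (t * X ω + (1 + t ^ 2 * (Real.exp (X ω ^ 2) - 1))) ∂μ := by
          refine integral_mono (hint t) ((hXi.const_mul t).add
            (integrable_one_add_mul_sub_one hi _)) fun ω ↦ ?_
          have h1 := exp_le_add_exp_sq (t * X ω)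
          rw [mul_pow] at h1
          have h2 := exp_mul_le_of_mem_Icc (sq_nonneg t) ht (X ω ^ 2)
          simp only
          linarith
      _ = 1 + t ^ 2 * (∫ ω, Real.exp (X ω ^ 2) ∂μ - 1) := by
          rw [integral_add (hXi.const_mul t) (integrable_one_add_mul_sub_one hi _),
            integral_const_mul, h0, integral_one_add_mul_sub_one hi, mul_zero, zero_add]
      _ ≤ t ^ 2 + 1 := by nlinarith [sq_nonneg t]
      _ ≤ Real.exp (t ^ 2) := Real.add_one_le_exp _
      _ = _ := by congr 1; simp
  · calc ∫ ω, Real.exp (t * X ω) ∂μ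
        ≤ ∫ ω, Real.exp (t ^ 2 / 2) * (1 + 1 / 2 * (Real.exp (X ω ^ 2) - 1)) ∂μ :=
          integral_mono (hint t) (hdi t) (hdom t)
      _ = Real.exp (t ^ 2 / 2) * (1 + 1 / 2 * (∫ ω, Real.exp (X ω ^ 2) ∂μ - 1)) := by
          rw [integral_const_mul, integral_one_add_mul_sub_one hi]
      _ ≤ Real.exp (t ^ 2 / 2) * Real.exp (t ^ 2 / 2) := by
          gcongr
          have := Real.add_one_le_exp (t ^ 2 / 2)
          linarith
      _ = _ := by rw [← Real.exp_add]; congr 1; simp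

theorem integrable_exp_sq_div_four_gaussianReal :
    Integrable (fun x : ℝ ↦ Real.exp (x ^ 2 / 4)) (gaussianReal 0 1) ∧
      ∫ x, Real.exp (x ^ 2 / 4) ∂(gaussianReal 0 1) = √2 := by
  have hpdf : ∀ x : ℝ, gaussianPDFReal 0 1 x • Real.exp (x ^ 2 / 4) =
      (√(2 * Real.pi))⁻¹ * Real.exp (-(1 / 4) * x ^ 2) := fun x ↦ by
    rw [gaussianPDFReal, smul_eq_mul, mul_assoc, ← Real.exp_add]
    congr 2
    · simp
    · simp; ring
  constructor
  · rw [gaussianReal_of_var_ne_zero _ one_ne_zero, gaussianPDF_def,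
      integrable_withDensity_iff_integrable_smul' (by fun_prop) (by simp)]
    refine ((integrable_exp_neg_mul_sq (b := 1 / 4) (by norm_num)).const_mul
      (√(2 * Real.pi))⁻¹).congr (Filter.Eventually.of_forall fun x ↦ ?_)
    simp only
    rw [ENNReal.toReal_ofReal (gaussianPDFReal_nonneg _ _ _), hpdf]
  · rw [integral_gaussianReal_eq_integral_smul one_ne_zero]
    simp_rw [hpdf]
    rw [integral_const_mul, integral_gaussian, ← Real.sqrt_inv, ← Real.sqrt_mul (by positivity)]
    congr 1
    field_simp
    norm_num

/-- The chord between c = 0 and c = 1/4, where the moment is √2, gives 1 + 4c(√2 - 1) ≤ 1 + 2c. -/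
theorem lintegral_exp_mul_sq_gaussianReal_le {c : ℝ} (h0 : 0 ≤ c) (h1 : c ≤ 1 / 4) :
    ∫⁻ x, ENNReal.ofReal (Real.exp (c * x ^ 2)) ∂(gaussianReal 0 1) ≤
      ENNReal.ofReal (Real.exp (2 * c)) := by
  obtain ⟨hi, he⟩ := integrable_exp_sq_div_four_gaussianReal
  have hi' : Integrable (fun x : ℝ ↦ 1 + 4 * c * (Real.exp (x ^ 2 / 4) - 1)) (gaussianReal 0 1) :=
    integrable_one_add_mul_sub_one hi _
  have hle : ∀ x : ℝ, Real.exp (c * x ^ 2) ≤ 1 + 4 * c * (Real.exp (x ^ 2 / 4) - 1) := fun x ↦ by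
    refine le_of_eq_of_le (by congr 1; ring)
      (exp_mul_le_of_mem_Icc (c := 4 * c) (by linarith) (by linarith) (x ^ 2 / 4))
  calc _ ≤ ∫⁻ x, ENNReal.ofReal (1 + 4 * c * (Real.exp (x ^ 2 / 4) - 1)) ∂(gaussianReal 0 1) :=
        lintegral_mono fun x ↦ ENNReal.ofReal_le_ofReal (hle x)
    _ = ENNReal.ofReal (∫ x, (1 + 4 * c * (Real.exp (x ^ 2 / 4) - 1)) ∂(gaussianReal 0 1)) := by
        rw [ofReal_integral_eq_lintegral_ofReal hi'
          (Filter.Eventually.of_forall fun x ↦ (Real.exp_pos _).le.trans (hle x))]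
    _ ≤ _ := by
        refine ENNReal.ofReal_le_ofReal ?_
        rw [integral_one_add_mul_sub_one hi, he]
        have h2 : √2 ≤ 3 / 2 := by
          rw [Real.sqrt_le_left (by norm_num)]; norm_num
        have := Real.add_one_le_exp (2 * c)
        nlinarith

end OneDim

/-! ### Moment generating function of a decoupled chaos. -/

section Chaos

variable {ι : Type*} [Fintype ι]

theorem lintegral_exp_sum_mul_pi_gaussianReal (t : ι → ℝ) :
    ∫⁻ g, ENNReal.ofReal (Real.exp (∑ i, t i * g i)) ∂(Measure.pi fun _ : ι ↦ gaussianReal 0 1) =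
      ENNReal.ofReal (Real.exp ((∑ i, t i ^ 2) / 2)) := by
  simp_rw [Real.exp_sum]
  rw [← ofReal_integral_eq_lintegral_ofReal]
  · rw [integral_fintype_prod_eq_prod (f := fun i x ↦ Real.exp (t i * x)), Finset.sum_div,
      Real.exp_sum]
    congr 1
    refine Finset.prod_congr rfl fun i _ ↦ ?_
    have := congrFun (mgf_id_gaussianReal (μ := 0) (v := 1)) (t i)
    simpa [mgf] using this
  · exact Integrable.fintype_prod (f := fun i x ↦ Real.exp (t i * x))
      fun i ↦ integrable_exp_mul_gaussianReal _
  · exact Filter.Eventually.of_forall fun g ↦ by positivity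

theorem lintegral_exp_mul_sum_sq_pi_gaussianReal_le {c : ℝ} (h0 : 0 ≤ c) (h1 : c ≤ 1 / 4) :
    ∫⁻ g, ENNReal.ofReal (Real.exp (c * ∑ i, g i ^ 2)) ∂(Measure.pi fun _ : ι ↦ gaussianReal 0 1) ≤
      ENNReal.ofReal (Real.exp (2 * c * Fintype.card ι)) := by
  simp_rw [Finset.mul_sum, Real.exp_sum]
  have : ∀ g : ι → ℝ, ENNReal.ofReal (∏ i, Real.exp (c * g i ^ 2)) =
      ∏ i, ENNReal.ofReal (Real.exp (c * g i ^ 2)) := fun g ↦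
    ENNReal.ofReal_prod_of_nonneg fun i _ ↦ (Real.exp_pos _).le
  simp_rw [this]
  rw [lintegral_prod_eq_prod_lintegral_of_indepFun Finset.univ
    (fun i (g : ι → ℝ) ↦ ENNReal.ofReal (Real.exp (c * g i ^ 2)))
    (iIndepFun_pi (X := fun _ x ↦ ENNReal.ofReal (Real.exp (c * x ^ 2)))
      fun i ↦ (by fun_prop : Measurable fun x : ℝ ↦ _).aemeasurable) (fun i ↦ by fun_prop)]
  calc _ ≤ ∏ _i : ι, ENNReal.ofReal (Real.exp (2 * c)) := by
        refine Finset.prod_le_prod' fun i _ ↦ ?_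
        refine le_of_eq_of_le ?_ (lintegral_exp_mul_sq_gaussianReal_le h0 h1)
        exact (measurePreserving_eval (fun _ : ι ↦ gaussianReal 0 1) i).lintegral_comp
          (f := fun x ↦ ENNReal.ofReal (Real.exp (c * x ^ 2))) (by fun_prop)
    _ = _ := by
        rw [Finset.prod_const, ← ENNReal.ofReal_pow (Real.exp_pos _).le, ← Real.exp_nat_mul,
          Finset.card_univ, mul_comm]

variable {Ω : Type*} [MeasurableSpace Ω] {μ : Measure Ω} [IsProbabilityMeasure μ]

/-- Decoupled chaos: if `P` and `Q` are independent random vectors whose linear forms are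
sub-gaussian with variance proxy `κ`, then `∑ Pᵢ Qᵢ` has a sub-exponential moment generating
function. -/
theorem lintegral_exp_mul_sum_mul_le {P Q : ι → Ω → ℝ} (hP : ∀ i, Measurable (P i))
    (hQ : ∀ i, Measurable (Q i)) (hPQ : IndepFun (fun ω i ↦ P i ω) (fun ω i ↦ Q i ω) μ)
    {κ : NNReal}
    (hsP : ∀ c : ι → ℝ, HasSubgaussianMGF (fun ω ↦ ∑ i, c i * P i ω) (κ * ∑ i, ‖c i‖₊ ^ 2) μ)
    (hsQ : ∀ c : ι → ℝ, HasSubgaussianMGF (fun ω ↦ ∑ i, c i * Q i ω) (κ * ∑ i, ‖c i‖₊ ^ 2) μ)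
    {s : ℝ} (hs : κ ^ 2 * s ^ 2 ≤ 1 / 2) :
    ∫⁻ ω, ENNReal.ofReal (Real.exp (s * ∑ i, P i ω * Q i ω)) ∂μ ≤
      ENNReal.ofReal (Real.exp (κ ^ 2 * s ^ 2 * Fintype.card ι)) := by
  have hmP : Measurable (fun ω i ↦ P i ω) := measurable_pi_iff.2 hP
  have hmQ : Measurable (fun ω i ↦ Q i ω) := measurable_pi_iff.2 hQ
  set νP := μ.map (fun ω i ↦ P i ω) with hνP
  set νQ := μ.map (fun ω i ↦ Q i ω) with hνQ
  have : IsProbabilityMeasure νP := Measure.isProbabilityMeasure_map hmP.aemeasurable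
  have : IsProbabilityMeasure νQ := Measure.isProbabilityMeasure_map hmQ.aemeasurable
  have hsub : ∀ (R : ι → Ω → ℝ), (∀ i, Measurable (R i)) →
      (∀ c : ι → ℝ, HasSubgaussianMGF (fun ω ↦ ∑ i, c i * R i ω) (κ * ∑ i, ‖c i‖₊ ^ 2) μ) →
      ∀ c : ι → ℝ, ∫⁻ r, ENNReal.ofReal (Real.exp (∑ i, c i * r i)) ∂(μ.map (fun ω i ↦ R i ω)) ≤
        ENNReal.ofReal (Real.exp (κ * (∑ i, c i ^ 2) / 2)) := by
    intro R hR hsR c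
    rw [lintegral_map (by fun_prop) (measurable_pi_iff.2 hR),
      ← ofReal_integral_eq_lintegral_ofReal (by simpa using (hsR c).integrable_exp_mul 1)
        (Filter.Eventually.of_forall fun _ ↦ (Real.exp_pos _).le)]
    refine ENNReal.ofReal_le_ofReal ?_
    have := (hsR c).mgf_le 1
    simpa [mgf] using this
  have hsqrt : √(κ : ℝ) ^ 2 = κ := Real.sq_sqrt κ.2
  calc ∫⁻ ω, ENNReal.ofReal (Real.exp (s * ∑ i, P i ω * Q i ω)) ∂μ
      = ∫⁻ z : (ι → ℝ) × (ι → ℝ), ENNReal.ofReal (Real.exp (∑ i, (s * z.1 i) * z.2 i))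
          ∂(νP.prod νQ) := by
        rw [← (indepFun_iff_map_prod_eq_prod_map_map hmP.aemeasurable hmQ.aemeasurable).1 hPQ,
          lintegral_map (by fun_prop) (hmP.prodMk hmQ)]
        simp only [Finset.mul_sum, mul_assoc]
    _ = ∫⁻ p, ∫⁻ q, ENNReal.ofReal (Real.exp (∑ i, (s * p i) * q i)) ∂νQ ∂νP := by
        rw [lintegral_prod _ (by fun_prop)]
    _ ≤ ∫⁻ p, ENNReal.ofReal (Real.exp (κ * (∑ i, (s * p i) ^ 2) / 2)) ∂νP :=
        lintegral_mono fun p ↦ hsub Q hQ hsQ _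
    -- The exponential of a squared norm is a Gaussian Laplace transform. The auxiliary vector g
    -- makes the exponent linear in p again, so after exchanging integrals the sub-gaussian bound
    -- for P applies.
    _ = ∫⁻ p, ∫⁻ g, ENNReal.ofReal (Real.exp (∑ i, (√κ * s * p i) * g i))
          ∂(Measure.pi fun _ : ι ↦ gaussianReal 0 1) ∂νP := by
        refine lintegral_congr fun p ↦ ?_
        rw [lintegral_exp_sum_mul_pi_gaussianReal]
        simp only [mul_pow, hsqrt, mul_assoc, Finset.mul_sum]
    _ = ∫⁻ g, ∫⁻ p, ENNReal.ofReal (Real.exp (∑ i, (√κ * s * g i) * p i)) ∂νP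
          ∂(Measure.pi fun _ : ι ↦ gaussianReal 0 1) := by
        rw [lintegral_lintegral_swap (by fun_prop)]
        refine lintegral_congr fun g ↦ lintegral_congr fun p ↦ ?_
        congr 3 with i
        ring
    _ ≤ ∫⁻ g, ENNReal.ofReal (Real.exp (κ * (∑ i, (√κ * s * g i) ^ 2) / 2))
          ∂(Measure.pi fun _ : ι ↦ gaussianReal 0 1) :=
        lintegral_mono fun g ↦ hsub P hP hsP _
    _ = ∫⁻ g, ENNReal.ofReal (Real.exp (κ ^ 2 * s ^ 2 / 2 * ∑ i, g i ^ 2))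
          ∂(Measure.pi fun _ : ι ↦ gaussianReal 0 1) := by
        refine lintegral_congr fun g ↦ ?_
        simp only [mul_pow, hsqrt, ← Finset.mul_sum]
        congr 2
        ring
    -- The assumption `hs` says exactly that the coefficient κ²s²/2 of the Gaussian squares is at
    -- most 1/4.
    _ ≤ _ := by
        refine (lintegral_exp_mul_sum_sq_pi_gaussianReal_le (by positivity) (by linarith)).trans_eq
          ?_
        congr 3
        ring

end Chaos

/-! ### Concentration of Lipschitz functions of a Gaussian vector. -/

section GaussianLipschitz

theorem pi_absolutelyContinuous {μ ν : Measure ℝ} [SigmaFinite μ] [SigmaFinite ν] (h : μ ≪ ν) (n : ℕ) :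
    Measure.pi (fun _ : Fin n ↦ μ) ≪ Measure.pi (fun _ : Fin n ↦ ν) := by
  induction n with
  | zero => rw [Measure.pi_of_empty, Measure.pi_of_empty]
  | succ n ih =>
    have h1 := (measurePreserving_piFinSuccAbove (fun _ : Fin (n + 1) ↦ μ) 0).symm
    have h2 := (measurePreserving_piFinSuccAbove (fun _ : Fin (n + 1) ↦ ν) 0).symm
    rw [← h1.map_eq, ← h2.map_eq]
    exact (h.prod ih).map (MeasurableEquiv.measurable _)

theorem ofReal_integral_le_lintegral_ofReal {Ω : Type*} [MeasurableSpace Ω] {μ : Measure Ω}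
    {f : Ω → ℝ} (hf : Integrable f μ) :
    ENNReal.ofReal (∫ ω, f ω ∂μ) ≤ ∫⁻ ω, ENNReal.ofReal (f ω) ∂μ := by
  have h1 : ∀ ω, ENNReal.ofReal (f ω) = ENNReal.ofReal (max (f ω) 0) := fun ω ↦ by
    rcases le_total (f ω) 0 with h | h
    · rw [max_eq_right h, ENNReal.ofReal_of_nonpos h, ENNReal.ofReal_zero]
    · rw [max_eq_left h]
  simp_rw [h1]
  rw [← ofReal_integral_eq_lintegral_ofReal hf.pos_part
    (Filter.Eventually.of_forall fun _ ↦ le_max_right _ _)]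
  exact ENNReal.ofReal_le_ofReal (integral_mono hf hf.pos_part fun ω ↦ le_max_left _ _)

variable {k : ℕ}

/-- Carries Rademacher's theorem from Lebesgue measure to the Gaussian measure. -/
theorem stdGaussian_absolutelyContinuous :
    stdGaussian (EuclideanSpace ℝ (Fin k)) ≪ volume := by
  rw [← map_pi_eq_stdGaussian, ← (PiLp.volume_preserving_toLp (Fin k)).map_eq]
  exact (pi_absolutelyContinuous (gaussianReal_absolutelyContinuous 0 one_ne_zero) k).map
    (by fun_prop)

theorem map_inner_stdGaussian (v : EuclideanSpace ℝ (Fin k)) :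
    (stdGaussian (EuclideanSpace ℝ (Fin k))).map (fun x ↦ inner ℝ v x) =
      gaussianReal 0 (‖v‖₊ ^ 2) := by
  have := IsGaussian.map_eq_gaussianReal (μ := stdGaussian (EuclideanSpace ℝ (Fin k)))
    (innerSL ℝ v)
  rw [integral_strongDual_stdGaussian, variance_dual_stdGaussian, innerSL_apply_norm] at this
  rwa [Real.toNNReal_pow (norm_nonneg v), norm_toNNReal] at this

theorem integrable_norm_stdGaussian :
    Integrable (fun x ↦ ‖x‖) (stdGaussian (EuclideanSpace ℝ (Fin k))) :=
  (IsGaussian.integrable_id (μ := stdGaussian (EuclideanSpace ℝ (Fin k)))).norm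

theorem integrable_of_lipschitz {L : NNReal} {h : EuclideanSpace ℝ (Fin k) → ℝ}
    (hL : LipschitzWith L h) : Integrable h (stdGaussian (EuclideanSpace ℝ (Fin k))) := by
  refine ((integrable_const |h 0|).add (integrable_norm_stdGaussian.const_mul (L : ℝ))).mono'
    hL.continuous.aestronglyMeasurable (Filter.Eventually.of_forall fun x ↦ ?_)
  have := hL.norm_sub_le x 0
  rw [sub_zero] at this
  have h2 := norm_sub_norm_le (h x) (h 0)
  simp only [Real.norm_eq_abs, Pi.add_apply] at this h2 ⊢
  linarith

theorem lintegral_exp_mul_inner_stdGaussian (c : ℝ) (v : EuclideanSpace ℝ (Fin k)) :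
    ∫⁻ x, ENNReal.ofReal (Real.exp (c * inner ℝ v x)) ∂stdGaussian (EuclideanSpace ℝ (Fin k)) =
      ENNReal.ofReal (Real.exp (c ^ 2 * ‖v‖ ^ 2 / 2)) := by
  have h1 : ∫⁻ x, ENNReal.ofReal (Real.exp (c * inner ℝ v x))
      ∂stdGaussian (EuclideanSpace ℝ (Fin k)) =
      ∫⁻ y, ENNReal.ofReal (Real.exp (c * y)) ∂gaussianReal 0 (‖v‖₊ ^ 2) := by
    rw [← map_inner_stdGaussian, lintegral_map (by fun_prop) (by fun_prop)]
  rw [h1, ← ofReal_integral_eq_lintegral_ofReal (integrable_exp_mul_gaussianReal _)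
    (Filter.Eventually.of_forall fun _ ↦ (Real.exp_pos _).le)]
  have := congrFun (mgf_id_gaussianReal (μ := 0) (v := ‖v‖₊ ^ 2)) c
  simp only [mgf, id] at this
  rw [this]
  congr 2
  simp
  ring

/-- Gaussian interpolation: `h(y) - h(x)` as an average of derivatives along a rotation. -/
theorem ae_sub_eq_integral_fderiv {L : NNReal} {h : EuclideanSpace ℝ (Fin k) → ℝ}
    (hL : LipschitzWith L h) :
    ∀ᵐ z ∂((stdGaussian (EuclideanSpace ℝ (Fin k))).prod (stdGaussian (EuclideanSpace ℝ (Fin k)))),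
      h z.2 - h z.1 = ∫ θ in Set.Ioc (0 : ℝ) 1, Real.pi / 2 *
        fderiv ℝ h (ContinuousLinearMap.rotation (Real.pi / 2 * θ) z).1
          (ContinuousLinearMap.rotation (Real.pi / 2 * θ) z).2 := by
  set γ := stdGaussian (EuclideanSpace ℝ (Fin k)) with hγ
  have hcont : Continuous fun p : (EuclideanSpace ℝ (Fin k) × EuclideanSpace ℝ (Fin k)) × ℝ ↦
      ContinuousLinearMap.rotation (Real.pi / 2 * p.2) p.1 := by
    simp only [ContinuousLinearMap.rotation_apply]
    fun_prop
  -- Rotations preserve γ × γ, so the rotated point is Gaussian for each fixed θ and h is almost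
  -- surely differentiable there. Fubini then gives, for almost every z, differentiability at almost
  -- every θ.
  have hdiff : ∀ θ : ℝ, ∀ᵐ z ∂(γ.prod γ),
      DifferentiableAt ℝ h (ContinuousLinearMap.rotation (Real.pi / 2 * θ) z).1 := by
    intro θ
    have h1 : ∀ᵐ z ∂(γ.prod γ), DifferentiableAt ℝ h z.1 :=
      Measure.quasiMeasurePreserving_fst.ae
        (stdGaussian_absolutelyContinuous.ae_le hL.ae_differentiableAt)
    have h2 := IsGaussian.map_rotation_eq_self (μ := γ) (by
      simp [hγ]) (Real.pi / 2 * θ)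
    rw [← h2] at h1
    exact ae_of_ae_map (p := fun z : EuclideanSpace ℝ (Fin k) × EuclideanSpace ℝ (Fin k) ↦
      DifferentiableAt ℝ h z.1)
      (ContinuousLinearMap.continuous _).measurable.aemeasurable h1
  have hms : MeasurableSet {p : (EuclideanSpace ℝ (Fin k) × EuclideanSpace ℝ (Fin k)) × ℝ |
      DifferentiableAt ℝ h (ContinuousLinearMap.rotation (Real.pi / 2 * p.2) p.1).1} :=
    (measurable_fst.comp hcont.measurable) (measurableSet_of_differentiableAt ℝ h)
  have hae : ∀ᵐ z ∂(γ.prod γ), ∀ᵐ θ : ℝ,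
      DifferentiableAt ℝ h (ContinuousLinearMap.rotation (Real.pi / 2 * θ) z).1 :=
    (Measure.ae_ae_comm (p := fun z θ ↦ DifferentiableAt ℝ h
      (ContinuousLinearMap.rotation (Real.pi / 2 * θ) z).1) hms).2
      (Filter.Eventually.of_forall hdiff)
  filter_upwards [hae] with z hz
  let c : ℝ → EuclideanSpace ℝ (Fin k) := fun θ ↦
    (ContinuousLinearMap.rotation (Real.pi / 2 * θ) z).1
  have hc : ∀ θ, HasDerivAt c ((Real.pi / 2) •
      (ContinuousLinearMap.rotation (Real.pi / 2 * θ) z).2) θ := fun θ ↦ by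
    have h1 : HasDerivAt (fun θ : ℝ ↦ Real.pi / 2 * θ) (Real.pi / 2) θ := by
      simpa using (hasDerivAt_id θ).const_mul (Real.pi / 2)
    have := (h1.cos.smul_const z.1).add (h1.sin.smul_const z.2)
    refine this.congr_deriv ?_
    simp only [ContinuousLinearMap.rotation_apply, smul_add, smul_smul]
    congr 2 <;> ring
  have hcl : ∃ K : NNReal, LipschitzWith K c := by
    refine ⟨Real.toNNReal (Real.pi / 2 * (‖z.1‖ + ‖z.2‖)),
      lipschitzWith_of_nnnorm_deriv_le (𝕜 := ℝ) (fun θ ↦ (hc θ).differentiableAt) fun θ ↦ ?_⟩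
    rw [(hc θ).deriv, Real.le_toNNReal_iff_coe_le (by positivity), coe_nnnorm, norm_smul,
      Real.norm_of_nonneg (by positivity)]
    simp only [ContinuousLinearMap.rotation_apply]
    gcongr
    refine (norm_add_le _ _).trans ?_
    rw [norm_smul, norm_smul, norm_neg]
    gcongr
    · exact mul_le_of_le_one_left (norm_nonneg _) (Real.abs_sin_le_one _)
    · exact mul_le_of_le_one_left (norm_nonneg _) (Real.abs_cos_le_one _)
  obtain ⟨K, hK⟩ := hcl
  -- A Lipschitz function along a Lipschitz path is absolutely continuous, so the fundamental
  -- theorem of calculus needs the derivative only almost everywhere.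
  have hac : AbsolutelyContinuousOnInterval (h ∘ c) 0 1 :=
    ((hL.comp hK).lipschitzOnWith).absolutelyContinuousOnInterval
  have hftc := hac.integral_deriv_eq_sub
  rw [intervalIntegral.integral_of_le zero_le_one] at hftc
  have hc0 : c 0 = z.1 := by simp [c, ContinuousLinearMap.rotation_apply]
  have hc1 : c 1 = z.2 := by simp [c, ContinuousLinearMap.rotation_apply]
  simp only [Function.comp_apply, hc0, hc1] at hftc
  rw [← hftc]
  refine integral_congr_ae ((ae_restrict_of_ae hz).mono fun θ hθ ↦ ?_)
  have hθ' : HasFDerivAt h (fderiv ℝ h (c θ)) (c θ) := hθ.hasFDerivAt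
  have := hθ'.comp_hasDerivAt θ (hc θ)
  change deriv (h ∘ c) θ = _
  rw [this.deriv, map_smul, smul_eq_mul]

/-- Maurey-Pisier: the difference of a Lipschitz function at independent Gaussian points is
sub-gaussian. -/
theorem lintegral_exp_sub_le {L : NNReal} {h : EuclideanSpace ℝ (Fin k) → ℝ}
    (hL : LipschitzWith L h) (t : ℝ) :
    ∫⁻ z, ENNReal.ofReal (Real.exp (t * (h z.2 - h z.1)))
      ∂((stdGaussian (EuclideanSpace ℝ (Fin k))).prod (stdGaussian (EuclideanSpace ℝ (Fin k)))) ≤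
      ENNReal.ofReal (Real.exp ((t * (Real.pi / 2)) ^ 2 * L ^ 2 / 2)) := by
  set γ := stdGaussian (EuclideanSpace ℝ (Fin k)) with hγ
  set ν : Measure ℝ := volume.restrict (Set.Ioc (0 : ℝ) 1) with hν
  have : IsProbabilityMeasure ν := ⟨by simp [hν]⟩
  have hcont : Continuous fun p : (EuclideanSpace ℝ (Fin k) × EuclideanSpace ℝ (Fin k)) × ℝ ↦
      ContinuousLinearMap.rotation (Real.pi / 2 * p.2) p.1 := by
    simp only [ContinuousLinearMap.rotation_apply]
    fun_prop
  obtain ⟨D, hDdef⟩ : ∃ D : EuclideanSpace ℝ (Fin k) × EuclideanSpace ℝ (Fin k) → ℝ,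
      D = fun z ↦ fderiv ℝ h z.1 z.2 := ⟨_, rfl⟩
  have hD : Measurable D := by
    have h1 : Measurable fun z : EuclideanSpace ℝ (Fin k) × EuclideanSpace ℝ (Fin k) ↦
        (fderiv ℝ h z.1, z.2) :=
     
      ((measurable_fderiv ℝ h).comp measurable_fst).prodMk measurable_snd
    rw [hDdef]
    exact (isBoundedBilinearMap_apply (𝕜 := ℝ) (E := EuclideanSpace ℝ (Fin k))
      (F := ℝ)).continuous.measurable.comp h1
  have hDb : ∀ z, |D z| ≤ L * ‖z.2‖ := fun z ↦ by
    rw [hDdef]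
    refine ((fderiv ℝ h z.1).le_opNorm z.2).trans ?_
    gcongr
    exact norm_fderiv_le_of_lipschitz ℝ hL
  have hjm : Measurable fun p : (EuclideanSpace ℝ (Fin k) × EuclideanSpace ℝ (Fin k)) × ℝ ↦
      D (ContinuousLinearMap.rotation (Real.pi / 2 * p.2) p.1) := hD.comp hcont.measurable
  have hrot : ∀ z : EuclideanSpace ℝ (Fin k) × EuclideanSpace ℝ (Fin k), ∀ θ,
      |D (ContinuousLinearMap.rotation (Real.pi / 2 * θ) z)| ≤ L * (‖z.1‖ + ‖z.2‖) := by
    intro z θ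
    refine (hDb _).trans ?_
    gcongr
    simp only [ContinuousLinearMap.rotation_apply]
    refine (norm_add_le _ _).trans ?_
    rw [norm_smul, norm_smul, norm_neg]
    gcongr
    · exact mul_le_of_le_one_left (norm_nonneg _) (Real.abs_sin_le_one _)
    · exact mul_le_of_le_one_left (norm_nonneg _) (Real.abs_cos_le_one _)
  -- Jensen's inequality for the uniform average over θ.
  have hle : ∀ᵐ z ∂(γ.prod γ), ENNReal.ofReal (Real.exp (t * (h z.2 - h z.1))) ≤
      ∫⁻ θ, ENNReal.ofReal (Real.exp (t * (Real.pi / 2) *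
          D (ContinuousLinearMap.rotation (Real.pi / 2 * θ) z))) ∂ν := by
    filter_upwards [ae_sub_eq_integral_fderiv hL] with z hz
    have hm : Measurable fun θ : ℝ ↦ D (ContinuousLinearMap.rotation (Real.pi / 2 * θ) z) := by
      have h1 : Continuous fun θ : ℝ ↦ ContinuousLinearMap.rotation (Real.pi / 2 * θ) z := by
        simp only [ContinuousLinearMap.rotation_apply]
        fun_prop
      exact hD.comp h1.measurable
    have hi : Integrable (fun θ ↦ t * (Real.pi / 2) *
        D (ContinuousLinearMap.rotation (Real.pi / 2 * θ) z)) ν := by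
      refine Integrable.const_mul ?_ _
      exact Integrable.of_bound hm.aestronglyMeasurable _
        (Filter.Eventually.of_forall (hrot z))
    have hie : Integrable (fun θ ↦ Real.exp (t * (Real.pi / 2) *
        D (ContinuousLinearMap.rotation (Real.pi / 2 * θ) z))) ν := by
      refine Integrable.of_bound (C := Real.exp (|t * (Real.pi / 2)| *
        (L * (‖z.1‖ + ‖z.2‖)))) (hm.const_mul _).exp.aestronglyMeasurable (Filter.Eventually.of_forall fun θ ↦ ?_)
      rw [Real.norm_eq_abs, Real.abs_exp, Real.exp_le_exp]
      refine (le_abs_self _).trans ?_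
      rw [abs_mul]
      gcongr
      exact hrot z θ
    rw [← ofReal_integral_eq_lintegral_ofReal hie
      (Filter.Eventually.of_forall fun _ ↦ (Real.exp_pos _).le)]
    refine ENNReal.ofReal_le_ofReal ?_
    have := convexOn_exp.map_integral_le (μ := ν) Real.continuous_exp.continuousOn isClosed_univ
      (Filter.Eventually.of_forall fun _ ↦ Set.mem_univ _) hi hie
    refine le_of_eq_of_le ?_ this
    congr 1
    rw [hz, ← integral_const_mul, hDdef, hν]
    simp only [mul_assoc]
  calc ∫⁻ z, ENNReal.ofReal (Real.exp (t * (h z.2 - h z.1))) ∂(γ.prod γ)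
      ≤ ∫⁻ z, ∫⁻ θ, ENNReal.ofReal (Real.exp (t * (Real.pi / 2) *
          D (ContinuousLinearMap.rotation (Real.pi / 2 * θ) z))) ∂ν ∂(γ.prod γ) := by
        exact lintegral_mono_ae hle
    _ = ∫⁻ θ, ∫⁻ z, ENNReal.ofReal (Real.exp (t * (Real.pi / 2) *
          D (ContinuousLinearMap.rotation (Real.pi / 2 * θ) z))) ∂(γ.prod γ) ∂ν := by
        rw [lintegral_lintegral_swap]
        exact (ENNReal.measurable_ofReal.comp
          (Real.measurable_exp.comp (hjm.const_mul _))).aemeasurable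
    -- The rotated point and its velocity (up to π/2) are again independent standard Gaussians, so θ
    -- disappears. Given the first, the derivative is a Gaussian linear form of norm at most L.
    _ = ∫⁻ θ, ∫⁻ z, ENNReal.ofReal (Real.exp (t * (Real.pi / 2) * D z)) ∂(γ.prod γ) ∂ν := by
        refine lintegral_congr fun θ ↦ ?_
        conv_rhs => rw [← IsGaussian.map_rotation_eq_self (μ := γ) (by simp [hγ]) (Real.pi / 2 * θ)]
        rw [lintegral_map (by fun_prop) (by fun_prop)]
    _ = ∫⁻ z, ENNReal.ofReal (Real.exp (t * (Real.pi / 2) * D z)) ∂(γ.prod γ) := by simp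
    _ = ∫⁻ x, ∫⁻ y, ENNReal.ofReal (Real.exp (t * (Real.pi / 2) * D (x, y))) ∂γ ∂γ :=
        lintegral_prod _ (by fun_prop)
    _ ≤ ∫⁻ _x, ENNReal.ofReal (Real.exp ((t * (Real.pi / 2)) ^ 2 * L ^ 2 / 2)) ∂γ := by
        refine lintegral_mono fun x ↦ ?_
        have h1 : ∀ y, D (x, y) =
            inner ℝ ((InnerProductSpace.toDual ℝ _).symm (fderiv ℝ h x)) y := fun y ↦ by
          rw [hDdef, InnerProductSpace.toDual_symm_apply]
        simp_rw [h1]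
        rw [lintegral_exp_mul_inner_stdGaussian, LinearIsometryEquiv.norm_map]
        refine ENNReal.ofReal_le_ofReal (Real.exp_le_exp.2 ?_)
        gcongr
        exact norm_fderiv_le_of_lipschitz ℝ hL
    _ = _ := by simp

/-- Gaussian concentration: a Lipschitz function of a standard Gaussian vector is sub-gaussian
about its mean. -/
theorem lintegral_exp_mul_sub_gaussianMean_le {L : NNReal} {h : EuclideanSpace ℝ (Fin k) → ℝ}
    (hL : LipschitzWith L h) (t : ℝ) :
    ∫⁻ x, ENNReal.ofReal (Real.exp (t * (h x - gaussianMean h)))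
      ∂(stdGaussian (EuclideanSpace ℝ (Fin k))) ≤
      ENNReal.ofReal (Real.exp ((t * (Real.pi / 2)) ^ 2 * L ^ 2 / 2)) := by
  have hc := hL.continuous
  have hm : Measurable h := hc.measurable
  have hi := integrable_of_lipschitz hL
  set γ := stdGaussian (EuclideanSpace ℝ (Fin k)) with hγ
  -- Jensen, through 1 + x ≤ exp x: replacing the mean by an independent copy can only increase the
  -- moment.
  have h1 : 1 ≤ ∫⁻ x, ENNReal.ofReal (Real.exp (t * (gaussianMean h - h x))) ∂γ := by
    have hi1 : Integrable (fun x ↦ gaussianMean h - h x) γ := (integrable_const _).sub hi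
    have hi' : Integrable (fun x ↦ t * (gaussianMean h - h x) + 1) γ :=
      (hi1.const_mul _).add (integrable_const _)
    calc (1 : ENNReal) = ENNReal.ofReal (∫ x, (t * (gaussianMean h - h x) + 1) ∂γ) := by
          rw [integral_add (hi1.const_mul _) (integrable_const _), integral_const_mul,
            integral_sub (integrable_const _) hi]
          simp [gaussianMean, hγ]
      _ ≤ ∫⁻ x, ENNReal.ofReal (t * (gaussianMean h - h x) + 1) ∂γ :=
          ofReal_integral_le_lintegral_ofReal hi'
      _ ≤ _ := lintegral_mono fun x ↦ ENNReal.ofReal_le_ofReal (Real.add_one_le_exp _)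
  calc _ ≤ (∫⁻ x, ENNReal.ofReal (Real.exp (t * (gaussianMean h - h x))) ∂γ) *
        ∫⁻ x, ENNReal.ofReal (Real.exp (t * (h x - gaussianMean h))) ∂γ :=
        le_mul_of_one_le_left zero_le h1
    _ = ∫⁻ z, ENNReal.ofReal (Real.exp (t * (h z.2 - h z.1))) ∂(γ.prod γ) := by
        rw [← lintegral_prod_mul (by fun_prop) (by fun_prop)]
        refine lintegral_congr fun z ↦ ?_
        rw [← ENNReal.ofReal_mul (Real.exp_pos _).le, ← Real.exp_add]
        congr 2
        ring
    _ ≤ _ := lintegral_exp_sub_le hL t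

end GaussianLipschitz

/-! ### Gaussian features and the directions orthogonal to them. -/

section Feature

variable {d k : ℕ} {B : Matrix (Fin d) (Fin k) ℝ}

theorem continuous_feature (B : Matrix (Fin d) (Fin k) ℝ) : Continuous (feature B) := by
  unfold feature
  fun_prop

theorem map_feature_stdGaussian (hB : Bᵀ * B = 1) :
    (stdGaussian (EuclideanSpace ℝ (Fin d))).map (feature B) =
      stdGaussian (EuclideanSpace ℝ (Fin k)) := by
  have hm := (continuous_feature B).measurable
  have := Measure.isProbabilityMeasure_map hm.aemeasurable
    (μ := stdGaussian (EuclideanSpace ℝ (Fin d)))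
  apply Measure.ext_of_charFun
  ext t
  rw [charFun_stdGaussian, charFun_apply, integral_map hm.aemeasurable (by fun_prop),
    ← (columnIsometry B hB).norm_map t, ← charFun_stdGaussian, charFun_apply]
  simp_rw [inner_columnIsometry B hB]

/-- The reflection in the range of `B` preserves the Gaussian measure and the feature but changes
the sign of ⟨w, z⟩, so the integral equals its own negative. -/
theorem integral_mul_inner_eq_zero (hB : Bᵀ * B = 1) (h : EuclideanSpace ℝ (Fin k) → ℝ)
    {w : EuclideanSpace ℝ (Fin d)} (hw : feature B w = 0) :
    ∫ z, h (feature B z) * inner ℝ w z ∂stdGaussian (EuclideanSpace ℝ (Fin d)) = 0 := by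
  let K : Submodule ℝ (EuclideanSpace ℝ (Fin d)) := LinearMap.range (columnIsometry B hB).toLinearMap
  let R := K.reflection
  have hRb : ∀ u, R (columnIsometry B hB u) = columnIsometry B hB u := fun u ↦
    Submodule.reflection_mem_subspace_eq_self ⟨u, rfl⟩
  have hRw : R w = -w := by
    refine Submodule.reflection_mem_subspace_orthogonalComplement_eq_neg ?_
    rw [Submodule.mem_orthogonal']
    rintro _ ⟨u, rfl⟩
    change inner ℝ w (columnIsometry B hB u) = 0
    rw [inner_columnIsometry, hw, inner_zero_left]
  have hf : ∀ z, feature B (R z) = feature B z := fun z ↦ by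
    refine ext_inner_right ℝ fun u ↦ ?_
    rw [← inner_columnIsometry B hB, ← inner_columnIsometry B hB]
    nth_rewrite 1 [← hRb u]
    exact R.inner_map_map z _
  have hwz : ∀ z, inner ℝ w (R z) = -inner ℝ w z := fun z ↦ by
    have h1 := R.inner_map_map w z
    rw [hRw, inner_neg_left] at h1
    linarith
  have key : ∫ z, h (feature B z) * inner ℝ w z ∂stdGaussian (EuclideanSpace ℝ (Fin d)) =
      -∫ z, h (feature B z) * inner ℝ w z ∂stdGaussian (EuclideanSpace ℝ (Fin d)) := by
    conv_lhs => rw [← stdGaussian_map R]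
    have hRm : MeasurableEmbedding R := R.toHomeomorph.measurableEmbedding
    rw [hRm.integral_map, ← integral_neg]
    refine integral_congr_ae (Filter.Eventually.of_forall fun z ↦ ?_)
    change h (feature B (R z)) * inner ℝ w (R z) = _
    rw [hf, hwz]
    ring
  linarith

theorem integral_sq_gaussianReal (v : NNReal) : ∫ t, t ^ 2 ∂gaussianReal 0 v = v := by
  have := variance_id_gaussianReal (μ := 0) (v := v)
  rw [variance_of_integral_eq_zero aemeasurable_id (by simp)] at this
  simpa using this

end Feature

/-! ### One sample: Stein-type identity, truncation, sub-gaussian scores. -/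

section Sample

variable {Ω : Type*} [MeasurableSpace Ω] {μ : Measure Ω} {d k : ℕ}
  {x : Ω → EuclideanSpace ℝ (Fin d)} {y : Ω → ℝ}

theorem integral_inner_sq (hxm : Measurable x)
    (hx : μ.map x = stdGaussian (EuclideanSpace ℝ (Fin d))) (v : EuclideanSpace ℝ (Fin d)) :
    ∫ ω, inner ℝ v (x ω) ^ 2 ∂μ = ‖v‖ ^ 2 := by
  have h1 : μ.map (fun ω ↦ inner ℝ v (x ω)) = gaussianReal 0 (‖v‖₊ ^ 2) := by
    rw [← map_inner_stdGaussian, ← hx, Measure.map_map (by fun_prop) hxm]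
    rfl
  have h2 := integral_sq_gaussianReal (‖v‖₊ ^ 2)
  rw [← h1, integral_map (by fun_prop) (by fun_prop)] at h2
  simpa using h2

theorem integrable_norm_sq (hxm : Measurable x)
    (hx : μ.map x = stdGaussian (EuclideanSpace ℝ (Fin d))) : Integrable (fun ω ↦ ‖x ω‖ ^ 2) μ := by
  have h1 := (IsGaussian.memLp_two_id
    (μ := stdGaussian (EuclideanSpace ℝ (Fin d)))).integrable_norm_pow two_ne_zero
  rw [← hx] at h1
  exact h1.comp_measurable hxm

theorem integrable_inner_sq (hxm : Measurable x)
    (hx : μ.map x = stdGaussian (EuclideanSpace ℝ (Fin d))) (v : EuclideanSpace ℝ (Fin d)) :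
    Integrable (fun ω ↦ inner ℝ v (x ω) ^ 2) μ := by
  refine ((integrable_norm_sq hxm hx).const_mul (‖v‖ ^ 2)).mono' (by fun_prop)
    (Filter.Eventually.of_forall fun ω ↦ ?_)
  rw [Real.norm_of_nonneg (sq_nonneg _), ← mul_pow, sq_le_sq, abs_of_nonneg
    (by positivity : 0 ≤ ‖v‖ * ‖x ω‖)]
  exact abs_real_inner_le_norm _ _

/-- If `|f| ≤ e^{2|y|}`, then `|E[f ⟨v, x⟩]| ≤ (E e^{4|y|} + 1) / 2` and `f x` is integrable. -/
theorem integrable_mul_norm_of_le_exp (hxm : Measurable x)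
    (hx : μ.map x = stdGaussian (EuclideanSpace ℝ (Fin d)))
    (hi : Integrable (fun ω ↦ Real.exp (4 * |y ω|)) μ) {f : Ω → ℝ} (hf : Measurable f)
    (hfy : ∀ ω, |f ω| ≤ Real.exp (2 * |y ω|)) : Integrable (fun ω ↦ f ω • x ω) μ := by
  refine ((hi.add (integrable_norm_sq hxm hx)).div_const 2).mono'
    (hf.smul hxm).aestronglyMeasurable (Filter.Eventually.of_forall fun ω ↦ ?_)
  have h1 : Real.exp (4 * |y ω|) = Real.exp (2 * |y ω|) ^ 2 := by
    rw [← Real.exp_nat_mul]; congr 1; push_cast; ring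
  have h2 := mul_le_mul_of_nonneg_right (hfy ω) (norm_nonneg (x ω))
  rw [norm_smul, Real.norm_eq_abs]
  simp only [Pi.add_apply, h1]
  nlinarith [sq_nonneg (Real.exp (2 * |y ω|) - ‖x ω‖)]

theorem abs_inner_integral_le_of_le_exp (hxm : Measurable x)
    (hx : μ.map x = stdGaussian (EuclideanSpace ℝ (Fin d)))
    (hi : Integrable (fun ω ↦ Real.exp (4 * |y ω|)) μ) {f : Ω → ℝ} (hf : Measurable f) {c : ℝ}
    (hc : 0 ≤ c) (hc1 : c ≤ 1) (hfy : ∀ ω, |f ω| ≤ c * Real.exp (2 * |y ω|))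
    {v : EuclideanSpace ℝ (Fin d)} (hv : ‖v‖ ≤ 1) :
    |inner ℝ v (∫ ω, f ω • x ω ∂μ)| ≤ c * ((∫ ω, Real.exp (4 * |y ω|) ∂μ + 1) / 2) := by
  have hint := integrable_mul_norm_of_le_exp hxm hx hi hf fun ω ↦
    (hfy ω).trans (mul_le_of_le_one_left (Real.exp_pos _).le hc1)
  rw [← integral_inner hint]
  have hi2 := integrable_inner_sq hxm hx v
  calc |∫ ω, inner ℝ v (f ω • x ω) ∂μ| ≤ ∫ ω, |inner ℝ v (f ω • x ω)| ∂μ :=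
        abs_integral_le_integral_abs
    _ ≤ ∫ ω, c * ((Real.exp (4 * |y ω|) + inner ℝ v (x ω) ^ 2) / 2) ∂μ := by
        refine integral_mono (hint.const_inner v).abs (((hi.add hi2).div_const 2).const_mul c)
          fun ω ↦ ?_
        have h1 : Real.exp (4 * |y ω|) = Real.exp (2 * |y ω|) ^ 2 := by
          rw [← Real.exp_nat_mul]; congr 1; push_cast; ring
        have h2 := mul_le_mul_of_nonneg_right (hfy ω) (abs_nonneg (inner ℝ v (x ω)))
        simp only
        rw [real_inner_smul_right, abs_mul, h1]
        refine h2.trans ?_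
        rw [mul_assoc]
        gcongr
        nlinarith [sq_nonneg (Real.exp (2 * |y ω|) - |inner ℝ v (x ω)|), sq_abs (inner ℝ v (x ω))]
    _ = c * ((∫ ω, Real.exp (4 * |y ω|) ∂μ + ‖v‖ ^ 2) / 2) := by
        rw [integral_const_mul, integral_div, integral_add hi hi2, integral_inner_sq hxm hx]
    _ ≤ _ := by
        gcongr
        nlinarith [norm_nonneg v]

/-- Stein-type identity: `E[y x] = B E[h(U) U]`. -/
theorem integral_smul_eq [IsProbabilityMeasure μ] {B : Matrix (Fin d) (Fin k) ℝ} (hB : Bᵀ * B = 1)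
    {h : EuclideanSpace ℝ (Fin k) → ℝ} (hh : Continuous h) (hxm : Measurable x) (hym : Measurable y)
    (hx : μ.map x = stdGaussian (EuclideanSpace ℝ (Fin d)))
    (hi : Integrable (fun ω ↦ Real.exp (4 * |y ω|)) μ) (hyi : Integrable y μ)
    (hcm : μ[y | MeasurableSpace.comap x inferInstance] =ᵐ[μ] fun ω ↦ h (feature B (x ω))) :
    ∫ ω, y ω • x ω ∂μ = columnIsometry B hB (gaussianCorr h) := by
  have hint : Integrable (fun ω ↦ y ω • x ω) μ := integrable_mul_norm_of_le_exp hxm hx hi hym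
    fun ω ↦ (by linarith [Real.add_one_le_exp |y ω|] : |y ω| ≤ Real.exp |y ω|).trans
      (Real.exp_le_exp.2 (by linarith [abs_nonneg (y ω)]))
  have hm : MeasurableSpace.comap x inferInstance ≤ (inferInstance : MeasurableSpace Ω) :=
    hxm.comap_le
  -- conditioning
  have hcond : ∀ v : EuclideanSpace ℝ (Fin d),
      Integrable (fun ω ↦ h (feature B (x ω)) * inner ℝ v (x ω)) μ ∧
      ∫ ω, h (feature B (x ω)) * inner ℝ v (x ω) ∂μ = inner ℝ v (∫ ω, y ω • x ω ∂μ) := by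
    intro v
    have hv : Integrable (y * fun ω ↦ inner ℝ v (x ω)) μ := by
      refine (hint.const_inner v).congr (Filter.Eventually.of_forall fun ω ↦ ?_)
      simp [real_inner_smul_right]
    have hsm : StronglyMeasurable[MeasurableSpace.comap x inferInstance]
        fun ω ↦ inner ℝ v (x ω) := by
      refine Measurable.stronglyMeasurable ?_
      exact (by fun_prop : Measurable fun z : EuclideanSpace ℝ (Fin d) ↦ inner ℝ v z).comp
        (comap_measurable x)
    have h1 := condExp_mul_of_stronglyMeasurable_right hsm hv hyi
    have h2 : μ[y * fun ω ↦ inner ℝ v (x ω) | MeasurableSpace.comap x inferInstance] =ᵐ[μ]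
        fun ω ↦ h (feature B (x ω)) * inner ℝ v (x ω) := by
      filter_upwards [h1, hcm] with ω h3 h4
      rw [h3, Pi.mul_apply, h4]
    refine ⟨integrable_condExp.congr h2, ?_⟩
    rw [← integral_congr_ae h2, integral_condExp hm, ← integral_inner hint]
    refine integral_congr_ae (Filter.Eventually.of_forall fun ω ↦ ?_)
    simp [real_inner_smul_right]
  have hfm := (continuous_feature B).measurable
  have hxf : μ.map (fun ω ↦ feature B (x ω)) = stdGaussian (EuclideanSpace ℝ (Fin k)) := by
    rw [← map_feature_stdGaussian hB, ← hx, Measure.map_map hfm hxm]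
    rfl
  have hfx : Measurable fun ω ↦ feature B (x ω) := hfm.comp hxm
  -- the component in the range of `B`
  have hcomp : ∀ w : EuclideanSpace ℝ (Fin k),
      Integrable (fun u ↦ h u * inner ℝ w u) (stdGaussian (EuclideanSpace ℝ (Fin k))) ∧
      ∫ u, h u * inner ℝ w u ∂stdGaussian (EuclideanSpace ℝ (Fin k)) =
        ∫ ω, h (feature B (x ω)) * inner ℝ (columnIsometry B hB w) (x ω) ∂μ := by
    intro w
    have hin : ∀ z, inner ℝ (columnIsometry B hB w) z = inner ℝ w (feature B z) := fun z ↦ by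
      rw [real_inner_comm, inner_columnIsometry, real_inner_comm]
    have h1 := (hcond (columnIsometry B hB w)).1
    simp only [hin] at h1 ⊢
    constructor
    · rw [← hxf]
      exact (integrable_map_measure (by fun_prop) hfx.aemeasurable).2 h1
    · rw [← hxf, integral_map hfx.aemeasurable (by fun_prop)]
  -- Integrability is inherited coordinatewise from y x, by conditioning on x.
  have hvec : Integrable (fun u ↦ h u • u) (stdGaussian (EuclideanSpace ℝ (Fin k))) := by
    have h1 : ∀ u : EuclideanSpace ℝ (Fin k), h u • u = ∑ r, (h u *
        inner ℝ (EuclideanSpace.basisFun (Fin k) ℝ r) u) • EuclideanSpace.basisFun (Fin k) ℝ r :=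
      fun u ↦ by
        simp_rw [mul_smul, ← Finset.smul_sum]
        rw [(EuclideanSpace.basisFun (Fin k) ℝ).sum_repr' u]
    simp_rw [h1]
    exact integrable_finsetSum _ fun r _ ↦ (hcomp _).1.smul_const _
  refine ext_inner_left ℝ fun v ↦ ?_
  rw [← (hcond v).2, inner_columnIsometry, gaussianCorr, ← integral_inner hvec]
  simp_rw [real_inner_smul_right]
  rw [(hcomp _).2]
  -- p is the projection of v onto the range of `B`; the remaining direction v - p contributes
  -- nothing by reflection.
  set p := columnIsometry B hB (feature B v) with hp
  have hperp : feature B (v - p) = 0 := by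
    rw [← adjoint_columnIsometry B hB, map_sub, hp, sub_eq_zero, adjoint_columnIsometry]
    exact (DFunLike.congr_fun (columnIsometry B hB).adjoint_comp_self _).symm
  have h0 := integral_mul_inner_eq_zero hB h hperp
  have hcont : Continuous fun z ↦ h (feature B z) * inner ℝ (v - p) z :=
    (hh.comp (continuous_feature B)).mul (by fun_prop)
  rw [← hx, integral_map hxm.aemeasurable hcont.aestronglyMeasurable] at h0
  simp only [inner_sub_left, mul_sub] at h0
  rw [integral_sub (hcond v).1 (hcond p).1] at h0
  linarith

/-- Truncation of a real number at level `T`. -/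
noncomputable def trunc (T y : ℝ) : ℝ := if |y| ≤ T then y else 0

theorem measurable_trunc (T : ℝ) : Measurable (trunc T) :=
  Measurable.ite (measurableSet_le (by fun_prop) measurable_const) measurable_id measurable_const

theorem abs_trunc_le {T : ℝ} (hT : 0 ≤ T) (y : ℝ) : |trunc T y| ≤ T := by
  unfold trunc
  split_ifs with h
  · exact h
  · simpa using hT

theorem abs_trunc_le_exp (T y : ℝ) : |trunc T y| ≤ Real.exp (2 * |y|) := by
  have h1 : |y| ≤ Real.exp (2 * |y|) := by
    have := Real.add_one_le_exp (2 * |y|)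
    linarith [abs_nonneg y]
  unfold trunc
  split_ifs
  · exact h1
  · rw [abs_zero]; positivity

/-- Truncation costs a factor e^(-T), small enough to be summed over all N samples when e^T ≥ N. For
|y| > T, exp(2|y| - T) ≥ 1 + 2|y| - T ≥ |y|. -/
theorem abs_sub_trunc_le (T y : ℝ) : |y - trunc T y| ≤ Real.exp (-T) * Real.exp (2 * |y|) := by
  unfold trunc
  split_ifs with h
  · rw [sub_self, abs_zero]; positivity
  · rw [sub_zero, ← Real.exp_add]
    have := Real.add_one_le_exp (-T + 2 * |y|)
    linarith [not_le.1 h]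

theorem integrable_trunc_smul (hxm : Measurable x) (hym : Measurable y)
    (hx : μ.map x = stdGaussian (EuclideanSpace ℝ (Fin d)))
    (hi : Integrable (fun ω ↦ Real.exp (4 * |y ω|)) μ) (T : ℝ) :
    Integrable (fun ω ↦ trunc T (y ω) • x ω) μ :=
  integrable_mul_norm_of_le_exp hxm hx hi ((measurable_trunc T).comp hym)
    fun _ ↦ abs_trunc_le_exp _ _

/-- The truncation bias. -/
theorem abs_inner_bias_le (hxm : Measurable x) (hym : Measurable y)
    (hx : μ.map x = stdGaussian (EuclideanSpace ℝ (Fin d)))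
    (hi : Integrable (fun ω ↦ Real.exp (4 * |y ω|)) μ) {T : ℝ} (hT : 0 ≤ T)
    {v : EuclideanSpace ℝ (Fin d)} (hv : ‖v‖ ≤ 1) :
    |inner ℝ v (∫ ω, y ω • x ω ∂μ) - inner ℝ v (∫ ω, trunc T (y ω) • x ω ∂μ)| ≤
      Real.exp (-T) * ((∫ ω, Real.exp (4 * |y ω|) ∂μ + 1) / 2) := by
  have hint : Integrable (fun ω ↦ y ω • x ω) μ := integrable_mul_norm_of_le_exp hxm hx hi hym
    fun ω ↦ (by linarith [Real.add_one_le_exp |y ω|] : |y ω| ≤ Real.exp |y ω|).trans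
      (Real.exp_le_exp.2 (by linarith [abs_nonneg (y ω)]))
  rw [← inner_sub_right, ← integral_sub hint (integrable_trunc_smul hxm hym hx hi T)]
  simp_rw [← sub_smul]
  exact abs_inner_integral_le_of_le_exp hxm hx hi (hym.sub ((measurable_trunc T).comp hym))
    (Real.exp_pos _).le (Real.exp_le_one_iff.2 (by linarith)) (fun ω ↦ abs_sub_trunc_le T (y ω)) hv

/-- The truncated, centred score `y' x - E[y' x]`. -/
noncomputable def centredScore (μ : Measure Ω) (x : Ω → EuclideanSpace ℝ (Fin d)) (y : Ω → ℝ)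
    (T : ℝ) (ω : Ω) : EuclideanSpace ℝ (Fin d) :=
  trunc T (y ω) • x ω - ∫ ω', trunc T (y ω') • x ω' ∂μ

theorem hasSubgaussianMGF_of_le {X : Ω → ℝ} {c c' : NNReal} (h : HasSubgaussianMGF X c μ)
    (hc : c ≤ c') : HasSubgaussianMGF X c' μ :=
  ⟨h.integrable_exp_mul, fun t ↦ (h.mgf_le t).trans (Real.exp_le_exp.2 (by gcongr))⟩

theorem integrable_exp_inner_sq_div_four (hxm : Measurable x)
    (hx : μ.map x = stdGaussian (EuclideanSpace ℝ (Fin d)))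
    {v : EuclideanSpace ℝ (Fin d)} (hv : ‖v‖ ≤ 1) :
    Integrable (fun ω ↦ Real.exp (inner ℝ v (x ω) ^ 2 / 4)) μ ∧
      ∫ ω, Real.exp (inner ℝ v (x ω) ^ 2 / 4) ∂μ ≤ √2 := by
  obtain ⟨hi, he⟩ := integrable_exp_sq_div_four_gaussianReal
  have h1 : μ.map (fun ω ↦ inner ℝ v (x ω)) = (gaussianReal 0 1).map (fun t ↦ ‖v‖ * t) := by
    rw [gaussianReal_map_const_mul, mul_zero, mul_one,
      (show (NNReal.mk (‖v‖ ^ 2) (sq_nonneg _)) = ‖v‖₊ ^ 2 from by ext; simp),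
      ← map_inner_stdGaussian, ← hx, Measure.map_map (by fun_prop) hxm]
    rfl
  have hle : ∀ t : ℝ, Real.exp ((‖v‖ * t) ^ 2 / 4) ≤ Real.exp (t ^ 2 / 4) := fun t ↦ by
    rw [Real.exp_le_exp, mul_pow]
    have := mul_le_of_le_one_left (sq_nonneg t) (pow_le_one₀ (n := 2) (norm_nonneg v) hv)
    linarith
  have h2 : Integrable (fun t : ℝ ↦ Real.exp ((‖v‖ * t) ^ 2 / 4)) (gaussianReal 0 1) := by
    refine hi.mono' (by fun_prop) (Filter.Eventually.of_forall fun t ↦ ?_)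
    rw [Real.norm_of_nonneg (Real.exp_pos _).le]
    exact hle t
  have h3 : Integrable (fun t : ℝ ↦ Real.exp (t ^ 2 / 4)) (μ.map fun ω ↦ inner ℝ v (x ω)) := by
    rw [h1]
    exact (integrable_map_measure (by fun_prop) (by fun_prop)).2 h2
  refine ⟨h3.comp_measurable (by fun_prop), ?_⟩
  rw [← he]
  calc _ = ∫ t, Real.exp (t ^ 2 / 4) ∂(μ.map fun ω ↦ inner ℝ v (x ω)) := by
        rw [integral_map (by fun_prop) (by fun_prop)]
    _ = ∫ t, Real.exp ((‖v‖ * t) ^ 2 / 4) ∂gaussianReal 0 1 := by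
        rw [h1, integral_map (by fun_prop) (by fun_prop)]
    _ ≤ _ := integral_mono h2 hi hle

/-- The truncated, centred score is sub-gaussian in every direction. -/
theorem hasSubgaussianMGF_inner_centredScore [IsProbabilityMeasure μ] (hxm : Measurable x) (hym : Measurable y)
    (hx : μ.map x = stdGaussian (EuclideanSpace ℝ (Fin d)))
    (hi : Integrable (fun ω ↦ Real.exp (4 * |y ω|)) μ) {T : ℝ} (hT : 0 < T)
    {v : EuclideanSpace ℝ (Fin d)} (hv : ‖v‖ ≤ 1) :
    HasSubgaussianMGF (fun ω ↦ inner ℝ v (centredScore μ x y T ω)) (16 * T.toNNReal ^ 2) μ := by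
  have hint := integrable_trunc_smul hxm hym hx hi T
  have hmt : Measurable fun ω ↦ trunc T (y ω) := (measurable_trunc T).comp hym
  set m := ∫ ω', trunc T (y ω') • x ω' ∂μ with hm
  have hcs : ∀ ω, centredScore μ x y T ω = trunc T (y ω) • x ω - m := fun ω ↦ rfl
  have hb : ∀ ω, |inner ℝ v (trunc T (y ω) • x ω)| ≤ T * |inner ℝ v (x ω)| := fun ω ↦ by
    rw [real_inner_smul_right, abs_mul]
    gcongr
    exact abs_trunc_le hT.le _
  have hmb : |inner ℝ v m| ≤ T := by
    have hi2 := integrable_inner_sq hxm hx v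
    rw [hm, ← integral_inner hint]
    calc |∫ ω, inner ℝ v (trunc T (y ω) • x ω) ∂μ|
        ≤ ∫ ω, |inner ℝ v (trunc T (y ω) • x ω)| ∂μ := abs_integral_le_integral_abs
      _ ≤ ∫ ω, T * ((1 + inner ℝ v (x ω) ^ 2) / 2) ∂μ := by
          refine integral_mono (hint.const_inner v).abs
            ((((integrable_const _).add hi2).div_const 2).const_mul T) fun ω ↦ (hb ω).trans ?_
          gcongr
          nlinarith [sq_nonneg (1 - |inner ℝ v (x ω)|), sq_abs (inner ℝ v (x ω))]
      _ = T * ((1 + ‖v‖ ^ 2) / 2) := by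
          rw [integral_const_mul, integral_div, integral_add (integrable_const _) hi2,
            integral_inner_sq hxm hx]
          simp
      _ ≤ T := by
          refine mul_le_of_le_one_right hT.le ?_
          nlinarith [norm_nonneg v]
  -- With this scale X² ≤ 1/4 + ⟨v, x⟩²/4, whence E exp(X²) ≤ e^(1/4) √2 ≤ 2. Undoing it gives the
  -- proxy 2 · 8T² = 16T².
  let X : Ω → ℝ := fun ω ↦ (√8 * T)⁻¹ * inner ℝ v (centredScore μ x y T ω)
  have hXm : Measurable X := by
    simp only [X, hcs]
    fun_prop
  have h8 : (√8 : ℝ) ^ 2 = 8 := Real.sq_sqrt (by norm_num)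
  have hXsq : ∀ ω, X ω ^ 2 ≤ 1 / 4 + inner ℝ v (x ω) ^ 2 / 4 := fun ω ↦ by
    simp only [X]
    rw [mul_pow, inv_pow, mul_pow, h8, hcs, inner_sub_right, inv_mul_le_iff₀ (by positivity)]
    have h1 : inner ℝ v (trunc T (y ω) • x ω) ^ 2 ≤ T ^ 2 * inner ℝ v (x ω) ^ 2 := by
      rw [← sq_abs, ← sq_abs (inner ℝ v (x ω)), ← mul_pow]
      gcongr
      exact hb ω
    have h2 : inner ℝ v m ^ 2 ≤ T ^ 2 := by
      rw [← sq_abs]; gcongr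
    nlinarith [sq_nonneg (inner ℝ v (trunc T (y ω) • x ω) + inner ℝ v m)]
  obtain ⟨hgi, hge⟩ := integrable_exp_inner_sq_div_four hxm hx hv
  have hle : ∀ ω, Real.exp (X ω ^ 2) ≤ Real.exp (1 / 4) * Real.exp (inner ℝ v (x ω) ^ 2 / 4) :=
    fun ω ↦ by
      rw [← Real.exp_add]
      exact Real.exp_le_exp.2 (hXsq ω)
  have hXi : Integrable (fun ω ↦ Real.exp (X ω ^ 2)) μ := by
    refine (hgi.const_mul (Real.exp (1 / 4))).mono' (by fun_prop)
      (Filter.Eventually.of_forall fun ω ↦ ?_)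
    rw [Real.norm_of_nonneg (Real.exp_pos _).le]
    exact hle ω
  have hcsi : Integrable (fun ω ↦ centredScore μ x y T ω) μ := hint.sub (integrable_const _)
  have h0 : ∫ ω, X ω ∂μ = 0 := by
    rw [integral_const_mul, integral_inner hcsi]
    simp only [hcs]
    rw [integral_sub hint (integrable_const _), ← hm]
    simp
  have h2 : ∫ ω, Real.exp (X ω ^ 2) ∂μ ≤ 2 := by
    calc _ ≤ ∫ ω, Real.exp (1 / 4) * Real.exp (inner ℝ v (x ω) ^ 2 / 4) ∂μ :=
          integral_mono hXi (hgi.const_mul _) hle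
      _ ≤ Real.exp (1 / 4) * √2 := by
          rw [integral_const_mul]
          gcongr
      _ ≤ √2 * √2 := by
          gcongr
          apply Real.le_sqrt_of_sq_le
          rw [← Real.exp_nat_mul]
          have h1 : Real.exp 1 ≤ 4 := Real.exp_one_lt_d9.le.trans (by norm_num)
          have h3 : Real.exp (((2 : ℕ) : ℝ) * (1 / 4)) ^ 2 = Real.exp 1 := by
            rw [← Real.exp_nat_mul]; congr 1; norm_num
          nlinarith [Real.exp_pos (((2 : ℕ) : ℝ) * (1 / 4))]
      _ = 2 := Real.mul_self_sqrt (by norm_num)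
  have hsub := (hasSubgaussianMGF_of_integral_exp_sq_le hXm.aemeasurable
    ((hcsi.const_inner v).const_mul _) h0 hXi h2).const_mul (√8 * T)
  have hX' : (fun ω ↦ √8 * T * X ω) = fun ω ↦ inner ℝ v (centredScore μ x y T ω) := by
    ext ω
    simp only [X]
    rw [mul_inv_cancel_left₀ (by positivity)]
  rw [hX'] at hsub
  refine hasSubgaussianMGF_of_le hsub (NNReal.eq ?_).le
  change (√8 * T) ^ 2 * 2 = 16 * (T.toNNReal : ℝ) ^ 2
  rw [Real.coe_toNNReal T hT.le, mul_pow, h8]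
  ring

/-- The exponent is 11 so that, with e^T = d + N, a union over N samples still leaves (d + N)^(-10).
-/
theorem measure_abs_gt_le [IsFiniteMeasure μ] {K T : ℝ} (hi : Integrable (fun ω ↦ Real.exp (11 * |y ω|)) μ)
    (hK : ∫ ω, Real.exp (11 * |y ω|) ∂μ ≤ K) :
    μ.real {ω | T < |y ω|} ≤ K * Real.exp (-(11 * T)) := by
  calc μ.real {ω | T < |y ω|} ≤ μ.real {ω | T ≤ |y ω|} :=
        measureReal_mono fun ω (h : T < |y ω|) ↦ h.le
    _ ≤ Real.exp (-11 * T) * mgf (fun ω ↦ |y ω|) μ 11 :=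
        measure_ge_le_exp_mul_mgf T (by norm_num) hi
    _ ≤ Real.exp (-11 * T) * K := by
        gcongr
        exact hK
    _ = _ := by rw [mul_comm]; congr 2; ring

end Sample

/-! ### Bilinear forms of `Z` and of the signal; averages over half samples. -/

section Algebra

variable {M d k : ℕ}

theorem inner_toEuclideanCLM_eq_dotProduct (Z : Matrix (Fin d) (Fin d) ℝ)
    (u v : EuclideanSpace ℝ (Fin d)) :
    inner ℝ u (toEuclideanCLM (𝕜 := ℝ) Z v) = u.ofLp ⬝ᵥ (Z *ᵥ v.ofLp) := by
  rw [EuclideanSpace.inner_eq_star_dotProduct, star_trivial, dotProduct_comm]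
  rfl

theorem dotProduct_vecMulVec_mulVec (u v a c : EuclideanSpace ℝ (Fin d)) :
    u.ofLp ⬝ᵥ (vecMulVec a.ofLp c.ofLp *ᵥ v.ofLp) = inner ℝ u a * inner ℝ v c := by
  rw [vecMulVec_mulVec, EuclideanSpace.inner_eq_star_dotProduct,
    EuclideanSpace.inner_eq_star_dotProduct, star_trivial, star_trivial]
  simp only [op_smul_eq_smul, dotProduct_smul, smul_eq_mul]
  rw [mul_comm, dotProduct_comm]

theorem dotProduct_sum_smul_vecMulVec_mulVec {ι : Type*} [Fintype ι] (c : ι → ℝ)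
    (a b : ι → EuclideanSpace ℝ (Fin d)) (u v : EuclideanSpace ℝ (Fin d)) :
    u.ofLp ⬝ᵥ ((∑ i, c i • vecMulVec (a i).ofLp (b i).ofLp) *ᵥ v.ofLp) =
      ∑ i, c i * (inner ℝ u (a i) * inner ℝ v (b i)) := by
  rw [sum_mulVec, dotProduct_sum]
  refine Finset.sum_congr rfl fun i _ ↦ ?_
  rw [smul_mulVec, dotProduct_smul, dotProduct_vecMulVec_mulVec, smul_eq_mul]

theorem inner_replicaMatrix (n : Fin M → ℕ) (x : (i : Fin M) → Fin (n i) → EuclideanSpace ℝ (Fin d))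
    (y : (i : Fin M) → Fin (n i) → ℝ) (u v : EuclideanSpace ℝ (Fin d)) :
    inner ℝ u (toEuclideanCLM (𝕜 := ℝ) (replicaMatrix n x y) v) = ∑ i, (n i : ℝ) *
      (inner ℝ u (firstAverage (x i) (y i)) * inner ℝ v (secondAverage (x i) (y i))) := by
  rw [inner_toEuclideanCLM_eq_dotProduct, replicaMatrix, dotProduct_sum_smul_vecMulVec_mulVec]

theorem inner_diversity (n : Fin M → ℕ) (hN : (totalSize n : ℝ) ≠ 0)
    (h : Fin M → EuclideanSpace ℝ (Fin k) → ℝ) (u v : EuclideanSpace ℝ (Fin k)) :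
    (totalSize n : ℝ) * inner ℝ u (toEuclideanCLM (𝕜 := ℝ) (diversity n h) v) = ∑ i, (n i : ℝ) *
      (inner ℝ u (gaussianCorr (h i)) * inner ℝ v (gaussianCorr (h i))) := by
  rw [inner_toEuclideanCLM_eq_dotProduct, diversity, smul_mulVec, dotProduct_smul,
    dotProduct_sum_smul_vecMulVec_mulVec, smul_eq_mul, mul_inv_cancel_left₀ hN]

theorem isHermitian_diversity (n : Fin M → ℕ) (h : Fin M → EuclideanSpace ℝ (Fin k) → ℝ) :
    (diversity n h).IsHermitian := by
  rw [IsHermitian, conjTranspose_eq_transpose_of_trivial, diversity, transpose_smul, transpose_sum]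
  simp_rw [transpose_smul, transpose_vecMulVec]

/-- Brings the signal into the shape of `inner_replicaMatrix`, so that the two can be compared
client by client. -/
theorem inner_signal (n : Fin M → ℕ) (hN : (totalSize n : ℝ) ≠ 0) {B : Matrix (Fin d) (Fin k) ℝ}
    (hB : Bᵀ * B = 1) (h : Fin M → EuclideanSpace ℝ (Fin k) → ℝ) (u v : EuclideanSpace ℝ (Fin d)) :
    inner ℝ u (toEuclideanCLM (𝕜 := ℝ) (B * ((totalSize n : ℝ) • diversity n h) * Bᵀ) v) =
      ∑ i, (n i : ℝ) * (inner ℝ u (columnIsometry B hB (gaussianCorr (h i))) *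
        inner ℝ v (columnIsometry B hB (gaussianCorr (h i)))) := by
  simp_rw [inner_columnIsometry]
  rw [← inner_diversity n hN]
  have h1 : toEuclideanCLM (𝕜 := ℝ) (B * ((totalSize n : ℝ) • diversity n h) * Bᵀ) v =
      columnIsometry B hB ((totalSize n : ℝ) •
        toEuclideanCLM (𝕜 := ℝ) (diversity n h) (feature B v)) := by
    change WithLp.toLp 2 ((B * ((totalSize n : ℝ) • diversity n h) * Bᵀ) *ᵥ v.ofLp) =
      WithLp.toLp 2 (B *ᵥ ((totalSize n : ℝ) • (diversity n h *ᵥ (Bᵀ *ᵥ v.ofLp))))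
    rw [← smul_mulVec, mulVec_mulVec, mulVec_mulVec, Matrix.mul_assoc]
  rw [h1, inner_columnIsometry, real_inner_smul_right]

theorem card_firstHalf {m : ℕ} : (Finset.univ.filter fun j : Fin m ↦ j.val < m / 2).card = m / 2 := by
  rw [Fin.card_filter_val_lt]
  omega

theorem card_secondHalf {m : ℕ} (hm : Even m) :
    (Finset.univ.filter fun j : Fin m ↦ m / 2 ≤ j.val).card = m / 2 := by
  have h1 := Finset.card_filter_add_card_filter_not (s := (Finset.univ : Finset (Fin m)))
    (fun j : Fin m ↦ j.val < m / 2)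
  simp_rw [not_lt] at h1
  rw [card_firstHalf, Finset.card_univ, Fintype.card_fin] at h1
  obtain ⟨r, rfl⟩ := hm
  omega

theorem cast_half_eq {m : ℕ} (hm : Even m) : ((m / 2 : ℕ) : ℝ) = m / 2 := by
  obtain ⟨r, rfl⟩ := hm
  rw [← two_mul, Nat.mul_div_cancel_left r (by norm_num)]
  push_cast
  ring

theorem abs_average_sub_le {m : ℕ} {s : Finset (Fin m)} (hs : s.card = m / 2) (hm : Even m)
    (hm2 : 2 ≤ m) {a : Fin m → ℝ} {c δ : ℝ} (hδ : ∀ j, |c - a j| ≤ δ) :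
    |2 / (m : ℝ) * ∑ j ∈ s, a j - c| ≤ δ := by
  have hm0 : (0 : ℝ) < m := by exact_mod_cast (by omega : 0 < m)
  have hsc : (s.card : ℝ) = m / 2 := by rw [hs, cast_half_eq hm]
  have h1 : 2 / (m : ℝ) * ∑ j ∈ s, a j - c = 2 / (m : ℝ) * ∑ j ∈ s, (a j - c) := by
    rw [Finset.sum_sub_distrib, Finset.sum_const, nsmul_eq_mul, hsc]
    field_simp
  rw [h1, abs_mul, abs_of_pos (by positivity)]
  calc 2 / (m : ℝ) * |∑ j ∈ s, (a j - c)| ≤ 2 / (m : ℝ) * ∑ j ∈ s, δ := by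
        gcongr
        refine (Finset.abs_sum_le_sum_abs _ _).trans (Finset.sum_le_sum fun j _ ↦ ?_)
        rw [abs_sub_comm]
        exact hδ j
    _ = δ := by
        rw [Finset.sum_const, nsmul_eq_mul, hsc]
        field_simp

end Algebra

/-! ### Chernoff bounds. -/

section Tails

variable {Ω : Type*} [MeasurableSpace Ω] {μ : Measure Ω}

theorem measureReal_ge_le_of_lintegral_exp {X : Ω → ℝ} (hX : Measurable X) {s b t : ℝ} (hs : 0 < s)
    (h : ∫⁻ ω, ENNReal.ofReal (Real.exp (s * X ω)) ∂μ ≤ ENNReal.ofReal (Real.exp b)) :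
    μ.real {ω | t ≤ X ω} ≤ Real.exp (b - s * t) := by
  have h1 := mul_meas_ge_le_lintegral (μ := μ)
    (f := fun ω ↦ ENNReal.ofReal (Real.exp (s * X ω))) (by fun_prop)
    (ENNReal.ofReal (Real.exp (s * t)))
  have h2 : {ω | ENNReal.ofReal (Real.exp (s * t)) ≤ ENNReal.ofReal (Real.exp (s * X ω))} =
      {ω | t ≤ X ω} := by
    ext ω
    simp only [Set.mem_ofPred_eq]
    rw [ENNReal.ofReal_le_ofReal_iff (Real.exp_pos _).le, Real.exp_le_exp]
    exact mul_le_mul_iff_right₀ hs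
  rw [h2] at h1
  have h3 := ENNReal.toReal_mono ENNReal.ofReal_ne_top (h1.trans h)
  rw [ENNReal.toReal_mul, ENNReal.toReal_ofReal (Real.exp_pos _).le,
    ENNReal.toReal_ofReal (Real.exp_pos _).le] at h3
  rw [Real.exp_sub, le_div_iff₀ (Real.exp_pos _), mul_comm]
  exact h3

/-- Chernoff's bound for a decoupled chaos. -/
theorem measureReal_chaos_ge_le [IsProbabilityMeasure μ] {ι : Type*} [Fintype ι] [Nonempty ι] {P Q : ι → Ω → ℝ}
    (hP : ∀ i, Measurable (P i))
    (hQ : ∀ i, Measurable (Q i)) (hPQ : IndepFun (fun ω i ↦ P i ω) (fun ω i ↦ Q i ω) μ)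
    {κ : NNReal} (hκ : 0 < κ)
    (hsP : ∀ c : ι → ℝ, HasSubgaussianMGF (fun ω ↦ ∑ i, c i * P i ω) (κ * ∑ i, ‖c i‖₊ ^ 2) μ)
    (hsQ : ∀ c : ι → ℝ, HasSubgaussianMGF (fun ω ↦ ∑ i, c i * Q i ω) (κ * ∑ i, ‖c i‖₊ ^ 2) μ)
    {q : ℝ} (hq : 0 < q) :
    μ.real {ω | 4 * κ * (√(Fintype.card ι * q) + q) ≤ ∑ i, P i ω * Q i ω} ≤ Real.exp (-q) := by
  set M : ℝ := (Fintype.card ι : ℝ) with hM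
  have hM0 : 0 < M := by rw [hM]; exact_mod_cast Fintype.card_pos
  set A := √M with hA
  set r := √q with hr
  have hA0 : 0 < A := Real.sqrt_pos.2 hM0
  have hr0 : 0 < r := Real.sqrt_pos.2 hq
  have hAA : A ^ 2 = M := Real.sq_sqrt hM0.le
  have hrr : r ^ 2 = q := Real.sq_sqrt hq.le
  have hk0 : (0 : ℝ) < κ := hκ
  -- Then κs ≤ 1/2 and κ²s²M ≤ q/4, while s times the threshold 4κ r(A + r) is 2q; the exponent q/4
  -- - 2q is below -q.
  set s : ℝ := r / (2 * κ * (A + r)) with hs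
  have hs0 : 0 < s := by positivity
  have hks : κ ^ 2 * s ^ 2 = r ^ 2 / (4 * (A + r) ^ 2) := by
    rw [hs]; field_simp; norm_num
  have h1 : κ ^ 2 * s ^ 2 ≤ 1 / 2 := by
    rw [hks, div_le_iff₀ (by positivity)]
    nlinarith [mul_pos hA0 hr0]
  have h2 : κ ^ 2 * s ^ 2 * M ≤ q / 4 := by
    rw [hks, ← hAA, ← hrr, div_mul_eq_mul_div, div_le_div_iff₀ (by positivity) (by norm_num)]
    have : A ^ 2 ≤ (A + r) ^ 2 := by gcongr; linarith
    nlinarith [sq_nonneg r]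
  have h3 : s * (4 * κ * (√(M * q) + q)) = 2 * q := by
    rw [Real.sqrt_mul hM0.le, ← hA, ← hr, ← hrr, hs]
    field_simp
    ring
  refine (measureReal_ge_le_of_lintegral_exp (Finset.measurable_sum _ fun i _ ↦
    (hP i).mul (hQ i)) hs0 (lintegral_exp_mul_sum_mul_le hP hQ hPQ hsP hsQ h1)).trans
    (Real.exp_le_exp.2 ?_)
  rw [h3]
  linarith

end Tails

/-! ### Sub-gaussianity and independence of sums of scores. -/

section Scores

variable {Ω : Type*} [MeasurableSpace Ω] {μ : Measure Ω}
  {M d k : ℕ} {n : Fin M → ℕ} {B : Matrix (Fin d) (Fin k) ℝ}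
  {h : Fin M → EuclideanSpace ℝ (Fin k) → ℝ}
  {x : (i : Fin M) → Fin (n i) → Ω → EuclideanSpace ℝ (Fin d)}
  {y : (i : Fin M) → Fin (n i) → Ω → ℝ}

theorem measurable_centredScore {x : Ω → EuclideanSpace ℝ (Fin d)} {y : Ω → ℝ} (hx : Measurable x)
    (hy : Measurable y) (T : ℝ) : Measurable (centredScore μ x y T) :=
  (((measurable_trunc T).comp hy).smul hx).sub_const _

/-- A linear combination of truncated, centred scores is sub-gaussian. -/
theorem hasSubgaussianMGF_sum_score [IsProbabilityMeasure μ] (hmod : GeneralModel μ n B h x y)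
    (hi : ∀ i j, Integrable (fun ω ↦ Real.exp (4 * |y i j ω|)) μ) {T : ℝ} (hT : 0 < T)
    {v : EuclideanSpace ℝ (Fin d)} (hv : ‖v‖ ≤ 1) (c : (i : Fin M) → Fin (n i) → ℝ) {V : NNReal}
    (hV : 16 * T ^ 2 * ∑ i, ∑ j, c i j ^ 2 ≤ V) :
    HasSubgaussianMGF (fun ω ↦ ∑ i, ∑ j, c i j * inner ℝ v (centredScore μ (x i j) (y i j) T ω))
      V μ := by
  have hind : iIndepFun (fun (p : (i : Fin M) × Fin (n i)) ω ↦
      c p.1 p.2 * inner ℝ v (centredScore μ (x p.1 p.2) (y p.1 p.2) T ω)) μ := by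
    have := hmod.indep.comp (fun p z ↦ c p.1 p.2 * inner ℝ v (trunc T z.2 • z.1 -
      ∫ ω', trunc T (y p.1 p.2 ω') • x p.1 p.2 ω' ∂μ)) (fun p ↦ by
        have := measurable_trunc T
        fun_prop)
    exact this
  have hsum := HasSubgaussianMGF.sum_of_iIndepFun hind (s := Finset.univ) fun p _ ↦
    (hasSubgaussianMGF_inner_centredScore (hmod.measurable_x p.1 p.2) (hmod.measurable_y p.1 p.2)
      (hmod.gaussian p.1 p.2) (hi p.1 p.2) hT hv).const_mul (c p.1 p.2)
  simp_rw [Fintype.sum_sigma] at hsum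
  refine hasSubgaussianMGF_of_le hsum ?_
  rw [← NNReal.coe_le_coe]
  refine le_trans (le_of_eq ?_) hV
  simp_rw [NNReal.coe_sum, Finset.mul_sum]
  refine Finset.sum_congr rfl fun i _ ↦ Finset.sum_congr rfl fun j _ ↦ ?_
  change c i j ^ 2 * (16 * (T.toNNReal : ℝ) ^ 2) = _
  rw [Real.coe_toNNReal T hT.le]
  ring

/-- Linear functions of the two halves of the samples are independent. -/
theorem indepFun_sum_score (hmod : GeneralModel μ n B h x y) (T : ℝ)
    (u v : EuclideanSpace ℝ (Fin d)) (c c' : Fin M → ℝ) :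
    IndepFun (fun ω i ↦ ∑ j : Fin (n i) with j.val < n i / 2,
        c i * inner ℝ u (centredScore μ (x i j) (y i j) T ω))
      (fun ω i ↦ ∑ j : Fin (n i) with n i / 2 ≤ j.val,
        c' i * inner ℝ v (centredScore μ (x i j) (y i j) T ω)) μ := by
  classical
  let S₁ : Finset ((i : Fin M) × Fin (n i)) := Finset.univ.filter fun p ↦ p.2.val < n p.1 / 2
  let S₂ : Finset ((i : Fin M) × Fin (n i)) := Finset.univ.filter fun p ↦ n p.1 / 2 ≤ p.2.val
  have hdisj : Disjoint S₁ S₂ := by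
    rw [Finset.disjoint_filter]
    intro p _ h1 h2
    omega
  have hind := hmod.indep.indepFun_finset S₁ S₂ hdisj fun p ↦
    (hmod.measurable_x p.1 p.2).prodMk (hmod.measurable_y p.1 p.2)
  -- Expresses the client sums as functions of the samples indexed by S alone, extended by zero, so
  -- that independence over disjoint index sets applies.
  let φ : (S : Finset ((i : Fin M) × Fin (n i))) → (Fin M → ℝ) → EuclideanSpace ℝ (Fin d) →
      (S → EuclideanSpace ℝ (Fin d) × ℝ) → Fin M → ℝ := fun S c u z i ↦
    ∑ j, if hj : (⟨i, j⟩ : (i : Fin M) × Fin (n i)) ∈ S then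
      c i * inner ℝ u (trunc T (z ⟨⟨i, j⟩, hj⟩).2 • (z ⟨⟨i, j⟩, hj⟩).1 -
        ∫ ω', trunc T (y i j ω') • x i j ω' ∂μ) else 0
  have hφ : ∀ S c u, Measurable (φ S c u) := fun S c u ↦ by
    refine measurable_pi_iff.2 fun i ↦ Finset.measurable_sum _ fun j _ ↦ ?_
    have := measurable_trunc T
    split_ifs
    · fun_prop
    · fun_prop
  refine (hind.comp (hφ S₁ c u) (hφ S₂ c' v)).congr (Filter.EventuallyEq.of_eq ?_)
    (Filter.EventuallyEq.of_eq ?_)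
  · ext ω i
    simp only [φ, Function.comp, S₁, Finset.mem_filter, Finset.mem_univ, true_and, dite_eq_ite,
      ← Finset.sum_filter]
    rfl
  · ext ω i
    simp only [φ, Function.comp, S₂, Finset.mem_filter, Finset.mem_univ, true_and, dite_eq_ite,
      ← Finset.sum_filter]
    rfl

end Scores

/-! ### Deviation of uᵀ(Z - S)v for fixed u and v. -/

section Halves

variable {Ω : Type*} [MeasurableSpace Ω] {μ : Measure Ω} [IsProbabilityMeasure μ]
  {M d k : ℕ} {n : Fin M → ℕ} {B : Matrix (Fin d) (Fin k) ℝ}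
  {h : Fin M → EuclideanSpace ℝ (Fin k) → ℝ}
  {x : (i : Fin M) → Fin (n i) → Ω → EuclideanSpace ℝ (Fin d)}
  {y : (i : Fin M) → Fin (n i) → Ω → ℝ}

/-- Each client uses only n_i/2 samples, which turns 16T² into 8T² n_i. -/
theorem hasSubgaussianMGF_sum_half (hmod : GeneralModel μ n B h x y)
    (hi : ∀ i j, Integrable (fun ω ↦ Real.exp (4 * |y i j ω|)) μ) {T : ℝ} (hT : 0 < T)
    {v : EuclideanSpace ℝ (Fin d)} (hv : ‖v‖ ≤ 1) {s : (i : Fin M) → Finset (Fin (n i))}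
    (hs : ∀ i, (s i).card = n i / 2) (c : Fin M → ℝ) {V : NNReal}
    (hV : 8 * T ^ 2 * ∑ i, (n i : ℝ) * c i ^ 2 ≤ V) :
    HasSubgaussianMGF
      (fun ω ↦ ∑ i, ∑ j ∈ s i, c i * inner ℝ v (centredScore μ (x i j) (y i j) T ω)) V μ := by
  classical
  have := hasSubgaussianMGF_sum_score hmod hi hT hv
    (fun i j ↦ if j ∈ s i then c i else 0) (V := V) (by
      refine le_trans (le_of_eq ?_) hV
      rw [Finset.mul_sum, Finset.mul_sum]
      refine Finset.sum_congr rfl fun i _ ↦ ?_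
      simp only [ite_pow, zero_pow two_ne_zero, Finset.sum_ite_mem, Finset.univ_inter,
        Finset.sum_const, nsmul_eq_mul, hs, cast_half_eq (hmod.even i)]
      ring)
  simpa only [ite_mul, zero_mul, Finset.sum_ite_mem, Finset.univ_inter] using this

/-- Tail of the terms that are linear in the centred averages. -/
theorem measureReal_linear_ge_le (hmod : GeneralModel μ n B h x y)
    (hi : ∀ i j, Integrable (fun ω ↦ Real.exp (4 * |y i j ω|)) μ) {T : ℝ} (hT : 0 < T)
    {v : EuclideanSpace ℝ (Fin d)} (hv : ‖v‖ ≤ 1) {s : (i : Fin M) → Finset (Fin (n i))}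
    (hs : ∀ i, (s i).card = n i / 2) (c : Fin M → ℝ) {V q : ℝ} (hV0 : 0 < V) (hq : 0 ≤ q)
    (hV : 8 * T ^ 2 * ∑ i, (n i : ℝ) * c i ^ 2 ≤ V) :
    μ.real {ω | √(2 * V * q) ≤
      ∑ i, ∑ j ∈ s i, c i * inner ℝ v (centredScore μ (x i j) (y i j) T ω)} ≤ Real.exp (-q) := by
  have hsub := hasSubgaussianMGF_sum_half hmod hi hT hv hs c (V := V.toNNReal)
    (by rwa [Real.coe_toNNReal V hV0.le])
  refine (hsub.measure_ge_le (Real.sqrt_nonneg (2 * V * q))).trans (Real.exp_le_exp.2 ?_)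
  rw [Real.sq_sqrt (by positivity), Real.coe_toNNReal V hV0.le]
  apply le_of_eq
  field_simp

/-- Tail of the term that is bilinear in the centred averages. -/
theorem measureReal_bilinear_ge_le (hmod : GeneralModel μ n B h x y) (hM : 0 < M)
    (hi : ∀ i j, Integrable (fun ω ↦ Real.exp (4 * |y i j ω|)) μ) {T : ℝ} (hT : 0 < T)
    {u v : EuclideanSpace ℝ (Fin d)} (hu : ‖u‖ ≤ 1) (hv : ‖v‖ ≤ 1) {q : ℝ} (hq : 0 < q) :
    μ.real {ω | 4 * (32 * T ^ 2) * (√(M * q) + q) ≤ ∑ i, (n i : ℝ) *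
      ((2 / (n i : ℝ) * ∑ j : Fin (n i) with j.val < n i / 2,
          inner ℝ u (centredScore μ (x i j) (y i j) T ω)) *
        (2 / (n i : ℝ) * ∑ j : Fin (n i) with n i / 2 ≤ j.val,
          inner ℝ v (centredScore μ (x i j) (y i j) T ω)))} ≤ Real.exp (-q) := by
  have : Nonempty (Fin M) := ⟨⟨0, hM⟩⟩
  have hn : ∀ i, (0 : ℝ) < n i := fun i ↦ by
    have := hmod.two_le i
    exact_mod_cast (by omega : 0 < n i)
  -- Splits the weight n_i (2/n_i)² evenly between the two factors. Since n_i r_i² = 4, every client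
  -- has the same proxy 8T² · 4 = 32T².
  let r : Fin M → ℝ := fun i ↦ √(n i : ℝ) * (2 / (n i : ℝ))
  have hr : ∀ i, (n i : ℝ) * r i ^ 2 = 4 := fun i ↦ by
    simp only [r]
    rw [mul_pow, Real.sq_sqrt (hn i).le]
    have := (hn i).ne'
    field_simp
    norm_num
  have hκ : (0 : ℝ) ≤ 32 * T ^ 2 := by positivity
  have hsub : ∀ {w : EuclideanSpace ℝ (Fin d)} (_ : ‖w‖ ≤ 1) {s : (i : Fin M) → Finset (Fin (n i))}
      (_ : ∀ i, (s i).card = n i / 2) (c : Fin M → ℝ), HasSubgaussianMGF (fun ω ↦ ∑ i, c i *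
        ∑ j ∈ s i, r i * inner ℝ w (centredScore μ (x i j) (y i j) T ω))
        ((32 * T ^ 2).toNNReal * ∑ i, ‖c i‖₊ ^ 2) μ := by
    intro w hw s hs c
    have h1 := hasSubgaussianMGF_sum_half hmod hi hT hw hs (fun i ↦ c i * r i)
      (V := (32 * T ^ 2).toNNReal * ∑ i, ‖c i‖₊ ^ 2) (by
        rw [NNReal.coe_mul, Real.coe_toNNReal _ hκ, NNReal.coe_sum, Finset.mul_sum, Finset.mul_sum]
        refine (Finset.sum_congr rfl fun i _ ↦ ?_).le
        rw [NNReal.coe_pow, coe_nnnorm, Real.norm_eq_abs, sq_abs, mul_pow]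
        linear_combination 8 * T ^ 2 * c i ^ 2 * hr i)
    simpa only [Finset.mul_sum, mul_assoc] using h1
  have hmeas : ∀ (w : EuclideanSpace ℝ (Fin d)) (s : (i : Fin M) → Finset (Fin (n i))) (i : Fin M),
      Measurable fun ω ↦ ∑ j ∈ s i, r i * inner ℝ w (centredScore μ (x i j) (y i j) T ω) := by
    intro w s i
    refine Finset.measurable_sum _ fun j _ ↦ ?_
    have := measurable_centredScore (μ := μ) (hmod.measurable_x i j) (hmod.measurable_y i j) T
    fun_prop
  have key := measureReal_chaos_ge_le (hmeas u fun i ↦ Finset.univ.filter fun j ↦ j.val < n i / 2)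
    (hmeas v fun i ↦ Finset.univ.filter fun j ↦ n i / 2 ≤ j.val)
    (indepFun_sum_score hmod T u v r r) (κ := (32 * T ^ 2).toNNReal)
    (Real.toNNReal_pos.2 (by positivity)) (hsub hu fun i ↦ card_firstHalf)
    (hsub hv fun i ↦ card_secondHalf (hmod.even i)) hq
  rw [Real.coe_toNNReal _ hκ, Fintype.card_fin] at key
  convert key using 6 with ω i
  rw [← Finset.mul_sum, ← Finset.mul_sum]
  simp only [r]
  have := Real.mul_self_sqrt (hn i).le
  linear_combination (-(2 / (n i : ℝ)) ^ 2 * (∑ j : Fin (n i) with j.val < n i / 2,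
          inner ℝ u (centredScore μ (x i j) (y i j) T ω)) *
        (∑ j : Fin (n i) with n i / 2 ≤ j.val,
          inner ℝ v (centredScore μ (x i j) (y i j) T ω))) * this

/-- For fixed directions, `uᵀ (Z - S) v` is small outside an event of small probability, as long
as the responses are not truncated. -/
theorem exists_tail_event (hmod : GeneralModel μ n B h x y) (hM : 0 < M)
    (hi : ∀ i j, Integrable (fun ω ↦ Real.exp (4 * |y i j ω|)) μ) {T : ℝ} (hT : 0 < T)
    {u v : EuclideanSpace ℝ (Fin d)} (hu : ‖u‖ ≤ 1) (hv : ‖v‖ ≤ 1)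
    (mean : Fin M → EuclideanSpace ℝ (Fin d)) {a δ Λ V q : ℝ} (hδa : δ ≤ a)
    (hδ0 : 0 ≤ δ) (hNδ : (totalSize n : ℝ) * δ ≤ a)
    (ha : ∀ i w, ‖w‖ ≤ 1 → |inner ℝ w (mean i)| ≤ a)
    (hbias : ∀ i j w, ‖w‖ ≤ 1 →
      |inner ℝ w (mean i) - inner ℝ w (∫ ω, trunc T (y i j ω) • x i j ω ∂μ)| ≤ δ)
    (hΛ : ∀ w, ‖w‖ ≤ 1 → ∑ i, (n i : ℝ) * inner ℝ w (mean i) ^ 2 ≤ Λ)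
    (hV0 : 0 < V) (hV : 64 * T ^ 2 * (Λ + a ^ 2) ≤ V) (hq : 0 < q) :
    ∃ E : Set Ω, MeasurableSet E ∧ μ.real E ≤ 3 * Real.exp (-q) ∧ ∀ ω ∉ E,
      (∀ i j, |y i j ω| ≤ T) →
      ∑ i, (n i : ℝ) * (inner ℝ u (firstAverage (fun j ↦ x i j ω) fun j ↦ y i j ω) *
        inner ℝ v (secondAverage (fun j ↦ x i j ω) fun j ↦ y i j ω)) -
        ∑ i, (n i : ℝ) * (inner ℝ u (mean i) * inner ℝ v (mean i)) ≤
      2 * √(2 * V * q) + 4 * (32 * T ^ 2) * (√(M * q) + q) + 3 * a ^ 2 := by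
  have hn : ∀ i, (0 : ℝ) < n i := fun i ↦ by
    have := hmod.two_le i
    exact_mod_cast (by omega : 0 < n i)
  have hN : (totalSize n : ℝ) = ∑ i, (n i : ℝ) := by simp [totalSize]
  have ha0 : 0 ≤ a := hδ0.trans hδa
  let s₁ : (i : Fin M) → Finset (Fin (n i)) := fun i ↦ Finset.univ.filter fun j ↦ j.val < n i / 2
  let s₂ : (i : Fin M) → Finset (Fin (n i)) := fun i ↦ Finset.univ.filter fun j ↦ n i / 2 ≤ j.val
  have hs₁ : ∀ i, (s₁ i).card = n i / 2 := fun i ↦ card_firstHalf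
  have hs₂ : ∀ i, (s₂ i).card = n i / 2 := fun i ↦ card_secondHalf (hmod.even i)
  -- means of the truncated averages
  let A : EuclideanSpace ℝ (Fin d) → ((i : Fin M) → Finset (Fin (n i))) → Fin M → ℝ :=
    fun w s i ↦ 2 / (n i : ℝ) * ∑ j ∈ s i, inner ℝ w (∫ ω, trunc T (y i j ω) • x i j ω ∂μ)
  have hA : ∀ w s, ‖w‖ ≤ 1 → (∀ i, (s i).card = n i / 2) → ∀ i,
      |A w s i - inner ℝ w (mean i)| ≤ δ := fun w s hw hs i ↦
    abs_average_sub_le (hs i) (hmod.even i) (hmod.two_le i) fun j ↦ hbias i j w hw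
  have hAV : ∀ w s, ‖w‖ ≤ 1 → (∀ i, (s i).card = n i / 2) →
      8 * T ^ 2 * ∑ i, (n i : ℝ) * (2 * A w s i) ^ 2 ≤ V := fun w s hw hs ↦ by
    have h1 : ∑ i, (n i : ℝ) * (2 * A w s i) ^ 2 ≤ 8 * (Λ + a ^ 2) := by
      calc ∑ i, (n i : ℝ) * (2 * A w s i) ^ 2
          ≤ ∑ i, (8 * ((n i : ℝ) * inner ℝ w (mean i) ^ 2) + 8 * ((n i : ℝ) * δ * δ)) := by
            refine Finset.sum_le_sum fun i _ ↦ ?_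
            have h2 : (2 * A w s i) ^ 2 ≤ 8 * inner ℝ w (mean i) ^ 2 + 8 * δ * δ := by
              have h3 := sq_le_sq' (abs_le.1 (hA w s hw hs i)).1 (abs_le.1 (hA w s hw hs i)).2
              nlinarith [sq_nonneg (A w s i - 2 * inner ℝ w (mean i))]
            have := mul_le_mul_of_nonneg_left h2 (hn i).le
            linarith
        _ = 8 * ∑ i, (n i : ℝ) * inner ℝ w (mean i) ^ 2 + 8 * ((totalSize n : ℝ) * δ * δ) := by
            rw [Finset.sum_add_distrib, ← Finset.mul_sum, ← Finset.mul_sum, hN, Finset.sum_mul,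
              Finset.sum_mul]
        _ ≤ 8 * (Λ + a ^ 2) := by
            have h2 := hΛ w hw
            have h3 : (totalSize n : ℝ) * δ * δ ≤ a * a := by gcongr
            nlinarith
    calc _ ≤ 8 * T ^ 2 * (8 * (Λ + a ^ 2)) := by gcongr
      _ = 64 * T ^ 2 * (Λ + a ^ 2) := by ring
      _ ≤ V := hV
  let X : EuclideanSpace ℝ (Fin d) → ((i : Fin M) → Finset (Fin (n i))) → (Fin M → ℝ) → Ω → ℝ :=
    fun w s c ω ↦ ∑ i, ∑ j ∈ s i, c i * inner ℝ w (centredScore μ (x i j) (y i j) T ω)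
  let e : EuclideanSpace ℝ (Fin d) → ((i : Fin M) → Finset (Fin (n i))) → Fin M → Ω → ℝ :=
    fun w s i ω ↦ 2 / (n i : ℝ) * ∑ j ∈ s i, inner ℝ w (centredScore μ (x i j) (y i j) T ω)
  have hcm : ∀ i j, Measurable (centredScore μ (x i j) (y i j) T) := fun i j ↦
    measurable_centredScore (hmod.measurable_x i j) (hmod.measurable_y i j) T
  have hXm : ∀ w s c, Measurable (X w s c) := fun w s c ↦
    Finset.measurable_sum _ fun i _ ↦ Finset.measurable_sum _ fun j _ ↦
      (measurable_const.inner (hcm i j)).const_mul _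
  have hem : ∀ w s i, Measurable (e w s i) := fun w s i ↦
    (Finset.measurable_sum _ fun j _ ↦ measurable_const.inner (hcm i j)).const_mul _
  -- One event for each random term of (A + e)(A' + e'): A e', e A' and e e'. The coefficient 2 is
  -- n_i · 2/n_i.
  let E₁ : Set Ω := {ω | √(2 * V * q) ≤ X v s₂ (fun i ↦ 2 * A u s₁ i) ω}
  let E₂ : Set Ω := {ω | √(2 * V * q) ≤ X u s₁ (fun i ↦ 2 * A v s₂ i) ω}
  let E₃ : Set Ω := {ω | 4 * (32 * T ^ 2) * (√(M * q) + q) ≤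
    ∑ i, (n i : ℝ) * (e u s₁ i ω * e v s₂ i ω)}
  refine ⟨E₁ ∪ E₂ ∪ E₃, ?_, ?_, ?_⟩
  · refine ((measurableSet_le measurable_const (hXm _ _ _)).union
      (measurableSet_le measurable_const (hXm _ _ _))).union (measurableSet_le measurable_const
      (Finset.measurable_sum _ fun i _ ↦ ((hem _ _ i).mul (hem _ _ i)).const_mul _))
  · have h1 : μ.real E₁ ≤ Real.exp (-q) :=
      measureReal_linear_ge_le hmod hi hT hv hs₂ _ hV0 hq.le (hAV u s₁ hu hs₁)
    have h2 : μ.real E₂ ≤ Real.exp (-q) :=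
      measureReal_linear_ge_le hmod hi hT hu hs₁ _ hV0 hq.le (hAV v s₂ hv hs₂)
    have h3 : μ.real E₃ ≤ Real.exp (-q) := measureReal_bilinear_ge_le hmod hM hi hT hu hv hq
    have h4 := measureReal_union_le (μ := μ) (E₁ ∪ E₂) E₃
    have h5 := measureReal_union_le (μ := μ) E₁ E₂
    linarith
  · intro ω hω hy
    simp only [Set.mem_union, not_or] at hω
    obtain ⟨⟨h1, h2⟩, h3⟩ := hω
    have h1 : X v s₂ (fun i ↦ 2 * A u s₁ i) ω < √(2 * V * q) := not_le.1 h1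
    have h2 : X u s₁ (fun i ↦ 2 * A v s₂ i) ω < √(2 * V * q) := not_le.1 h2
    have h3 : ∑ i, (n i : ℝ) * (e u s₁ i ω * e v s₂ i ω) <
      4 * (32 * T ^ 2) * (√(M * q) + q) := not_le.1 h3
    -- Because |y_ij| ≤ T at this ω, the actual averages coincide with the truncated ones.
    have hsplit : ∀ w s i, inner ℝ w ((2 / (n i : ℝ)) • ∑ j ∈ s i, y i j ω • x i j ω) =
        A w s i + e w s i ω := fun w s i ↦ by
      simp only [A, e]
      rw [real_inner_smul_right, inner_sum, ← mul_add, ← Finset.sum_add_distrib]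
      congr 1
      refine Finset.sum_congr rfl fun j _ ↦ ?_
      rw [← inner_add_right, centredScore, add_sub_cancel, trunc, if_pos (hy i j)]
    have hX : ∀ w s (c : Fin M → ℝ), ∑ i, (n i : ℝ) * (c i * e w s i ω) = X w s (fun i ↦ 2 * c i) ω :=
      fun w s c ↦ by
        simp only [X, e]
        refine Finset.sum_congr rfl fun i _ ↦ ?_
        rw [← Finset.mul_sum]
        have := (hn i).ne'
        field_simp
    have hmain : ∑ i, (n i : ℝ) * (inner ℝ u (firstAverage (fun j ↦ x i j ω) fun j ↦ y i j ω) *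
        inner ℝ v (secondAverage (fun j ↦ x i j ω) fun j ↦ y i j ω)) -
        ∑ i, (n i : ℝ) * (inner ℝ u (mean i) * inner ℝ v (mean i)) =
        X v s₂ (fun i ↦ 2 * A u s₁ i) ω + X u s₁ (fun i ↦ 2 * A v s₂ i) ω +
        ∑ i, (n i : ℝ) * (e u s₁ i ω * e v s₂ i ω) +
        ∑ i, (n i : ℝ) * (A u s₁ i * A v s₂ i - inner ℝ u (mean i) * inner ℝ v (mean i)) := by
      rw [← hX, ← hX, ← Finset.sum_sub_distrib, ← Finset.sum_add_distrib,
        ← Finset.sum_add_distrib, ← Finset.sum_add_distrib]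
      refine Finset.sum_congr rfl fun i _ ↦ ?_
      have e1 : inner ℝ u (firstAverage (fun j ↦ x i j ω) fun j ↦ y i j ω) =
        A u s₁ i + e u s₁ i ω := hsplit u s₁ i
      have e2 : inner ℝ v (secondAverage (fun j ↦ x i j ω) fun j ↦ y i j ω) =
        A v s₂ i + e v s₂ i ω := hsplit v s₂ i
      rw [e1, e2]
      ring
    -- The deterministic bias is at most 3aδ per unit of weight, and Nδ ≤ a.
    have hlast : ∑ i, (n i : ℝ) * (A u s₁ i * A v s₂ i -
        inner ℝ u (mean i) * inner ℝ v (mean i)) ≤ 3 * a ^ 2 := by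
      calc _ ≤ ∑ i, (n i : ℝ) * δ * (3 * a) := by
            refine Finset.sum_le_sum fun i _ ↦ ?_
            rw [mul_assoc (n i : ℝ) δ]
            refine mul_le_mul_of_nonneg_left ?_ (hn i).le
            have b1 := abs_le.1 (hA u s₁ hu hs₁ i)
            have b2 := hA v s₂ hv hs₂ i
            have b3 := ha i u hu
            have b4 := ha i v hv
            have hid : A u s₁ i * A v s₂ i - inner ℝ u (mean i) * inner ℝ v (mean i) =
              (A u s₁ i - inner ℝ u (mean i)) * (A v s₂ i - inner ℝ v (mean i)) +
              (A u s₁ i - inner ℝ u (mean i)) * inner ℝ v (mean i) +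
              inner ℝ u (mean i) * (A v s₂ i - inner ℝ v (mean i)) := by ring
            have b1' := hA u s₁ hu hs₁ i
            have c1 : (A u s₁ i - inner ℝ u (mean i)) * (A v s₂ i - inner ℝ v (mean i)) ≤ δ * a :=
              (le_abs_self _).trans (by rw [abs_mul]; gcongr; exact b2.trans hδa)
            have c2 : (A u s₁ i - inner ℝ u (mean i)) * inner ℝ v (mean i) ≤ δ * a :=
              (le_abs_self _).trans (by rw [abs_mul]; gcongr)
            have c3 : inner ℝ u (mean i) * (A v s₂ i - inner ℝ v (mean i)) ≤ a * δ :=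
              (le_abs_self _).trans (by rw [abs_mul]; gcongr)
            rw [hid]
            linarith
        _ = (totalSize n : ℝ) * δ * (3 * a) := by rw [hN, Finset.sum_mul, Finset.sum_mul]
        _ ≤ a * (3 * a) := by gcongr
        _ = 3 * a ^ 2 := by ring
    rw [hmain]
    linarith

end Halves

/-! ### From fixed directions to the spectral error bound. -/

section Core

variable {Ω : Type*} [MeasurableSpace Ω] {μ : Measure Ω} [IsProbabilityMeasure μ]
  {M d k : ℕ} {n : Fin M → ℕ} {B : Matrix (Fin d) (Fin k) ℝ}
  {h : Fin M → EuclideanSpace ℝ (Fin k) → ℝ}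
  {x : (i : Fin M) → Fin (n i) → Ω → EuclideanSpace ℝ (Fin d)}
  {y : (i : Fin M) → Fin (n i) → Ω → ℝ}

/-- On an event of large probability the matrix `Z` is close to its signal part. -/
theorem exists_norm_replicaMatrix_sub_le (hmod : GeneralModel μ n B h x y) (hM : 0 < M)
    (hh : ∀ i, Continuous (h i)) {K : ℝ}
    (hi : ∀ i j, Integrable (fun ω ↦ Real.exp (11 * |y i j ω|)) μ)
    (hK : ∀ i j, ∫ ω, Real.exp (11 * |y i j ω|) ∂μ ≤ K) {T a l V q : ℝ} (hT : 0 < T)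
    (ha : (K + 1) / 2 ≤ a) (hNT : (totalSize n : ℝ) * Real.exp (-T) ≤ 1)
    (hl : ∀ c ∈ spectrum ℝ (diversity n h), c ≤ l) (hl0 : 0 ≤ l) (hV0 : 0 < V)
    (hV : 64 * T ^ 2 * (totalSize n * l + a ^ 2) ≤ V) (hq : 0 < q) :
    ∃ G : Set Ω, MeasurableSet G ∧
      1 - (totalSize n * (K * Real.exp (-(11 * T))) + 25 ^ d * (3 * Real.exp (-q))) ≤ μ.real G ∧
      ∀ ω ∈ G, ‖toEuclideanCLM (𝕜 := ℝ) (replicaMatrix n (fun i j ↦ x i j ω) (fun i j ↦ y i j ω) -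
        B * ((totalSize n : ℝ) • diversity n h) * Bᵀ)‖ ≤
          4 * (2 * √(2 * V * q) + 4 * (32 * T ^ 2) * (√(M * q) + q) + 3 * a ^ 2) := by
  classical
  have hB := hmod.orthonormal
  have hn : ∀ i, 0 < n i := fun i ↦ by
    have := hmod.two_le i
    omega
  have hN : (totalSize n : ℝ) ≠ 0 := by
    rw [Nat.cast_ne_zero, totalSize]
    exact (Finset.sum_pos (fun i _ ↦ hn i) ⟨⟨0, hM⟩, Finset.mem_univ _⟩).ne'
  have hle : ∀ i j ω, Real.exp (4 * |y i j ω|) ≤ Real.exp (11 * |y i j ω|) := fun i j ω ↦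
    Real.exp_le_exp.2 (by linarith [abs_nonneg (y i j ω)])
  have hi4 : ∀ i j, Integrable (fun ω ↦ Real.exp (4 * |y i j ω|)) μ := fun i j ↦ by
    have := hmod.measurable_y i j
    refine (hi i j).mono' (by fun_prop) (Filter.Eventually.of_forall fun ω ↦ ?_)
    rw [Real.norm_of_nonneg (Real.exp_pos _).le]
    exact hle i j ω
  have hK4 : ∀ i j, (∫ ω, Real.exp (4 * |y i j ω|) ∂μ + 1) / 2 ≤ a := fun i j ↦ by
    have := integral_mono (hi4 i j) (hi i j) (hle i j)
    linarith [hK i j]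
  have hK40 : ∀ i j, 0 ≤ (∫ ω, Real.exp (4 * |y i j ω|) ∂μ + 1) / 2 := fun i j ↦ by positivity
  have ha0 : 0 ≤ a := (hK40 ⟨0, hM⟩ ⟨0, hn _⟩).trans (hK4 _ _)
  let mean : Fin M → EuclideanSpace ℝ (Fin d) := fun i ↦ columnIsometry B hB (gaussianCorr (h i))
  have hmean : ∀ i j, ∫ ω, y i j ω • x i j ω ∂μ = mean i := fun i j ↦
    integral_smul_eq hB (hh i) (hmod.measurable_x i j) (hmod.measurable_y i j) (hmod.gaussian i j)
      (hi4 i j) (hmod.integrable_y i j) (hmod.condMean i j)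
  have hmean_le : ∀ i w, ‖w‖ ≤ 1 → |inner ℝ w (mean i)| ≤ a := fun i w hw ↦ by
    let j : Fin (n i) := ⟨0, hn i⟩
    rw [← hmean i j]
    refine (abs_inner_integral_le_of_le_exp (hmod.measurable_x i j) (hmod.gaussian i j) (hi4 i j)
      (hmod.measurable_y i j) zero_le_one le_rfl (fun ω ↦ ?_) hw).trans ?_
    · have := Real.add_one_le_exp (2 * |y i j ω|)
      linarith [abs_nonneg (y i j ω)]
    · rw [one_mul]
      exact hK4 i j
  have hbias : ∀ i j w, ‖w‖ ≤ 1 →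
      |inner ℝ w (mean i) - inner ℝ w (∫ ω, trunc T (y i j ω) • x i j ω ∂μ)| ≤
        Real.exp (-T) * a := fun i j w hw ↦ by
    rw [← hmean i j]
    exact (abs_inner_bias_le (hmod.measurable_x i j) (hmod.measurable_y i j) (hmod.gaussian i j)
      (hi4 i j) hT.le hw).trans (mul_le_mul_of_nonneg_left (hK4 i j) (Real.exp_pos _).le)
  -- The largest eigenvalue enters here: the sum is N times the quadratic form of the diversity
  -- matrix at Bᵀw.
  have hΛ : ∀ w : EuclideanSpace ℝ (Fin d), ‖w‖ ≤ 1 →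
      ∑ i, (n i : ℝ) * inner ℝ w (mean i) ^ 2 ≤ totalSize n * l := fun w hw ↦ by
    have h1 := inner_diversity n hN h (feature B w) (feature B w)
    have h2 := inner_toEuclideanCLM_le (isHermitian_diversity n h) hl (feature B w)
    simp only [mean, inner_columnIsometry, sq]
    rw [← h1]
    refine mul_le_mul_of_nonneg_left (h2.trans ?_) (Nat.cast_nonneg _)
    have h3 := (norm_feature_le B hB w).trans hw
    have h4 : ‖feature B w‖ ^ 2 ≤ 1 := pow_le_one₀ (norm_nonneg _) h3
    nlinarith
  obtain ⟨S, hScard, hS1, hnet⟩ := exists_halfNet (EuclideanSpace ℝ (Fin d))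
  rw [finrank_euclideanSpace_fin] at hScard
  have hE : ∀ p : S × S, ∃ E : Set Ω, MeasurableSet E ∧ μ.real E ≤ 3 * Real.exp (-q) ∧ ∀ ω ∉ E,
      (∀ i j, |y i j ω| ≤ T) →
      inner ℝ (p.1 : EuclideanSpace ℝ (Fin d)) (toEuclideanCLM (𝕜 := ℝ)
        (replicaMatrix n (fun i j ↦ x i j ω) (fun i j ↦ y i j ω) -
          B * ((totalSize n : ℝ) • diversity n h) * Bᵀ) p.2) ≤
        2 * √(2 * V * q) + 4 * (32 * T ^ 2) * (√(M * q) + q) + 3 * a ^ 2 := fun p ↦ by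
    obtain ⟨E, hEm, hEp, hE⟩ := exists_tail_event hmod hM hi4 hT (hS1 _ p.1.2) (hS1 _ p.2.2) mean
      (a := a) (δ := Real.exp (-T) * a) (Λ := totalSize n * l)
      (mul_le_of_le_one_left ha0 (Real.exp_le_one_iff.2 (by linarith)))
      (by positivity) (by rw [← mul_assoc]; exact mul_le_of_le_one_left ha0 hNT)
      hmean_le hbias hΛ hV0 hV hq
    refine ⟨E, hEm, hEp, fun ω hω hy ↦ ?_⟩
    rw [map_sub, _root_.sub_apply, inner_sub_right, inner_replicaMatrix,
      inner_signal n hN hB]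
    exact hE ω hω hy
  choose E hEm hEp hE using hE
  let F : (i : Fin M) × Fin (n i) → Set Ω := fun p ↦ {ω | T < |y p.1 p.2 ω|}
  have hFm : ∀ p, MeasurableSet (F p) := fun p ↦
    measurableSet_lt measurable_const (measurable_norm.comp (hmod.measurable_y p.1 p.2))
  have hbad : MeasurableSet ((⋃ p, F p) ∪ ⋃ p, E p) :=
    (MeasurableSet.iUnion hFm).union (MeasurableSet.iUnion hEm)
  refine ⟨((⋃ p, F p) ∪ ⋃ p, E p)ᶜ, hbad.compl, ?_, ?_⟩
  · rw [probReal_compl_eq_one_sub hbad]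
    refine sub_le_sub_left ((measureReal_union_le _ _).trans (add_le_add ?_ ?_)) 1
    · refine (measureReal_iUnion_fintype_le F).trans ?_
      refine (Finset.sum_le_sum fun p _ ↦ measure_abs_gt_le (hi p.1 p.2) (hK p.1 p.2)).trans ?_
      rw [Finset.sum_const, nsmul_eq_mul, Finset.card_univ, Fintype.card_sigma]
      simp [totalSize]
    · refine (measureReal_iUnion_fintype_le E).trans ?_
      refine (Finset.sum_le_sum fun p _ ↦ hEp p).trans ?_
      rw [Finset.sum_const, nsmul_eq_mul, Finset.card_univ, Fintype.card_prod, Fintype.card_coe]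
      gcongr
      have : S.card * S.card ≤ 25 ^ d := by
        calc S.card * S.card ≤ 5 ^ d * 5 ^ d := by gcongr
          _ = 25 ^ d := by rw [← mul_pow]; norm_num
      exact_mod_cast this
  · intro ω hω
    simp only [Set.compl_union, Set.mem_inter_iff, Set.mem_compl_iff, Set.mem_iUnion,
      not_exists] at hω
    refine opNorm_le_of_halfNet hnet _ fun u hu v hv ↦ ?_
    exact hE (⟨u, hu⟩, ⟨v, hv⟩) ω (hω.2 _) fun i j ↦ not_lt.1 (hω.1 ⟨i, j⟩)

/-- The exponent 11T pays for N ≤ e^T samples; 14dT pays for 25^d ≤ e^(4d) net pairs, as 14dT ≥ 4d +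
10T for d, T ≥ 1. Both leave e^(-10T) = (d + N)^(-10). -/
theorem failure_probability_le {d N T K : ℝ} {m : ℕ} (hm : (m : ℝ) = d) (hd : 1 ≤ d)
    (hT : 1 ≤ T) (hexp : Real.exp T = d + N) (hK : 0 ≤ K) :
    N * (K * Real.exp (-(11 * T))) + 25 ^ m * (3 * Real.exp (-(14 * d * T))) ≤
      (K + 3) * ((d + N) ^ 10)⁻¹ := by
  have h10 : ((d + N) ^ 10)⁻¹ = Real.exp (-(10 * T)) := by
    rw [← hexp, ← Real.exp_nat_mul, ← Real.exp_neg]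
    norm_num
  have h1 : N * (K * Real.exp (-(11 * T))) ≤ K * Real.exp (-(10 * T)) := by
    have e : Real.exp (-(10 * T)) = Real.exp T * Real.exp (-(11 * T)) := by
      rw [← Real.exp_add]
      ring_nf
    have hp := Real.exp_pos (-(11 * T))
    rw [e, hexp]
    have : 0 ≤ d * (K * Real.exp (-(11 * T))) := by positivity
    linarith
  have h25 : (25 : ℝ) ^ m ≤ Real.exp (4 * d) := by
    have e4 : (25 : ℝ) ≤ Real.exp 4 := by
      have := Real.exp_one_gt_d9
      calc (25 : ℝ) ≤ 2.7 ^ 4 := by norm_num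
        _ ≤ Real.exp 1 ^ 4 := by gcongr; linarith
        _ = Real.exp 4 := by rw [← Real.exp_nat_mul]; norm_num
    calc (25 : ℝ) ^ m ≤ Real.exp 4 ^ m := by gcongr
      _ = Real.exp (4 * d) := by rw [← Real.exp_nat_mul, hm, mul_comm]
  have h2 : 25 ^ m * (3 * Real.exp (-(14 * d * T))) ≤ 3 * Real.exp (-(10 * T)) := by
    calc 25 ^ m * (3 * Real.exp (-(14 * d * T)))
        ≤ Real.exp (4 * d) * (3 * Real.exp (-(14 * d * T))) := by gcongr
      _ = 3 * Real.exp (4 * d + -(14 * d * T)) := by rw [Real.exp_add]; ring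
      _ ≤ 3 * Real.exp (-(10 * T)) := by
        gcongr
        nlinarith [mul_nonneg (sub_nonneg.2 hd) (sub_nonneg.2 hT)]
  rw [h10]
  linarith

/-- The deviation level in terms of the two rates. -/
theorem deviation_le {d N M T l a : ℝ} (hd : 1 ≤ d) (hM : 1 ≤ M) (hT : 1 ≤ T) (ha : 0 ≤ a)
    (hdN : d ≤ N * l) :
    2 * √(2 * (64 * T ^ 2 * (N * l + a ^ 2)) * (14 * d * T)) +
      4 * (32 * T ^ 2) * (√(M * (14 * d * T)) + 14 * d * T) + 3 * a ^ 2 ≤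
    (86 * (1 + a) + 1792 + 3 * a ^ 2) * (T ^ 3 * (√(N * l * d) + √(M * d))) := by
  have hNl : 0 ≤ N * l := by linarith
  have hT3 : T ^ 3 ≤ T ^ 6 := pow_le_pow_right₀ hT (by norm_num)
  have hMd : 1 ≤ √(M * d) := Real.one_le_sqrt.2 (by nlinarith)
  -- Under d ≤ N l the sub-exponential part dT of the chaos tail is absorbed by the first rate.
  have hdle : d ≤ √(N * l * d) := Real.le_sqrt_of_sq_le (by nlinarith)
  have hddM : √d ≤ √(M * d) := Real.sqrt_le_sqrt (by nlinarith)
  -- The constant is 43 because 2 · 64 · 14 = 1792 ≤ 43².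
  have h1 : √(2 * (64 * T ^ 2 * (N * l + a ^ 2)) * (14 * d * T)) ≤
      43 * T ^ 3 * (√(N * l * d) + a * √d) := by
    refine Real.sqrt_le_iff.2 ⟨by positivity, ?_⟩
    have e1 := Real.sq_sqrt (by positivity : 0 ≤ N * l * d)
    have e2 := Real.sq_sqrt (by positivity : 0 ≤ d)
    calc 2 * (64 * T ^ 2 * (N * l + a ^ 2)) * (14 * d * T)
        = 1792 * T ^ 3 * (N * l * d + a ^ 2 * d) := by ring
      _ ≤ 43 ^ 2 * T ^ 6 * (N * l * d + a ^ 2 * d) := by gcongr; norm_num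
      _ = 43 ^ 2 * T ^ 6 * (√(N * l * d) ^ 2 + a ^ 2 * √d ^ 2) := by rw [e1, e2]
      _ ≤ 43 ^ 2 * T ^ 6 * (√(N * l * d) + a * √d) ^ 2 := by
        gcongr
        have : 0 ≤ √(N * l * d) * (a * √d) := by positivity
        nlinarith
      _ = (43 * T ^ 3 * (√(N * l * d) + a * √d)) ^ 2 := by ring
  have h2 : √(M * (14 * d * T)) ≤ 14 * T * √(M * d) := by
    refine Real.sqrt_le_iff.2 ⟨by positivity, ?_⟩
    rw [mul_pow, Real.sq_sqrt (by positivity)]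
    have : 14 * T ≤ (14 * T) ^ 2 := by nlinarith
    calc M * (14 * d * T) = 14 * T * (M * d) := by ring
      _ ≤ (14 * T) ^ 2 * (M * d) := by gcongr
  set P := √(N * l * d)
  set Q := √(M * d)
  have hP : 0 ≤ P := Real.sqrt_nonneg _
  have hT31 : 1 ≤ T ^ 3 := one_le_pow₀ hT
  have b1 : √(2 * (64 * T ^ 2 * (N * l + a ^ 2)) * (14 * d * T)) ≤
      43 * (1 + a) * (T ^ 3 * (P + Q)) := by
    refine h1.trans ?_
    have : P + a * √d ≤ (1 + a) * (P + Q) := by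
      have := mul_le_mul_of_nonneg_left hddM ha
      nlinarith [mul_nonneg ha hP]
    calc 43 * T ^ 3 * (P + a * √d) ≤ 43 * T ^ 3 * ((1 + a) * (P + Q)) := by gcongr
      _ = _ := by ring
  have b2 : 4 * (32 * T ^ 2) * (√(M * (14 * d * T)) + 14 * d * T) ≤
      1792 * (T ^ 3 * (P + Q)) := by
    calc 4 * (32 * T ^ 2) * (√(M * (14 * d * T)) + 14 * d * T)
        ≤ 4 * (32 * T ^ 2) * (14 * T * Q + 14 * P * T) := by gcongr
      _ = 1792 * (T ^ 3 * (P + Q)) := by ring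
  have b3 : 3 * a ^ 2 ≤ 3 * a ^ 2 * (T ^ 3 * (P + Q)) :=
    le_mul_of_one_le_right (by positivity) (one_le_mul_of_one_le_of_one_le hT31 (by linarith))
  linarith

/-- The constant of the error bound, as a function of a bound `K` on the exponential moments. -/
noncomputable def errorConstant (K : ℝ) : ℝ :=
  -- The factor 16 is 4 from Wedin times 4 from the net; K + 5 exceeds the K + 3 of the failure
  -- probability and the trivial bound 2.
  16 * (86 * (1 + (K + 1) / 2) + 1792 + 3 * ((K + 1) / 2) ^ 2) + K + 5

theorem errorConstant_pos {K : ℝ} (hK : 1 ≤ K) : 0 < errorConstant K := by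
  unfold errorConstant
  positivity

/-- The error bound under an exponential moment of the responses. -/
theorem spectralErrorBound_of_integral_exp_le (hmod : GeneralModel μ n B h x y)
    (hh : ∀ i, Continuous (h i)) {K : ℝ} (hK1 : 1 ≤ K)
    (hi : ∀ i j, Integrable (fun ω ↦ Real.exp (11 * |y i j ω|)) μ)
    (hK : ∀ i j, ∫ ω, Real.exp (11 * |y i j ω|) ∂μ ≤ K) :
    SpectralErrorBound μ n B h x y (errorConstant K) := by
  intro l₁ l hl₁ hl hl0
  rw [errorConstant]
  set a := (K + 1) / 2 with ha
  have ha0 : 0 ≤ a := by positivity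
  set C₀ := 86 * (1 + a) + 1792 + 3 * a ^ 2 with hC₀
  have hC₀0 : 0 ≤ C₀ := by positivity
  set C := 16 * C₀ + K + 5 with hC
  have hB := hmod.orthonormal
  have hll : l ≤ l₁ := hl.2 hl₁.1
  have hl₁0 : 0 < l₁ := hl0.trans_le hll
  -- Positivity of M, k and d follows from a positive eigenvalue: for M = 0 the diversity matrix
  -- vanishes, and for k = 0 the spectrum is empty.
  have hM : 0 < M := by
    rcases Nat.eq_zero_or_pos M with rfl | h0
    · exfalso
      have h1 : diversity n h = 0 := by simp [diversity]
      have h2 := hl.1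
      rw [h1] at h2
      have : Nontrivial (Matrix (Fin k) (Fin k) ℝ) := by
        by_contra hnt
        rw [not_nontrivial_iff_subsingleton] at hnt
        rw [spectrum.of_subsingleton] at h2
        exact h2
      rw [spectrum.zero_eq] at h2
      exact hl0.ne' h2
    · exact h0
  have hk : 0 < k := by
    rcases Nat.eq_zero_or_pos k with rfl | h0
    · have h2 := hl.1
      rw [spectrum.of_subsingleton] at h2
      exact h2.elim
    · exact h0
  have hd : 0 < d := by
    rcases Nat.eq_zero_or_pos d with rfl | h0
    · have := congrFun (congrFun hB ⟨0, hk⟩) ⟨0, hk⟩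
      simp [mul_apply] at this
    · exact h0
  have hN2 : 2 ≤ totalSize n := (hmod.two_le ⟨0, hM⟩).trans
    (Finset.single_le_sum (f := n) (fun _ _ ↦ Nat.zero_le _) (Finset.mem_univ _))
  have hd1 : (1 : ℝ) ≤ d := by exact_mod_cast hd
  have hM1 : (1 : ℝ) ≤ M := by exact_mod_cast hM
  have hN2' : (2 : ℝ) ≤ totalSize n := by exact_mod_cast hN2
  set N : ℝ := (totalSize n : ℝ) with hNdef
  have hN0 : 0 < N := by linarith
  set T := Real.log (d + N) with hTdef
  have hexp : Real.exp T = d + N := Real.exp_log (by positivity)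
  -- d + N ≥ 3 > e.
  have hT : 1 ≤ T := by
    rw [hTdef, Real.le_log_iff_exp_le (by positivity)]
    linarith [Real.exp_one_lt_d9]
  have hT3 : 1 ≤ T ^ 3 := one_le_pow₀ hT
  have hN : N ≠ 0 := hN0.ne'
  obtain ⟨G, hGm, hGp, hG⟩ := exists_norm_replicaMatrix_sub_le hmod hM hh hi hK
    (T := T) (a := a) (l := l₁) (V := 64 * T ^ 2 * (N * l₁ + a ^ 2)) (q := 14 * d * T)
    (by linarith) le_rfl (by
      rw [← hNdef, Real.exp_neg, hexp, ← div_eq_mul_inv, div_le_one (by positivity)]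
      linarith) (fun c hc ↦ hl₁.2 hc) hl₁0.le (by positivity) le_rfl (by positivity)
  refine ⟨G, hGm, ?_, fun ω hω A hA ↦ ?_⟩
  · have h1 := failure_probability_le (m := d) rfl hd1 hT hexp (by linarith : 0 ≤ K)
    have h2 : (K + 3) * (((d : ℝ) + N) ^ 10)⁻¹ ≤ C * (((d : ℝ) + N) ^ 10)⁻¹ := by
      gcongr
      linarith
    linarith
  · have hr1 : √((d : ℝ) * l₁ / (N * l ^ 2)) = √(N * l₁ * d) / (N * l) := by
      rw [eq_div_iff (by positivity), ← Real.sqrt_sq (by positivity : 0 ≤ N * l),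
        ← Real.sqrt_mul (by positivity)]
      congr 1
      field_simp
    have hr2 : √((M : ℝ) * d / (N ^ 2 * l ^ 2)) = √(M * d) / (N * l) := by
      rw [← mul_pow, Real.sqrt_div (by positivity), Real.sqrt_sq (by positivity)]
    -- If N λ_k ≤ d, then N λ_k² ≤ d λ₁, the first rate is at least 1, and sin Θ ≤ 2 suffices.
    rcases le_total (N * l) d with hcase | hcase
    · have hA1 : Aᵀ * A = 1 := by
        rcases hA with hA | hA
        · exact hA.transpose_mul_self
        · exact hA.transpose.transpose_mul_self
      have h1 : 1 ≤ √((d : ℝ) * l₁ / (N * l ^ 2)) := by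
        rw [Real.one_le_sqrt, one_le_div (by positivity)]
        calc N * l ^ 2 = N * l * l := by ring
          _ ≤ d * l₁ := by gcongr
      have h2 := Real.sqrt_nonneg ((M : ℝ) * d / (N ^ 2 * l ^ 2))
      calc sinTheta A B ≤ 2 := sinTheta_le_two hA1 hB
        _ ≤ C := by linarith
        _ ≤ _ := le_mul_of_one_le_right (by linarith)
          (one_le_mul_of_one_le_of_one_le (by linarith) hT3)
    · have hdN : (d : ℝ) ≤ N * l₁ := hcase.trans (by gcongr)
      have hDs : (N • diversity n h)ᵀ = N • diversity n h := by
        have := isHermitian_diversity n h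
        rw [IsHermitian, conjTranspose_eq_transpose_of_trivial] at this
        rw [transpose_smul, this]
      have hD : ∀ z, N * l * ‖z‖ ≤ ‖toEuclideanCLM (𝕜 := ℝ) (N • diversity n h) z‖ := fun z ↦ by
        have := mul_norm_le_norm_toEuclideanCLM (isHermitian_diversity n h)
          (fun c hc ↦ hl.2 hc) z
        rw [map_smul, _root_.smul_apply, norm_smul, Real.norm_of_nonneg hN0.le,
          mul_assoc]
        gcongr
      have h1 := sinTheta_le hB (N • diversity n h) hDs (by positivity) hD hA
      refine h1.trans ?_
      have h2 := deviation_le hd1 hM1 hT ha0 hdN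
      rw [hr1, hr2, ← add_div, div_mul_eq_mul_div, mul_div_assoc']
      refine div_le_div_of_nonneg_right ?_ (by positivity)
      have h3 : 0 ≤ T ^ 3 * (√(N * l₁ * d) + √(M * d)) := by positivity
      have h4 := hG ω hω
      have h5 : 16 * C₀ * (T ^ 3 * (√(N * l₁ * d) + √(M * d))) ≤
          C * (T ^ 3 * (√(N * l₁ * d) + √(M * d))) := by
        gcongr
        linarith
      linarith

end Core

/-! ### Exponential moments of the responses. -/

section Moments

variable {Ω : Type*} [MeasurableSpace Ω] {μ : Measure Ω} {d k : ℕ}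
  {x : Ω → EuclideanSpace ℝ (Fin d)} {y : Ω → ℝ}

theorem integrable_and_integral_le_of_lintegral_le {f : Ω → ℝ} (hf : Measurable f)
    (hf0 : ∀ ω, 0 ≤ f ω) {c : ℝ} (hc : 0 ≤ c)
    (h : ∫⁻ ω, ENNReal.ofReal (f ω) ∂μ ≤ ENNReal.ofReal c) :
    Integrable f μ ∧ ∫ ω, f ω ∂μ ≤ c := by
  refine ⟨⟨hf.aestronglyMeasurable, ?_⟩, ?_⟩
  · rw [hasFiniteIntegral_iff_ofReal (Filter.Eventually.of_forall hf0)]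
    exact h.trans_lt ENNReal.ofReal_lt_top
  · rw [integral_eq_lintegral_of_nonneg_ae (Filter.Eventually.of_forall hf0)
      hf.aestronglyMeasurable]
    exact ENNReal.toReal_le_of_le_ofReal hc h

/-- Exponential moments of a Lipschitz function of a Gaussian feature. -/
theorem integral_exp_mul_feature_le {B : Matrix (Fin d) (Fin k) ℝ} (hB : Bᵀ * B = 1)
    {h : EuclideanSpace ℝ (Fin k) → ℝ} {L : NNReal} (hL : LipschitzWith L h) {m : ℝ}
    (hm : |gaussianMean h| ≤ m) (hxm : Measurable x)
    (hx : μ.map x = stdGaussian (EuclideanSpace ℝ (Fin d))) (t : ℝ) :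
    Integrable (fun ω ↦ Real.exp (t * h (feature B (x ω)))) μ ∧
      ∫ ω, Real.exp (t * h (feature B (x ω))) ∂μ ≤
        Real.exp (|t| * m) * Real.exp ((t * (Real.pi / 2)) ^ 2 * L ^ 2 / 2) := by
  have hh : Measurable h := hL.continuous.measurable
  have hfm : Measurable (feature B) := (continuous_feature B).measurable
  have hmap : μ.map (fun ω ↦ feature B (x ω)) = stdGaussian (EuclideanSpace ℝ (Fin k)) := by
    rw [← map_feature_stdGaussian hB, ← hx, Measure.map_map hfm hxm]
    rfl
  refine integrable_and_integral_le_of_lintegral_le (by fun_prop) (fun ω ↦ (Real.exp_pos _).le)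
    (by positivity) ?_
  have h1 : ∫⁻ ω, ENNReal.ofReal (Real.exp (t * h (feature B (x ω)))) ∂μ =
      ∫⁻ u, ENNReal.ofReal (Real.exp (t * h u)) ∂stdGaussian (EuclideanSpace ℝ (Fin k)) := by
    rw [← hmap, lintegral_map (by fun_prop) (by fun_prop)]
  rw [h1, ENNReal.ofReal_mul (Real.exp_pos _).le]
  calc ∫⁻ u, ENNReal.ofReal (Real.exp (t * h u)) ∂stdGaussian (EuclideanSpace ℝ (Fin k))
      ≤ ∫⁻ u, ENNReal.ofReal (Real.exp (|t| * m)) *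
          ENNReal.ofReal (Real.exp (t * (h u - gaussianMean h)))
          ∂stdGaussian (EuclideanSpace ℝ (Fin k)) := by
        refine lintegral_mono fun u ↦ ?_
        rw [← ENNReal.ofReal_mul (Real.exp_pos _).le, ← Real.exp_add]
        refine ENNReal.ofReal_le_ofReal (Real.exp_le_exp.2 ?_)
        have h2 : t * gaussianMean h ≤ |t| * m := (le_abs_self _).trans (by
          rw [abs_mul]
          gcongr)
        linarith
    _ = ENNReal.ofReal (Real.exp (|t| * m)) *
          ∫⁻ u, ENNReal.ofReal (Real.exp (t * (h u - gaussianMean h)))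
          ∂stdGaussian (EuclideanSpace ℝ (Fin k)) := lintegral_const_mul _ (by fun_prop)
    _ ≤ _ := by
        gcongr
        exact lintegral_exp_mul_sub_gaussianMean_le hL t

theorem CondSubgaussianError.integral_le [IsProbabilityMeasure μ] {σ : ℝ}
    (h : CondSubgaussianError μ x y σ) (hxm : Measurable x) (t : ℝ) :
    ∫ ω, Real.exp (t * (y ω - (μ[y | MeasurableSpace.comap x inferInstance]) ω)) ∂μ ≤
      Real.exp (σ ^ 2 * t ^ 2 / 2) := by
  rw [← integral_condExp hxm.comap_le]
  refine (integral_mono_ae integrable_condExp (integrable_const _) (h t).2).trans ?_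
  simp

/-- Bound exp(s|y|) by exp(sy) + exp(-sy) and split y into regression value and error. The
inequality ab ≤ (a² + b²)/2 separates the two without independence, at the price of doubling s. -/
theorem integral_exp_abs_le [IsProbabilityMeasure μ] {B : Matrix (Fin d) (Fin k) ℝ}
    (hB : Bᵀ * B = 1) {h : EuclideanSpace ℝ (Fin k) → ℝ} {L : NNReal} (hL : LipschitzWith L h)
    {m σ : ℝ} (hm : |gaussianMean h| ≤ m) (hxm : Measurable x) (hym : Measurable y)
    (hx : μ.map x = stdGaussian (EuclideanSpace ℝ (Fin d)))
    (hcm : μ[y | MeasurableSpace.comap x inferInstance] =ᵐ[μ] fun ω ↦ h (feature B (x ω)))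
    (hσ : CondSubgaussianError μ x y σ) {s : ℝ} (hs : 0 ≤ s) :
    Integrable (fun ω ↦ Real.exp (s * |y ω|)) μ ∧ ∫ ω, Real.exp (s * |y ω|) ∂μ ≤
      Real.exp (2 * s * m) * Real.exp ((2 * s * (Real.pi / 2)) ^ 2 * L ^ 2 / 2) +
        Real.exp (σ ^ 2 * (2 * s) ^ 2 / 2) := by
  let F : ℝ → Ω → ℝ := fun t ω ↦ Real.exp (t * h (feature B (x ω)))
  let R : ℝ → Ω → ℝ := fun t ω ↦
    Real.exp (t * (y ω - (μ[y | MeasurableSpace.comap x inferInstance]) ω))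
  have hF := fun t ↦ integral_exp_mul_feature_le hB hL hm hxm hx t
  have hint : Integrable (fun ω ↦ (F (2 * s) ω + R (2 * s) ω) / 2 +
      (F (-(2 * s)) ω + R (-(2 * s)) ω) / 2) μ :=
    (((hF _).1.add (hσ _).1).div_const 2).add (((hF _).1.add (hσ _).1).div_const 2)
  have hle : (fun ω ↦ Real.exp (s * |y ω|)) ≤ᵐ[μ] fun ω ↦ (F (2 * s) ω + R (2 * s) ω) / 2 +
      (F (-(2 * s)) ω + R (-(2 * s)) ω) / 2 := by
    filter_upwards [hcm] with ω hω
    have key : ∀ t : ℝ, Real.exp (t * y ω) ≤ (F (2 * t) ω + R (2 * t) ω) / 2 := fun t ↦ by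
      simp only [F, R, hω]
      set g := h (feature B (x ω))
      have e1 : Real.exp (2 * t * g) = Real.exp (t * g) ^ 2 := by
        rw [← Real.exp_nat_mul]; push_cast; ring_nf
      have e2 : Real.exp (2 * t * (y ω - g)) = Real.exp (t * (y ω - g)) ^ 2 := by
        rw [← Real.exp_nat_mul]; push_cast; ring_nf
      have e3 : Real.exp (t * y ω) = Real.exp (t * g) * Real.exp (t * (y ω - g)) := by
        rw [← Real.exp_add]; ring_nf
      rw [e1, e2, e3]
      nlinarith [sq_nonneg (Real.exp (t * g) - Real.exp (t * (y ω - g)))]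
    have k1 := key s
    have k2 := key (-s)
    rw [mul_neg] at k2
    rcases abs_cases (y ω) with ⟨h1, -⟩ | ⟨h1, -⟩
    · rw [h1]
      linarith [Real.exp_pos (-s * y ω)]
    · rw [h1, show s * -y ω = -s * y ω by ring]
      linarith [Real.exp_pos (s * y ω)]
  refine ⟨hint.mono' (by fun_prop) ?_, (integral_mono_ae (hint.mono' (by fun_prop) ?_) hint
    hle).trans ?_⟩
  · filter_upwards [hle] with ω hω
    rwa [Real.norm_of_nonneg (Real.exp_pos _).le]
  · filter_upwards [hle] with ω hω
    rwa [Real.norm_of_nonneg (Real.exp_pos _).le]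
  · have hFR : ∀ t, Integrable (F t) μ ∧ Integrable (R t) μ := fun t ↦ ⟨(hF t).1, (hσ t).1⟩
    have hsum : ∀ t, Integrable (fun ω ↦ F t ω + R t ω) μ := fun t ↦ (hFR t).1.add (hFR t).2
    rw [integral_add ((hsum _).div_const 2) ((hsum _).div_const 2),
      integral_div, integral_div, integral_add (hFR _).1 (hFR _).2,
      integral_add (hFR _).1 (hFR _).2]
    have b1 := (hF (2 * s)).2
    have b2 := (hF (-(2 * s))).2
    have b3 := hσ.integral_le hxm (2 * s)
    have b4 := hσ.integral_le hxm (-(2 * s))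
    rw [abs_of_nonneg (by positivity)] at b1
    rw [abs_neg, abs_of_nonneg (by positivity : 0 ≤ 2 * s), neg_mul, neg_sq] at b2
    rw [neg_sq] at b4
    simp only [F, R]
    linarith

end Moments

/-! ### Logistic and ReLU regression functions. -/

section Links

variable {k : ℕ}

theorem continuous_logisticLink (α : EuclideanSpace ℝ (Fin k)) : Continuous (logisticLink α) := by
  unfold logisticLink
  refine continuous_const.div (by fun_prop) fun u ↦ ?_
  positivity

theorem abs_reluLink_sub_le (α u v : EuclideanSpace ℝ (Fin k)) :
    |reluLink α u - reluLink α v| ≤ ‖α‖ * ‖u - v‖ := by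
  have h : reluLink α u - reluLink α v = ∑ r, (max 0 (u r) - max 0 (v r)) * α r := by
    simp only [reluLink, ← Finset.sum_sub_distrib, sub_mul]
  rw [h, EuclideanSpace.norm_eq, EuclideanSpace.norm_eq, mul_comm]
  calc |∑ r, (max 0 (u r) - max 0 (v r)) * α r|
      ≤ ∑ r, ‖(u - v) r‖ * ‖α r‖ := by
        refine (Finset.abs_sum_le_sum_abs _ _).trans (Finset.sum_le_sum fun r _ ↦ ?_)
        rw [abs_mul]
        refine mul_le_mul_of_nonneg_right ?_ (abs_nonneg _)
        simpa [max_comm] using abs_max_sub_max_le_abs (u r) (v r) 0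
    _ ≤ _ := Real.sum_mul_le_sqrt_mul_sqrt _ _ _

theorem integrable_sq_gaussianReal : Integrable (fun t : ℝ ↦ t ^ 2) (gaussianReal 0 1) :=
  (memLp_id_gaussianReal 2).integrable_sq

/-- All coordinates share the same mean c = E max(0, g), so the mean of the network is c ∑ α_r; only
0 ≤ c ≤ 1 is needed. -/
theorem abs_gaussianMean_reluLink_le (α : EuclideanSpace ℝ (Fin k)) :
    |gaussianMean (reluLink α)| ≤ |∑ r, α r| := by
  let c : ℝ := ∫ t, max 0 t ∂gaussianReal 0 1
  have hmap : ∀ r : Fin k, (stdGaussian (EuclideanSpace ℝ (Fin k))).map (fun u ↦ u r) =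
      gaussianReal 0 1 := fun r ↦ by
    have := map_inner_stdGaussian (EuclideanSpace.single r (1 : ℝ))
    simpa [EuclideanSpace.inner_single_left] using this
  have hdom : ∀ t : ℝ, max 0 t ≤ (t ^ 2 + 1) / 2 := fun t ↦
    max_le (by positivity) (by nlinarith [sq_nonneg (t - 1)])
  have hsq := (integrable_sq_gaussianReal.add (integrable_const 1)).div_const 2
  have hci : Integrable (fun t : ℝ ↦ max 0 t) (gaussianReal 0 1) := by
    refine hsq.mono' (by fun_prop) (Filter.Eventually.of_forall fun t ↦ ?_)
    rw [Real.norm_of_nonneg (le_max_left _ _)]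
    exact hdom t
  have hc0 : 0 ≤ c := integral_nonneg fun t ↦ le_max_left _ _
  have hc1 : c ≤ 1 := by
    refine (integral_mono hci hsq hdom).trans ?_
    rw [integral_div]
    erw [integral_add integrable_sq_gaussianReal (integrable_const 1)]
    rw [integral_sq_gaussianReal]
    simp
  have hr : ∀ r : Fin k, Integrable (fun u : EuclideanSpace ℝ (Fin k) ↦ max 0 (u r))
      (stdGaussian (EuclideanSpace ℝ (Fin k))) ∧
      ∫ u : EuclideanSpace ℝ (Fin k), max 0 (u r) ∂stdGaussian (EuclideanSpace ℝ (Fin k)) = c :=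
    fun r ↦ by
    have hm : Measurable fun u : EuclideanSpace ℝ (Fin k) ↦ u r := by fun_prop
    constructor
    · have := hci
      rw [← hmap r] at this
      exact this.comp_measurable hm
    · simp only [c]
      rw [← hmap r, integral_map hm.aemeasurable (by fun_prop)]
  have h : gaussianMean (reluLink α) = c * ∑ r, α r := by
    unfold gaussianMean reluLink
    rw [integral_finsetSum _ fun r _ ↦ (hr r).1.mul_const _, Finset.mul_sum]
    exact Finset.sum_congr rfl fun r _ ↦ by rw [integral_mul_const, (hr r).2]
  rw [h, abs_mul, abs_of_nonneg hc0]
  exact mul_le_of_le_one_left (abs_nonneg _) hc1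

end Links

/-! ### Constants for the three models and the main theorem. -/

/-- The error bound for Lipschitz regression functions with sub-gaussian errors, with a constant
that depends on the Lipschitz constant, the mean and the variance proxy. -/
theorem exists_spectralErrorBound_of_lipschitz (L m σ : ℝ) : ∃ C : ℝ, 0 < C ∧
    ∀ (Ω : Type*) [MeasurableSpace Ω] (μ : Measure Ω) [IsProbabilityMeasure μ]
      (M d k : ℕ) (n : Fin M → ℕ) (B : Matrix (Fin d) (Fin k) ℝ)
      (h : Fin M → EuclideanSpace ℝ (Fin k) → ℝ)
      (x : (i : Fin M) → Fin (n i) → Ω → EuclideanSpace ℝ (Fin d))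
      (y : (i : Fin M) → Fin (n i) → Ω → ℝ), GeneralModel μ n B h x y →
      (∀ i u v, |h i u - h i v| ≤ L * ‖u - v‖) → (∀ i, |gaussianMean (h i)| ≤ m) →
      (∀ i j, CondSubgaussianError μ (x i j) (y i j) σ) → SpectralErrorBound μ n B h x y C := by
  -- The bound of `integral_exp_abs_le` at s = 11, with L replaced by its positive part.
  let K : ℝ := Real.exp (2 * 11 * m) *
    Real.exp ((2 * 11 * (Real.pi / 2)) ^ 2 * (L.toNNReal : ℝ) ^ 2 / 2) +
      Real.exp (σ ^ 2 * (2 * 11) ^ 2 / 2)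
  have hK : 1 ≤ K := by
    have h1 : 1 ≤ Real.exp (σ ^ 2 * (2 * 11) ^ 2 / 2) := Real.one_le_exp (by positivity)
    have h2 : 0 < Real.exp (2 * 11 * m) *
      Real.exp ((2 * 11 * (Real.pi / 2)) ^ 2 * (L.toNNReal : ℝ) ^ 2 / 2) := by positivity
    exact h1.trans (le_add_of_nonneg_left h2.le)
  refine ⟨errorConstant K, errorConstant_pos hK, fun Ω _ μ _ M d k n B h x y hmod hL hm hσ ↦ ?_⟩
  have hLip : ∀ i, LipschitzWith L.toNNReal (h i) := fun i ↦
    LipschitzWith.of_dist_le_mul fun u v ↦ by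
      rw [Real.dist_eq, dist_eq_norm]
      exact (hL i u v).trans (mul_le_mul_of_nonneg_right (Real.le_coe_toNNReal L)
        (norm_nonneg _))
  have key := fun i j ↦ integral_exp_abs_le hmod.orthonormal (hLip i) (hm i)
    (hmod.measurable_x i j) (hmod.measurable_y i j) (hmod.gaussian i j) (hmod.condMean i j)
    (hσ i j) (by norm_num : (0 : ℝ) ≤ 11)
  exact spectralErrorBound_of_integral_exp_le hmod (fun i ↦ (hLip i).continuous) hK
    (fun i j ↦ (key i j).1) (fun i j ↦ (key i j).2)

/-- Binary responses have exp(11|y|) ≤ e^11, so the constant is numerical and only continuity of the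
link is needed. -/
theorem exists_spectralErrorBound_logistic : ∃ C : ℝ, 0 < C ∧
    ∀ (Ω : Type*) [MeasurableSpace Ω] (μ : Measure Ω) [IsProbabilityMeasure μ]
      (M d k : ℕ) (n : Fin M → ℕ) (B : Matrix (Fin d) (Fin k) ℝ)
      (α : Fin M → EuclideanSpace ℝ (Fin k))
      (x : (i : Fin M) → Fin (n i) → Ω → EuclideanSpace ℝ (Fin d))
      (y : (i : Fin M) → Fin (n i) → Ω → ℝ),
      GeneralModel μ n B (fun i ↦ logisticLink (α i)) x y →
      (∀ i j, ∀ᵐ ω ∂μ, y i j ω = 0 ∨ y i j ω = 1) →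
      SpectralErrorBound μ n B (fun i ↦ logisticLink (α i)) x y C := by
  have hK : 1 ≤ Real.exp 11 := Real.one_le_exp (by norm_num)
  refine ⟨errorConstant (Real.exp 11), errorConstant_pos hK,
    fun Ω _ μ _ M d k n B α x y hmod hy ↦ ?_⟩
  have hle : ∀ i j, ∀ᵐ ω ∂μ, Real.exp (11 * |y i j ω|) ≤ Real.exp 11 := fun i j ↦ by
    filter_upwards [hy i j] with ω hω
    refine Real.exp_le_exp.2 ?_
    rcases hω with h | h <;> simp [h]
  have hint : ∀ i j, Integrable (fun ω ↦ Real.exp (11 * |y i j ω|)) μ := fun i j ↦ by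
    have := hmod.measurable_y i j
    refine (integrable_const (Real.exp 11)).mono' (by fun_prop) ?_
    filter_upwards [hle i j] with ω hω
    rwa [Real.norm_of_nonneg (Real.exp_pos _).le]
  refine spectralErrorBound_of_integral_exp_le hmod (fun i ↦ continuous_logisticLink (α i))
    hK hint fun i j ↦ ?_
  exact (integral_mono_ae (hint i j) (integrable_const _) (hle i j)).trans (by simp)

end SharedRep

theorem mainTheorem3 :
    -- The general nonlinear model.
    (∀ L a m σ : ℝ, ∃ C : ℝ, 0 < C ∧
      ∀ (Ω : Type*) [MeasurableSpace Ω] (μ : Measure Ω) [IsProbabilityMeasure μ]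
        (M d k : ℕ) (n : Fin M → ℕ) (B : Matrix (Fin d) (Fin k) ℝ)
        (h : Fin M → EuclideanSpace ℝ (Fin k) → ℝ)
        (x : (i : Fin M) → Fin (n i) → Ω → EuclideanSpace ℝ (Fin d))
        (y : (i : Fin M) → Fin (n i) → Ω → ℝ),
        SharedRep.GeneralModel μ n B h x y →
        (∀ i, ‖SharedRep.gaussianCorr (h i)‖ ≤ a) →
        (∀ i u v, |h i u - h i v| ≤ L * ‖u - v‖) →
        (∀ i, |SharedRep.gaussianMean (h i)| ≤ m) →
        (∀ i j, SharedRep.CondSubgaussianError μ (x i j) (y i j) σ) →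
        SharedRep.SpectralErrorBound μ n B h x y C) ∧
    -- Logistic regression: binary responses, the constant depends only on the bound on `‖αᵢ‖`.
    (∀ a : ℝ, ∃ C : ℝ, 0 < C ∧
      ∀ (Ω : Type*) [MeasurableSpace Ω] (μ : Measure Ω) [IsProbabilityMeasure μ]
        (M d k : ℕ) (n : Fin M → ℕ) (B : Matrix (Fin d) (Fin k) ℝ)
        (α : Fin M → EuclideanSpace ℝ (Fin k))
        (x : (i : Fin M) → Fin (n i) → Ω → EuclideanSpace ℝ (Fin d))
        (y : (i : Fin M) → Fin (n i) → Ω → ℝ),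
        SharedRep.GeneralModel μ n B (fun i ↦ SharedRep.logisticLink (α i)) x y →
        (∀ i, ‖α i‖ ≤ a) →
        (∀ i j, ∀ᵐ ω ∂μ, y i j ω = 0 ∨ y i j ω = 1) →
        SharedRep.SpectralErrorBound μ n B (fun i ↦ SharedRep.logisticLink (α i)) x y C) ∧
    -- One-hidden-layer ReLU networks.
    (∀ a m σ : ℝ, ∃ C : ℝ, 0 < C ∧
      ∀ (Ω : Type*) [MeasurableSpace Ω] (μ : Measure Ω) [IsProbabilityMeasure μ]
        (M d k : ℕ) (n : Fin M → ℕ) (B : Matrix (Fin d) (Fin k) ℝ)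
        (α : Fin M → EuclideanSpace ℝ (Fin k))
        (x : (i : Fin M) → Fin (n i) → Ω → EuclideanSpace ℝ (Fin d))
        (y : (i : Fin M) → Fin (n i) → Ω → ℝ),
        SharedRep.GeneralModel μ n B (fun i ↦ SharedRep.reluLink (α i)) x y →
        (∀ i, ‖α i‖ ≤ a) →
        (∀ i, |∑ r, α i r| ≤ m) →
        (∀ i j, SharedRep.CondSubgaussianError μ (x i j) (y i j) σ) →
        SharedRep.SpectralErrorBound μ n B (fun i ↦ SharedRep.reluLink (α i)) x y C) := by
  refine ⟨fun L a m σ ↦ ?_, fun a ↦ ?_, fun a m σ ↦ ?_⟩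
  · obtain ⟨C, hC, h⟩ := SharedRep.exists_spectralErrorBound_of_lipschitz L m σ
    exact ⟨C, hC, fun Ω _ μ _ M d k n B g x y hmod _ ↦ h Ω μ M d k n B g x y hmod⟩
  · obtain ⟨C, hC, h⟩ := SharedRep.exists_spectralErrorBound_logistic
    exact ⟨C, hC, fun Ω _ μ _ M d k n B α x y hmod _ ↦ h Ω μ M d k n B α x y hmod⟩
  -- A ReLU network is ‖α‖-Lipschitz by Cauchy-Schwarz, so `a` plays the role of the Lipschitz
  -- constant.
  · obtain ⟨C, hC, h⟩ := SharedRep.exists_spectralErrorBound_of_lipschitz a m σ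
    refine ⟨C, hC, fun Ω _ μ _ M d k n B α x y hmod hα hm hσ ↦ ?_⟩
    exact h Ω μ M d k n B _ x y hmod
      (fun i u v ↦ (SharedRep.abs_reluLink_sub_le (α i) u v).trans
        (mul_le_mul_of_nonneg_right (hα i) (norm_nonneg _)))
      (fun i ↦ (SharedRep.abs_gaussianMean_reluLink_le (α i)).trans (hm i)) hσ
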